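/- Let $(V,Q)$ be a rational quadratic space of signature $(n,2)$ with $n\ge 3$, let $(x\cdot y)=Q(x+y)-Q(x)-Q(y)$, and let $L\subset V$ be a lattice on which $Q$ is $\mathbb{Z}$-valued and which is maximal, i.e. for every prime $p$ the lattice $L\otimes\mathbb{Z}_p$ is maximal among the lattices of $V\otimes\mathbb{Q}_p$ on which $Q$ is $\mathbb{Z}_p$-valued. Let $L^\vee$ be the dual lattice and $\mathrm{disc}(L)=|L^\vee/L|$. Let $r\ge 1$, put $\Lambda=rL$ and $k=1+\frac n2$, and let $\beta\in L/rL$ be an element whose order is coprime to $\mathrm{disc}(L)$. Let $\rho_\Lambda$ be the Weil representation of $\mathrm{Mp}_2(\mathbb{Z})$ on $\mathbb{C}[\Lambda^\vee/\Lambda]$ (with $\rho_\Lambda(T)e_\gamma=e^{2\pi i Q(\gamma)}e_\gamma$) and let $$E_\Lambda(\tau,s)=\frac12\sum_{(\gamma,\varphi)\in\langle T\rangle\backslash \mathrm{Mp}_2(\mathbb{Z})}\varphi(\tau)^{-2k}\,\mathrm{Im}(\gamma\tau)^s\,\rho_\Lambda(\gamma,\varphi)^{-1}e_0 .$$ For an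 integer $m\ge 1$ let $c(\beta,m)$ be the coefficient of $e^{2\pi i m\tau}e_\beta$ in the Fourier expansion of $E_\Lambda(\tau,0)$. Let $C(\beta,m,s)$ be the function such that the coefficient of $e^{2\pi i m u}e_\beta$ in the Fourier expansion of $E_\Lambda(u+iv,s)$ is $C(\beta,m,s)\,\mathcal W_s(4\pi m v)$ for all $v>0$, where $\mathcal W_s(y)=y^{-k/2}W_{\frac k2,\frac{1-k}2-s}(y)$ and $W_{\nu,\mu}$ is Whittaker's function. Put $$b(\beta,m,s)=-\frac{C\left(\beta,m,s-\frac k2\right)\left(s-1+\frac k2\right)}{(2s-1)\,\Gamma\left(s+1-\frac k2\right)},$$ and let $b'$ be the derivative of $b$ in $s$. Theorem. Let $D\ge 1$ be an integer. For every $m\ge 1$ the function $s\mapsto b(\beta,m,s)$ is complex differentiable at $s=\frac k2$. For $m\to\infty$ represented by $\beta+rL$ (that is, $m=Q(\lambda)$ for some $\lambda\in\beta+rL$) and such that $m/D$ is the square of an integer, $$b'\left(\beta,m,\tfrac k2\right)=|c(\beta,m)|\log m+o\bigl(c(\beta,m)\log m\bigr).$$ -/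

import Mathlib

open scoped TensorProduct MatrixGroups

noncomputable section

namespace GreenEstimate

open Module QuadraticMap

variable {V : Type*} [AddCommGroup V] [Module ℚ V]

/-! ### Lattices in a rational quadratic space -/

/-- `Q` takes integral values on `L`, so that `(x · y) = Q (x + y) - Q x - Q y` makes `L`
an even lattice. -/
def IsIntegralOn (Q : QuadraticForm ℚ V) (L : Submodule ℤ V) : Prop :=
  ∀ x ∈ L, ∃ k : ℤ, Q x = k

/-- The dual lattice `{x | (x · y) ∈ ℤ for all y ∈ L}`. -/
def dualLattice (Q : QuadraticForm ℚ V) (L : Submodule ℤ V) : Submodule ℤ V :=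
  LinearMap.BilinForm.dualSubmodule (polarBilin Q) L

/-- The order of the discriminant group `L^∨ / L`, i.e. the absolute value of the discriminant. -/
def disc (Q : QuadraticForm ℚ V) (L : Submodule ℤ V) : ℕ :=
  Nat.card (dualLattice Q L ⧸ L.submoduleOf (dualLattice Q L))

/-- The lattice `r L`. -/
def scale (r : ℕ) (L : Submodule ℤ V) : Submodule ℤ V :=
  L.map ((r : ℤ) • (LinearMap.id : V →ₗ[ℤ] V))

/-- The order of the class of `β` in the group `L / rL`. -/
def orderMod (r : ℕ) (L : Submodule ℤ V) (β : L) : ℕ :=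
  addOrderOf (Submodule.Quotient.mk β : L ⧸ (scale r L).submoduleOf L)

/-- The image of `L ⊗ ℤ_p` in `ℚ_p ⊗ V`. -/
def localLattice (L : Submodule ℤ V) (p : ℕ) [Fact p.Prime] : Submodule ℤ_[p] (ℚ_[p] ⊗[ℚ] V) :=
  Submodule.span ℤ_[p] ((fun x : V => (1 : ℚ_[p]) ⊗ₜ[ℚ] x) '' (L : Set V))

/-- `Q` is `ℤ_p`-valued on the `ℤ_p`-submodule `M` of `ℚ_p ⊗ V`. -/
def IsIntegralAt (Q : QuadraticForm ℚ V) (p : ℕ) [Fact p.Prime]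
    (M : Submodule ℤ_[p] (ℚ_[p] ⊗[ℚ] V)) : Prop :=
  ∀ x ∈ M, ‖Q.baseChange ℚ_[p] x‖ ≤ 1

/-- `L` is maximal at `p`: `L ⊗ ℤ_p` is maximal among the lattices of `ℚ_p ⊗ V` on which the
quadratic form is `ℤ_p`-valued. -/
def IsMaximalAt (Q : QuadraticForm ℚ V) (L : Submodule ℤ V) (p : ℕ) [Fact p.Prime] : Prop :=
  IsIntegralAt Q p (localLattice L p) ∧
    ∀ M : Submodule ℤ_[p] (ℚ_[p] ⊗[ℚ] V), M.FG → IsIntegralAt Q p M →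
      localLattice L p ≤ M → M = localLattice L p

/-- `L` is maximal: it is maximal at all primes. -/
def IsMaximal (Q : QuadraticForm ℚ V) (L : Submodule ℤ V) : Prop :=
  ∀ (p : ℕ) [Fact p.Prime], IsMaximalAt Q L p

/-- `m` is represented by the coset `β + rL`. -/
def RepresentedBy (Q : QuadraticForm ℚ V) (L : Submodule ℤ V) (r : ℕ) (β : V) (m : ℕ) : Prop :=
  ∃ x : V, x - β ∈ scale r L ∧ Q x = m

/-! ### The Weil representation and the vector-valued Eisenstein series -/

/-- `e(x) = exp (2 π i x)`. -/
def e (x : ℚ) : ℂ := Complex.exp (2 * Real.pi * Complex.I * (x : ℂ))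

/-- The integer `b⁻ - b⁺`, where `(b⁺, b⁻)` is the signature of `Q`. -/
def negSig (Q : QuadraticForm ℚ V) : ℤ := (sigNeg Q : ℤ) - (sigPos Q : ℤ)

/-- Matrix coefficients of the Weil representation `ρ_Λ` of `Mp₂(ℤ)` on `ℂ[Λ^∨/Λ]`, in closed
form (Shintani's formula): for `γ = (a, b; c, d)` and its lift `(γ, √(cτ + d))` (principal branch),
`ρ_Λ(γ, √(cτ + d)) e_β = ∑_α weilCoeff Q Λ γ α β • e_α`.
It is the representation determined by `ρ_Λ(T) e_β = e(Q β) e_β` and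
`ρ_Λ(S) e_β = √i^{b⁻ - b⁺} |Λ^∨/Λ|^{-1/2} ∑_α e(-(α · β)) e_α`.
The classes `α, β` are given by representatives in `Λ^∨`, and `√i = exp (π i / 4)`. -/
def weilCoeff (Q : QuadraticForm ℚ V) (Λ : Submodule ℤ V) (γ : SL(2, ℤ)) (α β : V) : ℂ :=
  let a : ℤ := γ 0 0
  let b : ℤ := γ 0 1
  let c : ℤ := γ 1 0
  let d : ℤ := γ 1 1
  let i₈ : ℂ := Complex.exp (Real.pi * Complex.I / 4)
  open Classical in
  if c = 0 then
    if α - a • β ∈ Λ then i₈ ^ (negSig Q * (1 - d.sign)) * e (a * b * Q α) else 0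
  else
    i₈ ^ (negSig Q * c.sign) /
        (Real.sqrt (|(c : ℝ)| ^ finrank ℚ V) * Real.sqrt (disc Q Λ) : ℝ) *
      ∑ᶠ x : Λ ⧸ LinearMap.range (LinearMap.lsmul ℤ Λ c),
        e ((a * Q (α + (x.out : Λ)) - polar Q (α + (x.out : Λ)) β + d * Q β) / c)

/-- The weight `k = 1 + n/2`, for signature `(n, 2)`. -/
def weight (n : ℕ) : ℝ := 1 + n / 2

/-- The `e_β`-component of the non-holomorphic Eisenstein series of weight `k = 1 + n/2`
`E_Λ(τ, s) = (1/2) ∑_{(γ, φ) ∈ ⟨T⟩ \ Mp₂(ℤ)} φ(τ)^{-2k} Im(γτ)^s ρ_Λ(γ, φ)⁻¹ e_0`.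
The two lifts `(γ, ±φ)` contribute equally, which cancels the factor `1/2` and leaves a sum over
`⟨T⟩ \ SL₂(ℤ)`; as `ρ_Λ` is unitary, the `e_β`-component of `ρ_Λ(γ, φ)⁻¹ e_0` is the complex
conjugate of `weilCoeff Q Λ γ 0 β`. -/
def eisenstein (Q : QuadraticForm ℚ V) (Λ : Submodule ℤ V) (n : ℕ) (β : V)
    (τ : UpperHalfPlane) (s : ℂ) : ℂ :=
  ∑' x : Quotient (QuotientGroup.rightRel (Subgroup.zpowers ModularGroup.T)),
    let γ : SL(2, ℤ) := x.out
    (((γ 1 0 : ℤ) : ℂ) * τ + ((γ 1 1 : ℤ) : ℂ)) ^ (-(weight n : ℂ)) *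
      ((γ • τ).im : ℂ) ^ s * star (weilCoeff Q Λ γ 0 β)

/-- The Fourier coefficient `c_0(β, m, s, v) = ∫_0^1 E_β(u + iv, s) e(-mu) du` at height `v > 0`,
so that `E_β(u + iv, s) = ∑_m c_0(β, m, s, v) e(mu)`. -/
def eisensteinCoeff (Q : QuadraticForm ℚ V) (Λ : Submodule ℤ V) (n : ℕ) (β : V) (m : ℕ)
    (s : ℂ) (v : ℝ) (hv : 0 < v) : ℂ :=
  ∫ u in (0 : ℝ)..1,
    eisenstein Q Λ n β ⟨(u : ℂ) + (v : ℂ) * Complex.I, by simpa using hv⟩ s *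
      Complex.exp (-(2 * Real.pi * Complex.I * m * u))

/-- `c(β, m)`: the `(β, m)`-th Fourier coefficient of the Eisenstein series
`E_Λ(τ) = E_Λ(τ, 0) = ∑_β ∑_m c(β, m) exp (2 π i m τ) e_β`, computed on the line `Im τ = 1`. -/
def coeffC (Q : QuadraticForm ℚ V) (Λ : Submodule ℤ V) (n : ℕ) (β : V) (m : ℕ) : ℂ :=
  Complex.exp (2 * Real.pi * m) * eisensteinCoeff Q Λ n β m 0 1 one_pos

/-! ### The Whittaker function and the function `C(β, m, s)` -/

/-- Tricomi's confluent hypergeometric function `U(a, b, y)` for `Re a > -1` and `y > 0`: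
the formula `Γ(a)⁻¹ ∫_0^∞ t^(a-1) exp (-yt) (1+t)^(b-a-1) dt` for `Re a > 0`, integrated by parts
once so that it also makes sense (and is analytic in `a`) near `a = 0`. -/
def tricomiU (a b : ℂ) (y : ℝ) : ℂ :=
  (Complex.Gamma (a + 1))⁻¹ * ∫ t in Set.Ioi (0 : ℝ),
    (t : ℂ) ^ a * Complex.exp (-(y * t)) * ((1 + t : ℝ) : ℂ) ^ (b - a - 2) *
      (y * (1 + t) - (b - a - 1))

/-- Whittaker's function
`W_{ν, μ}(y) = exp (-y/2) y^(μ + 1/2) U(μ - ν + 1/2, 1 + 2μ, y)`, `y > 0`. -/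
def whittakerW (ν μ : ℂ) (y : ℝ) : ℂ :=
  Complex.exp (-(y / 2)) * (y : ℂ) ^ (μ + 1 / 2) * tricomiU (μ - ν + 1 / 2) (1 + 2 * μ) y

/-- `𝒲_s(y) = y^(-k/2) W_{k/2, (k-1)/2 + s}(y)` for `y > 0`
(recall that `W_{ν, μ} = W_{ν, -μ}`). One has `𝒲_0(y) = exp (-y/2)`. -/
def curlyW (n : ℕ) (s : ℂ) (y : ℝ) : ℂ :=
  (y : ℂ) ^ (-(weight n : ℂ) / 2) *
    whittakerW ((weight n : ℂ) / 2) (((weight n : ℂ) - 1) / 2 + s) y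

/-- The function `C(β, m, s)`, `m > 0`, given by `c_0(β, m, s, v) = C(β, m, s) 𝒲_s(4πmv)`.
The quotient `c_0(β, m, s, v) / 𝒲_s(4πmv)` does not depend on the height `v`; it is taken here
at the height `v = 1 / (4πm)`. (For `m = 0` the value is irrelevant and set to `0`.) -/
def bigC (Q : QuadraticForm ℚ V) (Λ : Submodule ℤ V) (n : ℕ) (β : V) (m : ℕ) (s : ℂ) : ℂ :=
  if hm : 0 < m then
    eisensteinCoeff Q Λ n β m s (1 / (4 * Real.pi * m)) (by positivity) / curlyW n s 1
  else 0

/-- `b(β, m, s) = - C(β, m, s - k/2) (s - 1 + k/2) / ((2s - 1) Γ(s + 1 - k/2))`. -/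
def smallB (Q : QuadraticForm ℚ V) (Λ : Submodule ℤ V) (n : ℕ) (β : V) (m : ℕ) (s : ℂ) : ℂ :=
  -(bigC Q Λ n β m (s - (weight n : ℂ) / 2) * (s - 1 + (weight n : ℂ) / 2)) /
    ((2 * s - 1) * Complex.Gamma (s + 1 - (weight n : ℂ) / 2))

end GreenEstimate

end

/-! Unfolding the Eisenstein series over bottom rows `(c, d)` writes its `m`-th coefficient, `m ≥
1`, as a constant times an archimedean integral times a Dirichlet series `F_m(s) = ∑ a_m(c)
c^(-2s)`. Here `a_m(c)` is the normalised sum, over units `d` mod `c`, of Gauss sums of `f_m(x) =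
Q(x - β) - m` on `Λ` (`hasSum_eisensteinCoeff`). By homogeneity of the integral, the archimedean
part of `b(β, m, s)` depends on `m` only through `(4πm)^(s + k/2 - 1)` (`smallB_eq`). Hence `c(β, m)
= -T_m F_m(0)` with `T_m ≥ 0`, while `b' = T_m (F_m'(0) + F_m(0) (log(4πm) + const))` at `k/2`. So
`b' - |c(β, m)| log m` is even `O(c(β, m))`, as soon as `F_m'(0)` is bounded and `F_m(0)` is bounded
below by a positive constant, both uniformly in `m`.

Upper bound: by Weyl differencing, a Gauss sum modulo `c` in `N = n + 2 ≥ 5` variables is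
`O(c^(N/2))`, with a constant depending only on the quadratic part (`norm_gauss_le`). Thus `a_m(c) =
O(c^(-3/2))`, the series converges absolutely near `s = 0`, and Cauchy's estimate bounds its
derivative.

Lower bound: `F_m(0)` is a singular series. Its partial sums over the divisors of `c` are densities
of zeros of `f_m` modulo `c`, hence products of densities at prime powers. At large primes these are
`1 - O(p^(-3/2))`. At the other primes Hensel's argument bounds them below once `f_m` has an
approximate zero whose gradient has valuation bounded independently of `m`
(`exists_le_singularSeries`).

Such zeros come from the hypotheses on `L` and `β`. Maximality forces the radical of `L` modulo `p`
to have dimension at most `2`. By Chevalley–Warning there is then a nonsingular isotropic vector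
modulo `p`, and `L` represents every integer nonsingularly modulo all powers of `p`. If `p` divides
`disc L`, the condition on the order of `β` puts `β` in `rL` locally at `p`, which reduces the coset
to a scaled lattice. Otherwise `L` is self-dual at `p`, and the gradient at a vector of the coset is
controlled by the power of `p` dividing that vector (`exists_approxZero_coset`). -/

noncomputable section

namespace GreenEstimate

/-! ### Quadratic polynomials modulo integers -/

section QuadPoly

variable {N : ℕ} (A : Matrix (Fin N) (Fin N) ℤ) (b : Fin N → ℤ) (c₀ : ℤ)

/-- The quadratic polynomial `xᵀ A x + b x + c₀` with integral coefficients over a ring. -/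
def quadPoly {R : Type*} [CommRing R] (x : Fin N → R) : R :=
  ∑ i, ∑ j, (A i j : R) * x i * x j + ∑ i, (b i : R) * x i + (c₀ : R)

/-- The polar form `xᵀ (A + Aᵀ) y` of `quadPoly`. -/
def polarPoly {R : Type*} [CommRing R] (x y : Fin N → R) : R :=
  ∑ i, ((A + A.transpose).map (Int.cast : ℤ → R)).mulVec x i * y i

lemma polarPoly_eq {R : Type*} [CommRing R] (x y : Fin N → R) :
    polarPoly A x y = ∑ i, ∑ j, (A i j : R) * (x i * y j + y i * x j) := by
  have h1 : ∑ i, ∑ j, (A i j : R) * (x i * y j + y i * x j) =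
      ∑ i, ∑ j, (A i j : R) * (y i * x j) + ∑ i, ∑ j, (A j i : R) * (y i * x j) := by
    rw [Finset.sum_comm (f := fun i j => (A j i : R) * (y i * x j))]
    simp only [← Finset.sum_add_distrib]
    exact Finset.sum_congr rfl fun i _ => Finset.sum_congr rfl fun j _ => by ring
  rw [h1, ← Finset.sum_add_distrib]
  refine Finset.sum_congr rfl fun i _ => ?_
  simp only [Matrix.mulVec, dotProduct, Finset.sum_mul, Matrix.map_apply, Matrix.add_apply,
    Matrix.transpose_apply, ← Finset.sum_add_distrib]
  exact Finset.sum_congr rfl fun j _ => by push_cast; ring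

lemma map_quadPoly {R S : Type*} [CommRing R] [CommRing S] (f : R →+* S) (x : Fin N → R) :
    f (quadPoly A b c₀ x) = quadPoly A b c₀ (fun i => f (x i)) := by
  simp [quadPoly]

lemma quadPoly_add {R : Type*} [CommRing R] (x y : Fin N → R) :
    quadPoly A b c₀ (x + y) = quadPoly A b c₀ x + quadPoly A b 0 y + polarPoly A x y := by
  rw [polarPoly_eq]
  simp only [quadPoly, Pi.add_apply, mul_add, Finset.sum_add_distrib, add_mul, Int.cast_zero,
    ← mul_assoc]
  ring

lemma polarPoly_smul {R : Type*} [CommRing R] (x y : Fin N → R) (t : R) :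
    polarPoly A x (t • y) = t * polarPoly A x y := by
  simp only [polarPoly, Finset.mul_sum, Pi.smul_apply, smul_eq_mul]
  exact Finset.sum_congr rfl fun j _ => by ring

lemma polarPoly_comm {R : Type*} [CommRing R] (x y : Fin N → R) :
    polarPoly A x y = polarPoly A y x := by
  simp only [polarPoly_eq]
  exact Finset.sum_congr rfl fun i _ => Finset.sum_congr rfl fun j _ => by ring

lemma quadPoly_smul {R : Type*} [CommRing R] (y : Fin N → R) (t : R) :
    quadPoly A b 0 (t • y) = t ^ 2 * (∑ i, ∑ j, (A i j : R) * y i * y j) +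
      t * ∑ i, (b i : R) * y i := by
  simp only [quadPoly, Finset.mul_sum, Pi.smul_apply, smul_eq_mul, Int.cast_zero, add_zero]
  congr 1
  · exact Finset.sum_congr rfl fun i _ => Finset.sum_congr rfl fun j _ => by ring
  · exact Finset.sum_congr rfl fun j _ => by ring

/-- The number of zeros of a quadratic polynomial modulo `c`. -/
def numZeros (c : ℕ) : ℕ := Nat.card {x : Fin N → ZMod c // quadPoly A b c₀ x = 0}

lemma numZeros_one : numZeros A b c₀ 1 = 1 := by
  rw [numZeros, Nat.card_eq_one_iff_unique]
  refine ⟨⟨fun x y => Subtype.ext (funext fun i => ?_)⟩, ⟨0, ?_⟩⟩ <;>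
    exact Subsingleton.elim (α := ZMod 1) _ _

lemma numZeros_mul {c d : ℕ} (h : c.Coprime d) :
    numZeros A b c₀ (c * d) = numZeros A b c₀ c * numZeros A b c₀ d := by
  rw [numZeros, numZeros, numZeros, ← Nat.card_prod]
  let φ := ZMod.chineseRemainder h
  refine Nat.card_congr
    { toFun := fun x => (⟨fun i => (φ (x.1 i)).1, ?_⟩, ⟨fun i => (φ (x.1 i)).2, ?_⟩)
      invFun := fun y => ⟨fun i => φ.symm (y.1.1 i, y.2.1 i), ?_⟩
      left_inv := fun x => by simp
      right_inv := fun y => by simp }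
  · have := map_quadPoly A b c₀ ((RingHom.fst _ _).comp φ.toRingHom) x.1
    rw [x.2, map_zero] at this
    exact this.symm
  · have := map_quadPoly A b c₀ ((RingHom.snd _ _).comp φ.toRingHom) x.1
    rw [x.2, map_zero] at this
    exact this.symm
  · apply φ.injective
    rw [map_zero]
    have h1 := map_quadPoly A b c₀ ((RingHom.fst _ _).comp φ.toRingHom)
      fun i => φ.symm (y.1.1 i, y.2.1 i)
    have h2 := map_quadPoly A b c₀ ((RingHom.snd _ _).comp φ.toRingHom)
      fun i => φ.symm (y.1.1 i, y.2.1 i)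
    refine Prod.ext (h1.trans ?_) (h2.trans ?_)
    · simpa using y.1.2
    · simpa using y.2.2

/-- The zero counting function as an arithmetic function. -/
def numZerosFun : ArithmeticFunction ℕ :=
  ⟨fun c => if c = 0 then 0 else numZeros A b c₀ c, by simp⟩

lemma isMultiplicative_numZerosFun : (numZerosFun A b c₀).IsMultiplicative := by
  refine ⟨by simp [numZerosFun, numZeros_one], fun {c d} h => ?_⟩
  simp only [numZerosFun, ArithmeticFunction.coe_mk]
  by_cases hc : c = 0
  · simp [hc]
  by_cases hd : d = 0
  · simp [hd]
  simp [hc, hd, numZeros_mul A b c₀ h]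

lemma numZeros_eq_prod {c : ℕ} (hc : c ≠ 0) :
    numZeros A b c₀ c = c.factorization.prod fun p j => numZeros A b c₀ (p ^ j) := by
  have := (isMultiplicative_numZerosFun A b c₀).multiplicative_factorization _ hc
  simp only [numZerosFun, ArithmeticFunction.coe_mk, hc, if_false] at this
  rw [this]
  refine Finset.prod_congr rfl fun p hp => ?_
  exact if_neg (pow_ne_zero _ (Nat.prime_of_mem_primeFactors hp).ne_zero)

/-! ### Gauss sums -/

/-- The Gauss sum `∑ e(d f(x) / c)` over `x` modulo `c` of a quadratic polynomial `f`. -/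
def gauss (c : ℕ) [NeZero c] (d : ZMod c) : ℂ :=
  ∑ x : Fin N → ZMod c, ZMod.stdAddChar (d * quadPoly A b c₀ x)

/-- The sum of the Gauss sums modulo `c` over all units modulo `c`. -/
def unitGauss (c : ℕ) : ℂ :=
  if h : c = 0 then 0 else
    haveI := NeZero.mk h
    ∑ d : (ZMod c)ˣ, gauss A b c₀ c (d : ZMod c)

lemma unitGauss_eq (c : ℕ) [NeZero c] :
    unitGauss A b c₀ c = ∑ d : (ZMod c)ˣ, gauss A b c₀ c (d : ZMod c) := by
  rw [unitGauss, dif_neg (NeZero.ne c)]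

/-- Orthogonality: summed over `d`, the characters detect the zeros of the polynomial. -/
lemma sum_gauss (c : ℕ) [NeZero c] :
    ∑ d : ZMod c, gauss A b c₀ c d = (c : ℂ) * numZeros A b c₀ c := by
  classical
  simp only [gauss]
  rw [Finset.sum_comm]
  have h : ∀ x : Fin N → ZMod c, ∑ d : ZMod c, (ZMod.stdAddChar (d * quadPoly A b c₀ x) : ℂ) =
      if quadPoly A b c₀ x = 0 then (c : ℂ) else 0 := by
    intro x
    rw [AddChar.sum_mulShift _ (ZMod.isPrimitive_stdAddChar c)]
    simp
  simp only [h]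
  rw [← Finset.sum_filter, Finset.sum_const, numZeros, Nat.card_eq_fintype_card,
    Fintype.card_subtype, nsmul_eq_mul, mul_comm]

lemma star_stdAddChar {c : ℕ} [NeZero c] (t : ZMod c) :
    star (ZMod.stdAddChar t : ℂ) = ZMod.stdAddChar (-t) := by
  rw [ZMod.stdAddChar_apply, ZMod.stdAddChar_apply, AddChar.map_neg_eq_inv,
    Circle.coe_inv_eq_conj]
  rfl

lemma star_gauss (c : ℕ) [NeZero c] (d : ZMod c) :
    star (gauss A b c₀ c d) = gauss A b c₀ c (-d) := by
  simp only [gauss, star_sum, star_stdAddChar, neg_mul]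

/-- The units are stable under `d ↦ -d`, which conjugates the Gauss sums. The reality of the
singular series rests on this. -/
lemma star_unitGauss (c : ℕ) : star (unitGauss A b c₀ c) = unitGauss A b c₀ c := by
  by_cases hc : c = 0
  · simp [unitGauss, hc]
  have := NeZero.mk hc
  rw [unitGauss_eq, star_sum, ← Equiv.sum_comp (Equiv.neg (ZMod c)ˣ)]
  refine Finset.sum_congr rfl fun d _ => ?_
  simp [star_gauss]

lemma card_fiber_castHom {e f : ℕ} [NeZero e] [NeZero f] (y : Fin N → ZMod e) :
    (Finset.univ.filter fun x : Fin N → ZMod (e * f) =>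
      (fun i => ZMod.castHom (Dvd.intro f rfl) (ZMod e) (x i)) = y).card = f ^ N := by
  classical
  set φ := ZMod.castHom (Dvd.intro f rfl : e ∣ e * f) (ZMod e)
  have hsurj : Function.Surjective φ := ZMod.castHom_surjective _
  have hconst (s t : ZMod e) : (Finset.univ.filter fun x => φ x = s).card =
      (Finset.univ.filter fun x => φ x = t).card :=
    AddMonoidHom.card_fiber_eq_of_mem_range φ.toAddMonoidHom (hsurj s) (hsurj t)
  have hcard (s : ZMod e) : (Finset.univ.filter fun x => φ x = s).card = f := by
    have h1 := Finset.card_eq_sum_card_fiberwise (f := φ) (s := Finset.univ) (t := Finset.univ)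
      (fun x _ => Finset.mem_coe.2 (Finset.mem_univ _))
    rw [Finset.sum_congr rfl fun t _ => hconst t s] at h1
    simp only [Finset.card_univ, ZMod.card, Finset.sum_const, smul_eq_mul] at h1
    exact (Nat.eq_of_mul_eq_mul_left (NeZero.pos e) h1).symm
  have : (Finset.univ.filter fun x : Fin N → ZMod (e * f) => (fun i => φ (x i)) = y) =
      Fintype.piFinset fun i => Finset.univ.filter fun t => φ t = y i := by
    ext x
    simp [funext_iff]
  rw [this, Fintype.card_piFinset, Finset.prod_congr rfl fun i _ => hcard (y i)]
  simp

lemma stdAddChar_mul_castHom {e f : ℕ} [NeZero e] [NeZero f] [NeZero (e * f)] (d : ℕ)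
    (t : ZMod (e * f)) : (ZMod.stdAddChar (((f * d : ℕ) : ZMod (e * f)) * t) : ℂ) =
      ZMod.stdAddChar ((d : ZMod e) * ZMod.castHom (Dvd.intro f rfl) (ZMod e) t) := by
  obtain ⟨z, rfl⟩ := ZMod.intCast_surjective t
  have h1 : ((f * d : ℕ) : ZMod (e * f)) * (z : ZMod (e * f)) =
      (((f * d : ℕ) * z : ℤ) : ZMod (e * f)) := by push_cast; ring
  have h2 : (d : ZMod e) * ZMod.castHom (Dvd.intro f rfl : e ∣ e * f) (ZMod e) (z : ZMod (e * f)) =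
      ((d * z : ℤ) : ZMod e) := by rw [map_intCast]; push_cast; ring
  rw [h1, h2, ZMod.stdAddChar_coe, ZMod.stdAddChar_coe]
  congr 1
  have he : (e : ℂ) ≠ 0 := Nat.cast_ne_zero.2 (NeZero.ne e)
  have hf : (f : ℂ) ≠ 0 := Nat.cast_ne_zero.2 (NeZero.ne f)
  push_cast
  field_simp

/-- Since `fd/(ef) = d/e`, the summand depends only on `x` modulo `e`, and every class has `f^N`
lifts. -/
lemma gauss_mul (e f : ℕ) [NeZero e] [NeZero f] [NeZero (e * f)] (d : ℕ) :
    gauss A b c₀ (e * f) ((f * d : ℕ) : ZMod (e * f)) = (f : ℂ) ^ N * gauss A b c₀ e (d : ZMod e) := by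
  classical
  simp only [gauss, stdAddChar_mul_castHom, map_quadPoly]
  rw [← Finset.sum_fiberwise (s := Finset.univ) (g := fun x : Fin N → ZMod (e * f) =>
    (fun i => ZMod.castHom (Dvd.intro f rfl) (ZMod e) (x i))), Finset.mul_sum]
  refine Finset.sum_congr rfl fun y _ => ?_
  rw [Finset.sum_congr rfl fun x hx => by rw [(Finset.mem_filter.1 hx).2], Finset.sum_const,
    card_fiber_castHom, nsmul_eq_mul]
  push_cast
  rfl

/-- Sorting `d` modulo `c` by the reduced denominator `e = c / gcd(c, d)` of `d/c` turns the
complete sum, which counts zeros, into unit sums at the divisors of `c`. -/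
lemma sum_unitGauss_divisors (c : ℕ) (hc : c ≠ 0) :
    ∑ e ∈ c.divisors, ((c / e : ℕ) : ℂ) ^ N * unitGauss A b c₀ e = (c : ℂ) * numZeros A b c₀ c := by
  have := NeZero.mk hc
  rw [← sum_gauss]
  have h1 : ∑ d : ZMod c, gauss A b c₀ c d = ∑ d ∈ Finset.range c, gauss A b c₀ c (d : ZMod c) := by
    refine Finset.sum_bij' (fun d _ => d.val) (fun d _ => (d : ZMod c)) ?_ ?_ ?_ ?_ ?_
    · exact fun d _ => Finset.mem_range.2 (ZMod.val_lt d)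
    · simp
    · simp
    · exact fun d hd => ZMod.val_cast_of_lt (Finset.mem_range.1 hd)
    · simp
  rw [h1, ← Finset.sum_fiberwise_of_maps_to (s := Finset.range c) (g := fun d => c / c.gcd d)
    (t := c.divisors)
    (fun d _ => Nat.mem_divisors.2 ⟨Nat.div_dvd_of_dvd (Nat.gcd_dvd_left _ _), hc⟩)]
  refine Finset.sum_congr rfl fun e he => ?_
  obtain ⟨f, rfl⟩ := (Nat.mem_divisors.1 he).1
  have he0 : e ≠ 0 := left_ne_zero_of_mul hc
  have hf0 : f ≠ 0 := right_ne_zero_of_mul hc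
  have := NeZero.mk he0
  have := NeZero.mk hf0
  rw [Nat.mul_div_cancel_left _ (Nat.pos_of_ne_zero he0), unitGauss_eq, Finset.mul_sum]
  have key : ∀ d, e * f / (e * f).gcd d = e → ∃ d', d = f * d' ∧ e.Coprime d' := by
    intro d hd
    have h2 : (e * f).gcd d = f := by
      have h3 := Nat.div_mul_cancel (Nat.gcd_dvd_left (e * f) d)
      rw [hd] at h3
      exact Nat.eq_of_mul_eq_mul_left (Nat.pos_of_ne_zero he0) h3
    obtain ⟨d', rfl⟩ : f ∣ d := h2 ▸ Nat.gcd_dvd_right _ _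
    refine ⟨d', rfl, ?_⟩
    rw [mul_comm e f, Nat.gcd_mul_left] at h2
    exact Nat.eq_of_mul_eq_mul_left (Nat.pos_of_ne_zero hf0) (by rw [h2, mul_one])
  refine Finset.sum_bij (fun u _ => f * (u : ZMod e).val) ?_ ?_ ?_ ?_
  · intro u _
    have hu := ZMod.val_coe_unit_coprime u
    refine Finset.mem_filter.2 ⟨Finset.mem_range.2 ?_, ?_⟩
    · rw [mul_comm e f]
      exact Nat.mul_lt_mul_of_pos_left (ZMod.val_lt _) (Nat.pos_of_ne_zero hf0)
    · rw [mul_comm e f, Nat.gcd_mul_left, hu.symm.gcd_eq_one, mul_one,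
        Nat.mul_div_cancel_left _ (Nat.pos_of_ne_zero hf0)]
  · intro u _ v _ h
    exact Units.ext (ZMod.val_injective e (Nat.eq_of_mul_eq_mul_left (Nat.pos_of_ne_zero hf0) h))
  · intro d hd
    obtain ⟨hd1, hd2⟩ := Finset.mem_filter.1 hd
    obtain ⟨d', rfl, h⟩ := key d hd2
    have hlt : d' < e := by
      rw [Finset.mem_range, mul_comm e f] at hd1
      exact Nat.lt_of_mul_lt_mul_left hd1
    exact ⟨ZMod.unitOfCoprime d' h.symm, Finset.mem_univ _, by
      rw [ZMod.coe_unitOfCoprime, ZMod.val_cast_of_lt hlt]⟩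
  · intro u _
    rw [gauss_mul, ZMod.natCast_zmod_val]

/-- Multiplying by the adjugate shows that `det S` kills every coordinate of a kernel vector, and a
cyclic group has at most `|det S|` elements killed by `det S`. -/
lemma card_mulVec_eq_zero_le (S : Matrix (Fin N) (Fin N) ℤ) (hS : S.det ≠ 0) (c : ℕ) [NeZero c] :
    (Finset.univ.filter fun h : Fin N → ZMod c =>
      (S.map (Int.cast : ℤ → ZMod c)).mulVec h = 0).card ≤ S.det.natAbs ^ N := by
  classical
  have hsub : (Finset.univ.filter fun h : Fin N → ZMod c =>
      (S.map (Int.cast : ℤ → ZMod c)).mulVec h = 0) ⊆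
      Fintype.piFinset fun _ => Finset.univ.filter fun t : ZMod c => S.det.natAbs • t = 0 := by
    intro h hh
    have h0 := (Finset.mem_filter.1 hh).2
    have h1 : ((S.map (Int.cast : ℤ → ZMod c)).adjugate * S.map (Int.cast : ℤ → ZMod c)).mulVec h
        = 0 := by
      rw [← Matrix.mulVec_mulVec, h0, Matrix.mulVec_zero]
    have hdet : (S.map (Int.cast : ℤ → ZMod c)).det = (S.det : ZMod c) :=
      ((Int.castRingHom (ZMod c)).map_det S).symm
    rw [Matrix.adjugate_mul, hdet, Matrix.smul_mulVec, Matrix.one_mulVec] at h1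
    simp only [Fintype.mem_piFinset, Finset.mem_filter, Finset.mem_univ, true_and]
    intro i
    have h2 := congrFun h1 i
    simp only [Pi.smul_apply, smul_eq_mul, Pi.zero_apply] at h2
    have h3 : S.det • h i = 0 := by rw [zsmul_eq_mul]; exact h2
    rcases Int.natAbs_eq S.det with h4 | h4
    · rw [h4, natCast_zsmul] at h3; exact h3
    · rw [h4, neg_smul, natCast_zsmul, neg_eq_zero] at h3; exact h3
  refine (Finset.card_le_card hsub).trans ?_
  rw [Fintype.card_piFinset]
  refine (Finset.prod_le_pow_card _ _ S.det.natAbs fun i _ => ?_).trans (by simp)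
  exact IsAddCyclic.card_nsmul_eq_zero_le (Int.natAbs_pos.2 hS)

lemma sum_stdAddChar_dotProduct (c : ℕ) [NeZero c] (w : Fin N → ZMod c) :
    ∑ y : Fin N → ZMod c, (ZMod.stdAddChar (∑ i, w i * y i) : ℂ) =
      if w = 0 then (c : ℂ) ^ N else 0 := by
  classical
  have h1 : ∀ y : Fin N → ZMod c, (ZMod.stdAddChar (∑ i, w i * y i) : ℂ) =
      ∏ i, ZMod.stdAddChar (y i * w i) := by
    intro y
    have h := map_prod (ZMod.stdAddChar (N := c)).toMonoidHom
      (fun i => Multiplicative.ofAdd (w i * y i)) Finset.univ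
    rw [← ofAdd_sum] at h
    exact h.trans (Finset.prod_congr rfl fun i _ => by rw [mul_comm]; rfl)
  simp only [h1]
  rw [← Fintype.piFinset_univ, ← Finset.prod_univ_sum (fun _ => Finset.univ)
    (fun i (t : ZMod c) => (ZMod.stdAddChar (t * w i) : ℂ))]
  simp only [AddChar.sum_mulShift _ (ZMod.isPrimitive_stdAddChar c)]
  by_cases hw : w = 0
  · simp [hw, ZMod.card]
  · rw [if_neg hw]
    obtain ⟨i, hi⟩ := Function.ne_iff.1 hw
    exact Finset.prod_eq_zero (Finset.mem_univ i) (by simp [show w i ≠ 0 from hi])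

/-- Weyl differencing: in `|G|²` the substitution `x = y + h` leaves a phase linear in `y`, so the
sum over `y` vanishes unless `h` lies in the kernel of the Gram matrix modulo `c`. The bound
involves neither `b` nor `c₀`, which makes it uniform in `m` later. -/
lemma norm_gauss_sq_le (hA : (A + A.transpose).det ≠ 0) (c : ℕ) [NeZero c] (d : (ZMod c)ˣ) :
    ‖gauss A b c₀ c d‖ ^ 2 ≤ (c : ℝ) ^ N * ((A + A.transpose).det.natAbs : ℝ) ^ N := by
  classical
  have h1 : ((‖gauss A b c₀ c d‖ ^ 2 : ℝ) : ℂ) = ∑ h : Fin N → ZMod c,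
      ZMod.stdAddChar ((d : ZMod c) * quadPoly A b 0 h) *
        if ((A + A.transpose).map (Int.cast : ℤ → ZMod c)).mulVec h = 0 then (c : ℂ) ^ N else 0 := by
    rw [← Complex.normSq_eq_norm_sq, Complex.normSq_eq_conj_mul_self]
    change star (gauss A b c₀ c d) * _ = _
    rw [gauss, star_sum, Finset.sum_mul_sum]
    have h2 : ∀ y : Fin N → ZMod c, ∑ x, star (ZMod.stdAddChar ((d : ZMod c) * quadPoly A b c₀ y) : ℂ) *
        ZMod.stdAddChar ((d : ZMod c) * quadPoly A b c₀ x) = ∑ h : Fin N → ZMod c,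
        ZMod.stdAddChar ((d : ZMod c) * quadPoly A b 0 h) *
          ZMod.stdAddChar ((d : ZMod c) * polarPoly A h y) := by
      intro y
      rw [← Equiv.sum_comp (Equiv.addLeft y)]
      refine Finset.sum_congr rfl fun h _ => ?_
      rw [Equiv.coe_addLeft, star_stdAddChar, quadPoly_add, ← AddChar.map_add_eq_mul,
        ← AddChar.map_add_eq_mul, polarPoly_comm A y h]
      congr 1
      ring
    rw [Finset.sum_congr rfl fun y _ => h2 y, Finset.sum_comm]
    refine Finset.sum_congr rfl fun h _ => ?_
    rw [← Finset.mul_sum]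
    congr 1
    have h3 := sum_stdAddChar_dotProduct c
      ((d : ZMod c) • ((A + A.transpose).map (Int.cast : ℤ → ZMod c)).mulVec h)
    have h4 : ((d : ZMod c) • ((A + A.transpose).map (Int.cast : ℤ → ZMod c)).mulVec h = 0) ↔
        (((A + A.transpose).map (Int.cast : ℤ → ZMod c)).mulVec h = 0) :=
      IsUnit.smul_eq_zero d.isUnit
    rw [if_congr h4 rfl rfl] at h3
    rw [← h3]
    simp only [polarPoly, Finset.mul_sum, Pi.smul_apply, smul_eq_mul, mul_assoc]
  have h5 : ‖gauss A b c₀ c d‖ ^ 2 = ‖((‖gauss A b c₀ c d‖ ^ 2 : ℝ) : ℂ)‖ := by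
    rw [Complex.norm_real, Real.norm_of_nonneg (by positivity)]
  rw [h5, h1]
  refine (norm_sum_le _ _).trans ?_
  have h6 : ∀ h : Fin N → ZMod c, ‖(ZMod.stdAddChar ((d : ZMod c) * quadPoly A b 0 h) : ℂ) *
      (if ((A + A.transpose).map (Int.cast : ℤ → ZMod c)).mulVec h = 0 then (c : ℂ) ^ N else 0)‖ =
      if ((A + A.transpose).map (Int.cast : ℤ → ZMod c)).mulVec h = 0 then (c : ℝ) ^ N else 0 := by
    intro h
    rw [norm_mul, AddChar.norm_apply, one_mul]
    split_ifs <;> simp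
  rw [Finset.sum_congr rfl fun h _ => h6 h, ← Finset.sum_filter, Finset.sum_const, nsmul_eq_mul,
    mul_comm]
  gcongr
  exact_mod_cast card_mulVec_eq_zero_le _ hA c

/-- A bound for the Gauss sums of polynomials with quadratic part `A`. -/
def gaussBound : ℝ := √(((A + A.transpose).det.natAbs : ℝ) ^ N)

lemma norm_gauss_le (hA : (A + A.transpose).det ≠ 0) (c : ℕ) [NeZero c] (d : (ZMod c)ˣ) :
    ‖gauss A b c₀ c d‖ ≤ gaussBound A * (c : ℝ) ^ (N / 2 : ℝ) := by
  have h := Real.sqrt_le_sqrt (norm_gauss_sq_le A b c₀ hA c d)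
  rw [Real.sqrt_sq (norm_nonneg _), mul_comm, Real.sqrt_mul (by positivity)] at h
  refine h.trans_eq ?_
  rw [gaussBound, Real.sqrt_eq_rpow ((c : ℝ) ^ N), ← Real.rpow_natCast_mul (by positivity)]
  congr 2
  ring

lemma norm_unitGauss_le (hA : (A + A.transpose).det ≠ 0) (c : ℕ) :
    ‖unitGauss A b c₀ c‖ ≤ gaussBound A * (c : ℝ) ^ (1 + N / 2 : ℝ) := by
  by_cases hc : c = 0
  · rw [unitGauss, dif_pos hc, norm_zero]
    exact mul_nonneg (Real.sqrt_nonneg _) (by positivity)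
  have := NeZero.mk hc
  rw [unitGauss_eq]
  refine (norm_sum_le _ _).trans ((Finset.sum_le_sum fun d _ => norm_gauss_le A b c₀ hA c d).trans ?_)
  rw [Finset.sum_const, nsmul_eq_mul, Finset.card_univ, ZMod.card_units_eq_totient,
    Real.rpow_add (by positivity), Real.rpow_one]
  have : ((c.totient : ℕ) : ℝ) ≤ c := by exact_mod_cast Nat.totient_le c
  have h2 : 0 ≤ gaussBound A * (c : ℝ) ^ (N / 2 : ℝ) := mul_nonneg (Real.sqrt_nonneg _) (by positivity)
  nlinarith

end QuadPoly

/-! ### Local densities: Hensel lifting and lower bounds -/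

section LocalDensity

variable {N : ℕ} (A : Matrix (Fin N) (Fin N) ℤ) (b : Fin N → ℤ) (c₀ : ℤ)

/-- The integral point `x₀` solves `quadPoly = 0` modulo `p ^ (2 M + 1)`, while the derivative of
the polynomial at `x₀` in direction `z` has `p`-adic valuation exactly `M`. -/
def IsApproxZero (p M : ℕ) (x₀ z : Fin N → ℤ) : Prop :=
  (p : ℤ) ^ (2 * M + 1) ∣ quadPoly A b c₀ x₀ ∧
    ∃ u : ℤ, polarPoly A x₀ z + ∑ i, b i * z i = (p : ℤ) ^ M * u ∧ ¬ (p : ℤ) ∣ u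

/-- The difference of the values at `s` and `t` is `s - t` times `u + pγ(s + t)`, a unit. So the
polynomial is injective on a finite ring, hence surjective: Hensel's lemma without iteration. -/
lemma exists_quadratic_root_mod_pow {p : ℕ} (hp : p.Prime) (j : ℕ) (α γ u : ℤ)
    (hu : ¬ (p : ℤ) ∣ u) : ∃ t : ℤ, (p : ℤ) ^ j ∣ α + u * t + p * γ * t ^ 2 := by
  have : NeZero (p ^ j) := ⟨pow_ne_zero _ hp.ne_zero⟩
  have hunit (s : ℤ) : IsUnit ((u + p * s : ℤ) : ZMod (p ^ j)) := by
    rw [ZMod.coe_int_isUnit_iff_isCoprime]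
    push_cast
    refine IsCoprime.pow_left ((Nat.prime_iff_prime_int.1 hp).irreducible.coprime_iff_not_dvd.2 ?_)
    exact fun h => hu ((Int.dvd_add_left (Dvd.intro _ rfl)).1 h)
  let f : ZMod (p ^ j) → ZMod (p ^ j) := fun t => α + u * t + p * γ * t ^ 2
  have hinj : Function.Injective f := by
    intro s t hst
    obtain ⟨s, rfl⟩ := ZMod.intCast_surjective s
    obtain ⟨t, rfl⟩ := ZMod.intCast_surjective t
    have h1 : ((u + p * (γ * (s + t)) : ℤ) : ZMod (p ^ j)) * ((s : ZMod (p ^ j)) - t) = 0 := by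
      push_cast
      linear_combination hst
    exact sub_eq_zero.1 ((hunit _).mul_right_eq_zero.1 h1)
  obtain ⟨t, ht⟩ := (Finite.surjective_of_injective hinj) 0
  obtain ⟨t, rfl⟩ := ZMod.intCast_surjective t
  refine ⟨t, ?_⟩
  have h2 := (ZMod.intCast_zmod_eq_zero_iff_dvd (α + u * t + p * γ * t ^ 2) (p ^ j)).1
    (by push_cast; exact ht)
  exact_mod_cast h2

/-- Taylor expansion at `x₀`: with a step `p^(2M+1)` in a free direction `y` and a step `p^(M+1) t`
along `z`, all terms are divisible by `p^(2M+1)`, and the quotient is a quadratic polynomial in `t`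
with unit linear coefficient and leading coefficient divisible by `p`. -/
lemma exists_lift_of_isApproxZero {p M : ℕ} (hp : p.Prime) {x₀ z : Fin N → ℤ}
    (h : IsApproxZero A b c₀ p M x₀ z) (j : ℕ) (y : Fin N → ℤ) :
    ∃ t : ℤ, (p : ℤ) ^ j ∣
      quadPoly A b c₀ (x₀ + (p : ℤ) ^ (2 * M + 1) • y + ((p : ℤ) ^ (M + 1) * t) • z) := by
  obtain ⟨⟨q₀, hq₀⟩, u, hu, hpu⟩ := h
  obtain ⟨t, ht⟩ := exists_quadratic_root_mod_pow hp j
    (q₀ + (p : ℤ) ^ (2 * M + 1) * (∑ i, ∑ j, (A i j : ℤ) * y i * y j) + ∑ i, b i * y i +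
      polarPoly A x₀ y) (∑ i, ∑ j, (A i j : ℤ) * z i * z j)
    (u + p * (p ^ M * polarPoly A y z))
    (fun h => hpu ((Int.dvd_add_left (Dvd.intro _ rfl)).1 h))
  refine ⟨t, ht.trans (Dvd.intro_left ((p : ℤ) ^ (2 * M + 1)) ?_)⟩
  have h1 : polarPoly A (x₀ + (p : ℤ) ^ (2 * M + 1) • y) z =
      polarPoly A x₀ z + (p : ℤ) ^ (2 * M + 1) * polarPoly A y z := by
    rw [polarPoly_comm A _ z, polarPoly_comm A x₀ z, polarPoly_comm A y z, ← polarPoly_smul]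
    simp only [polarPoly, Pi.add_apply, mul_add, Finset.sum_add_distrib]
  rw [quadPoly_add, quadPoly_add, quadPoly_smul, quadPoly_smul, polarPoly_smul, polarPoly_smul, h1]
  simp only [Int.cast_id] at *
  linear_combination (-(1 : ℤ)) * hq₀ - (p : ℤ) ^ (M + 1) * t * hu

lemma card_smul_eq_le (c n : ℕ) [NeZero c] (hn : 0 < n) (w : Fin N → ZMod c) :
    (Finset.univ.filter fun y : Fin N → ZMod c => n • y = w).card ≤ n ^ N := by
  classical
  have hfib (s : ZMod c) : (Finset.univ.filter fun t : ZMod c => n • t = s).card ≤ n := by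
    by_cases hs : ∃ t, n • t = s
    · have h1 := AddMonoidHom.card_fiber_eq_of_mem_range (nsmulAddMonoidHom (α := ZMod c) n)
        (x := s) (y := 0) (by simpa using hs) ⟨0, by simp⟩
      exact (h1.trans_le (IsAddCyclic.card_nsmul_eq_zero_le hn))
    · rw [Finset.filter_false_of_mem fun t _ ht => hs ⟨t, ht⟩]
      simp
  have : (Finset.univ.filter fun y : Fin N → ZMod c => n • y = w) =
      Fintype.piFinset fun i => Finset.univ.filter fun t : ZMod c => n • t = w i := by
    ext y
    simp [funext_iff]
  rw [this, Fintype.card_piFinset]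
  exact (Finset.prod_le_pow_card _ _ n fun i _ => hfib (w i)).trans (by simp)

/-- Each `y` modulo `p^j` yields a zero together with its parameter `t`. This pair determines
`p^(2M+1) y`, so it comes from at most `(p^(2M+1))^N` values of `y`, and there are at most `numZeros
* p^j` pairs. -/
lemma pow_le_numZeros {p M : ℕ} (hp : p.Prime) {x₀ z : Fin N → ℤ}
    (h : IsApproxZero A b c₀ p M x₀ z) (j : ℕ) :
    (p ^ j) ^ N ≤ (p ^ (2 * M + 1)) ^ N * (numZeros A b c₀ (p ^ j) * p ^ j) := by
  classical
  have : NeZero (p ^ j) := ⟨pow_ne_zero _ hp.ne_zero⟩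
  let ι : (Fin N → ℤ) → Fin N → ZMod (p ^ j) := fun x i => x i
  have key : ∀ y : Fin N → ZMod (p ^ j), ∃ t : ZMod (p ^ j), quadPoly A b c₀
      (ι x₀ + p ^ (2 * M + 1) • y + ((p : ZMod (p ^ j)) ^ (M + 1) * t) • ι z) = 0 := by
    intro y
    obtain ⟨Y, hY⟩ : ∃ Y, ι Y = y :=
      ⟨fun i => (ZMod.intCast_surjective (y i)).choose,
        funext fun i => (ZMod.intCast_surjective (y i)).choose_spec⟩
    obtain ⟨t, ht⟩ := exists_lift_of_isApproxZero A b c₀ hp h j Y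
    refine ⟨t, ?_⟩
    have h1 := (ZMod.intCast_zmod_eq_zero_iff_dvd _ (p ^ j)).2 (by exact_mod_cast ht)
    rw [← eq_intCast (Int.castRingHom _), map_quadPoly] at h1
    rw [← h1, ← hY]
    congr 1
    ext i
    simp [ι]
  choose t ht using key
  let X : Finset (Fin N → ZMod (p ^ j)) := Finset.univ.filter fun x => quadPoly A b c₀ x = 0
  have hX : X.card = numZeros A b c₀ (p ^ j) := by
    rw [numZeros, Nat.card_eq_fintype_card, Fintype.card_subtype]
  have h2 := Finset.card_le_mul_card_image_of_maps_to
    (f := fun y => (ι x₀ + p ^ (2 * M + 1) • y +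
      ((p : ZMod (p ^ j)) ^ (M + 1) * t y) • ι z, t y))
    (s := Finset.univ) (t := X ×ˢ Finset.univ)
    (fun y _ => Finset.mem_product.2 ⟨Finset.mem_filter.2 ⟨Finset.mem_univ _, ht y⟩,
      Finset.mem_univ _⟩) ((p ^ (2 * M + 1)) ^ N) ?_
  · rw [Finset.card_product, hX] at h2
    simpa [ZMod.card] using h2
  · rintro ⟨w, s⟩ _
    refine le_trans (Finset.card_le_card ?_) (card_smul_eq_le (p ^ j) (p ^ (2 * M + 1))
      (pow_pos hp.pos _) (w - ι x₀ - ((p : ZMod (p ^ j)) ^ (M + 1) * s) • ι z))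
    intro y hy
    obtain ⟨h3, h4⟩ := Prod.ext_iff.1 (Finset.mem_filter.1 hy).2
    simp only at h3 h4
    refine Finset.mem_filter.2 ⟨Finset.mem_univ _, ?_⟩
    rw [← h3, h4]
    abel

/-! ### The singular series -/

/-- The coefficients of the singular series. -/
def singularCoeff (c : ℕ) : ℂ := unitGauss A b c₀ c / (c : ℂ) ^ N

lemma singularCoeff_zero : singularCoeff A b c₀ 0 = 0 := by
  simp [singularCoeff, unitGauss]

lemma singularCoeff_one : singularCoeff A b c₀ 1 = 1 := by
  have h := sum_unitGauss_divisors A b c₀ 1 one_ne_zero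
  simp [numZeros_one] at h
  simp [singularCoeff, h]

lemma star_singularCoeff (c : ℕ) : star (singularCoeff A b c₀ c) = singularCoeff A b c₀ c := by
  rw [singularCoeff, star_div₀, star_unitGauss]
  simp

lemma singularCoeff_re (c : ℕ) : ((singularCoeff A b c₀ c).re : ℂ) = singularCoeff A b c₀ c :=
  Complex.conj_eq_iff_re.1 (star_singularCoeff A b c₀ c)

lemma gaussBound_nonneg : 0 ≤ gaussBound A := Real.sqrt_nonneg _

lemma norm_singularCoeff_le (hA : (A + A.transpose).det ≠ 0) {c : ℕ} (hc : c ≠ 0) :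
    ‖singularCoeff A b c₀ c‖ ≤ gaussBound A * (c : ℝ) ^ (1 - N / 2 : ℝ) := by
  have h1 : (0 : ℝ) < (c : ℝ) ^ N := by positivity
  rw [singularCoeff, norm_div, norm_pow, Complex.norm_natCast, div_le_iff₀ h1]
  refine (norm_unitGauss_le A b c₀ hA c).trans_eq ?_
  rw [mul_assoc, ← Real.rpow_natCast, ← Real.rpow_add (by positivity)]
  congr 2
  ring

lemma norm_singularCoeff_le' (hA : (A + A.transpose).det ≠ 0) (hN : 5 ≤ N) {c : ℕ} (hc : c ≠ 0) :
    ‖singularCoeff A b c₀ c‖ ≤ gaussBound A * (c : ℝ) ^ (-(3 / 2) : ℝ) := by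
  refine (norm_singularCoeff_le A b c₀ hA hc).trans ?_
  have : (1 : ℝ) ≤ c := by exact_mod_cast Nat.one_le_iff_ne_zero.2 hc
  have hN' : (5 : ℝ) ≤ N := by exact_mod_cast hN
  have := gaussBound_nonneg A
  gcongr
  linarith

lemma summable_singularCoeff (hA : (A + A.transpose).det ≠ 0) (hN : 5 ≤ N) :
    Summable (singularCoeff A b c₀) := by
  refine Summable.of_norm_bounded (g := fun c : ℕ => gaussBound A * (c : ℝ) ^ (-(3 / 2) : ℝ))
    ((Real.summable_nat_rpow.2 (by norm_num)).mul_left _) fun c => ?_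
  by_cases hc : c = 0
  · rw [hc, singularCoeff_zero, norm_zero]
    exact mul_nonneg (gaussBound_nonneg A) (by positivity)
  · exact norm_singularCoeff_le' A b c₀ hA hN hc

/-- The density of zeros of the quadratic polynomial modulo `c`. -/
def zeroDensity (c : ℕ) : ℝ := numZeros A b c₀ c * c / (c : ℝ) ^ N

lemma zeroDensity_nonneg (c : ℕ) : 0 ≤ zeroDensity A b c₀ c := by
  unfold zeroDensity
  positivity

/-- Truncated to the divisors of `c`, the singular series is a density of zeros, normalised to have
expected value `1`. Its nonnegativity is visible only in this form. -/
lemma sum_singularCoeff_divisors {c : ℕ} (hc : c ≠ 0) :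
    ∑ e ∈ c.divisors, singularCoeff A b c₀ e = zeroDensity A b c₀ c := by
  have h := sum_unitGauss_divisors A b c₀ c hc
  have hc' : (c : ℂ) ^ N ≠ 0 := pow_ne_zero _ (Nat.cast_ne_zero.2 hc)
  simp only [zeroDensity]
  push_cast
  rw [eq_div_iff hc', mul_comm (numZeros A b c₀ c : ℂ), ← h, Finset.sum_mul]
  refine Finset.sum_congr rfl fun e he => ?_
  have he' : (e : ℂ) ≠ 0 :=
    Nat.cast_ne_zero.2 (ne_zero_of_dvd_ne_zero hc (Nat.dvd_of_mem_divisors he))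
  rw [singularCoeff, Nat.cast_div (Nat.dvd_of_mem_divisors he) he', div_pow]
  field_simp

lemma zeroDensity_eq_prod {c : ℕ} (hc : c ≠ 0) :
    zeroDensity A b c₀ c = ∏ p ∈ c.primeFactors, zeroDensity A b c₀ (p ^ c.factorization p) := by
  have h1 : (c : ℝ) = ∏ p ∈ c.primeFactors, ((p ^ c.factorization p : ℕ) : ℝ) := by
    rw [← Nat.cast_prod]
    exact_mod_cast (Nat.prod_factorization_pow_eq_self hc).symm
  have h2 : (numZeros A b c₀ c : ℝ) =
      ∏ p ∈ c.primeFactors, (numZeros A b c₀ (p ^ c.factorization p) : ℝ) := by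
    rw [numZeros_eq_prod A b c₀ hc]
    push_cast [Finsupp.prod]
    rfl
  simp only [zeroDensity]
  rw [Finset.prod_div_distrib, Finset.prod_mul_distrib, Finset.prod_pow, ← h2, ← h1]

lemma le_zeroDensity_of_isApproxZero {p M : ℕ} (hp : p.Prime) {x₀ z : Fin N → ℤ}
    (h : IsApproxZero A b c₀ p M x₀ z) (j : ℕ) :
    (((p : ℝ) ^ (2 * M + 1)) ^ N)⁻¹ ≤ zeroDensity A b c₀ (p ^ j) := by
  have h1 := pow_le_numZeros A b c₀ hp h j
  have hp' : (0 : ℝ) < p := by exact_mod_cast hp.pos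
  have h2 : ((p : ℝ) ^ j) ^ N ≤ ((p : ℝ) ^ (2 * M + 1)) ^ N *
      (numZeros A b c₀ (p ^ j) * (p : ℝ) ^ j) := by exact_mod_cast h1
  rw [zeroDensity, inv_le_iff_one_le_mul₀ (by positivity), div_mul_eq_mul_div,
    le_div_iff₀ (pow_pos (by exact_mod_cast pow_pos hp.pos j) N)]
  push_cast
  linarith

/-- The density at `p^j` is `1` plus the coefficients at `p, ..., p^j`. These are dominated by a
geometric series of ratio `p^(-3/2) ≤ 1/2`, whence the factor `2`. -/
lemma one_sub_le_zeroDensity (hA : (A + A.transpose).det ≠ 0) (hN : 5 ≤ N) {p : ℕ} (hp : p.Prime)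
    (j : ℕ) : 1 - 2 * gaussBound A * (p : ℝ) ^ (-(3 / 2) : ℝ) ≤ zeroDensity A b c₀ (p ^ j) := by
  have h1 := sum_singularCoeff_divisors A b c₀ (pow_ne_zero j hp.ne_zero)
  rw [Nat.sum_divisors_prime_pow hp, Finset.sum_range_succ', pow_zero, singularCoeff_one] at h1
  have h2 : zeroDensity A b c₀ (p ^ j) =
      1 + ∑ i ∈ Finset.range j, (singularCoeff A b c₀ (p ^ (i + 1))).re := by
    have := congrArg Complex.re h1
    simp only [Complex.add_re, Complex.re_sum, Complex.one_re, Complex.ofReal_re] at this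
    linarith
  set x : ℝ := (p : ℝ) ^ (-(3 / 2) : ℝ) with hx
  have hp2 : (2 : ℝ) ≤ p := by exact_mod_cast hp.two_le
  have hx0 : 0 ≤ x := by positivity
  have hx1 : x ≤ 1 / 2 := by
    rw [hx]
    calc (p : ℝ) ^ (-(3 / 2) : ℝ) ≤ (p : ℝ) ^ (-1 : ℝ) :=
          Real.rpow_le_rpow_of_exponent_le (by linarith) (by norm_num)
      _ = 1 / p := by rw [Real.rpow_neg_one, one_div]
      _ ≤ 1 / 2 := one_div_le_one_div_of_le (by norm_num) hp2
  have h3 : ∀ i, -(gaussBound A * x * x ^ i) ≤ (singularCoeff A b c₀ (p ^ (i + 1))).re := by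
    intro i
    have h4 := norm_singularCoeff_le' A b c₀ hA hN (pow_ne_zero (i + 1) hp.ne_zero)
    have h5 : (((p ^ (i + 1) : ℕ) : ℝ)) ^ (-(3 / 2) : ℝ) = x * x ^ i := by
      rw [hx, ← pow_succ', ← Real.rpow_natCast, ← Real.rpow_mul (by positivity)]
      push_cast
      rw [← Real.rpow_natCast, ← Real.rpow_mul (by positivity)]
      congr 1
      push_cast
      ring
    rw [h5, ← mul_assoc] at h4
    linarith [(abs_le.1 (Complex.abs_re_le_norm (singularCoeff A b c₀ (p ^ (i + 1))))).1]
  have h6 : ∑ i ∈ Finset.range j, x ^ i ≤ 2 := by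
    have h7 := geom_sum_mul_neg x j
    have h8 : 0 ≤ x ^ j := by positivity
    have h9 : 0 ≤ ∑ i ∈ Finset.range j, x ^ i := Finset.sum_nonneg fun i _ => by positivity
    nlinarith
  have h10 : -(gaussBound A * x * ∑ i ∈ Finset.range j, x ^ i) ≤
      ∑ i ∈ Finset.range j, (singularCoeff A b c₀ (p ^ (i + 1))).re := by
    rw [Finset.mul_sum, ← Finset.sum_neg_distrib]
    exact Finset.sum_le_sum fun i _ => h3 i
  have h11 : gaussBound A * x * ∑ i ∈ Finset.range j, x ^ i ≤ gaussBound A * x * 2 :=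
    mul_le_mul_of_nonneg_left h6 (mul_nonneg (gaussBound_nonneg A) hx0)
  rw [h2]
  linarith

lemma one_sub_sum_le_prod_one_sub {ι : Type*} (s : Finset ι) (f : ι → ℝ)
    (h0 : ∀ i ∈ s, 0 ≤ f i) (h1 : ∀ i ∈ s, f i ≤ 1) : 1 - ∑ i ∈ s, f i ≤ ∏ i ∈ s, (1 - f i) := by
  classical
  induction s using Finset.induction_on with
  | empty => simp
  | insert a s ha ih =>
    rw [Finset.sum_insert ha, Finset.prod_insert ha]
    have h2 := ih (fun i hi => h0 i (Finset.mem_insert_of_mem hi))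
      (fun i hi => h1 i (Finset.mem_insert_of_mem hi))
    have h3 := h0 a (Finset.mem_insert_self a s)
    have h4 := h1 a (Finset.mem_insert_self a s)
    have h5 : 0 ≤ ∑ i ∈ s, f i :=
      Finset.sum_nonneg fun i hi => h0 i (Finset.mem_insert_of_mem hi)
    nlinarith

/-- The singular series is bounded below, uniformly in all quadratic polynomials with given
quadratic part that have an approximate zero at every prime `p` with valuation of the gradient
bounded in terms of `p`. -/
theorem exists_le_singularSeries (hA : (A + A.transpose).det ≠ 0) (hN : 5 ≤ N) (M : ℕ → ℕ) :
    ∃ δ > 0, ∀ b c₀, (∀ p : ℕ, p.Prime → ∃ m ≤ M p, ∃ x₀ z, IsApproxZero A b c₀ p m x₀ z) →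
      δ ≤ (∑' c, singularCoeff A b c₀ c).re := by
  let x : ℕ → ℝ := fun p => 2 * gaussBound A * (p : ℝ) ^ (-(3 / 2) : ℝ)
  have hx0 : ∀ p, 0 ≤ x p := fun p =>
    mul_nonneg (mul_nonneg zero_le_two (gaussBound_nonneg A)) (by positivity)
  have hxs : Summable x := (Real.summable_nat_rpow.2 (by norm_num)).mul_left _
  -- Outside the finite set `s` the local deficits add up to less than `1/2`, so those primes
  -- contribute a factor of at least `1/2`. The primes in `s` are left to the Hensel bound `y p`.
  obtain ⟨s, hs⟩ := (summable_iff_vanishing_norm.1 hxs) (1 / 2) (by norm_num)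
  let y : ℕ → ℝ := fun p => (((p : ℝ) ^ (2 * M p + 1)) ^ N)⁻¹
  have hy : ∀ p : ℕ, p.Prime → 0 < y p ∧ y p ≤ 1 := by
    intro p hp
    have hp1 : (1 : ℝ) ≤ p := by exact_mod_cast hp.one_le
    exact ⟨by positivity, inv_le_one_of_one_le₀ (one_le_pow₀ (one_le_pow₀ hp1))⟩
  let s' := s.filter Nat.Prime
  have hs' : 0 < ∏ p ∈ s', y p := Finset.prod_pos fun p hp => (hy p (Finset.mem_filter.1 hp).2).1
  refine ⟨(∏ p ∈ s', y p) * (1 / 2), by positivity, fun b c₀ h => ?_⟩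
  have hdens : ∀ c : ℕ, c ≠ 0 → (∏ p ∈ s', y p) * (1 / 2) ≤ zeroDensity A b c₀ c := by
    intro c hc
    rw [zeroDensity_eq_prod A b c₀ hc,
      ← Finset.prod_filter_mul_prod_filter_not c.primeFactors (fun p => p ∈ s)]
    refine mul_le_mul ?_ ?_ (by norm_num) (Finset.prod_nonneg fun p _ => zeroDensity_nonneg _ _ _ _)
    · have h1 : (c.primeFactors.filter fun p => p ∈ s) ⊆ s' := fun p hp => by
        obtain ⟨h2, h3⟩ := Finset.mem_filter.1 hp
        exact Finset.mem_filter.2 ⟨h3, Nat.prime_of_mem_primeFactors h2⟩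
      rw [← Finset.prod_sdiff h1]
      refine (mul_le_of_le_one_left (Finset.prod_nonneg fun p hp =>
        (hy p (Finset.mem_filter.1 (h1 hp)).2).1.le) (Finset.prod_le_one (fun p hp => ?_)
          fun p hp => ?_)).trans (Finset.prod_le_prod (fun p hp => ?_) fun p hp => ?_)
      · exact (hy p (Finset.mem_filter.1 (Finset.mem_sdiff.1 hp).1).2).1.le
      · exact (hy p (Finset.mem_filter.1 (Finset.mem_sdiff.1 hp).1).2).2
      · exact (hy p (Finset.mem_filter.1 (h1 hp)).2).1.le
      · have hp' := (Finset.mem_filter.1 (h1 hp)).2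
        obtain ⟨m, hm, x₀, z, hz⟩ := h p hp'
        refine le_trans ?_ (le_zeroDensity_of_isApproxZero A b c₀ hp' hz _)
        have hp1 : (1 : ℝ) ≤ p := by exact_mod_cast hp'.one_le
        have : (0 : ℝ) < p := by linarith
        simp only [y]
        gcongr
    · have h1 := hs (c.primeFactors.filter fun p => p ∉ s)
        (Finset.disjoint_left.2 fun p hp hp' => (Finset.mem_filter.1 hp).2 hp')
      rw [Real.norm_of_nonneg (Finset.sum_nonneg fun p _ => hx0 p)] at h1
      have h2 : ∀ p ∈ c.primeFactors.filter fun p => p ∉ s, x p ≤ 1 := fun p hp => by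
        have := Finset.single_le_sum (fun p _ => hx0 p) hp
        linarith
      have h3 := one_sub_sum_le_prod_one_sub _ x (fun p _ => hx0 p) h2
      refine le_trans (by linarith) (h3.trans (Finset.prod_le_prod (fun p hp => ?_) fun p hp => ?_))
      · linarith [h2 p hp]
      · exact one_sub_le_zeroDensity A b c₀ hA hN
          (Nat.prime_of_mem_primeFactors (Finset.mem_filter.1 hp).1) _
  -- The divisors of `K!` exhaust the positive integers; the index `0`, whose coefficient vanishes,
  -- is added to exhaust `ℕ`. The singular series is thus the limit of the densities modulo `K!`.
  have hlim : Filter.Tendsto (fun K : ℕ => ∑ e ∈ insert 0 (K.factorial).divisors,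
      singularCoeff A b c₀ e) Filter.atTop (nhds (∑' c, singularCoeff A b c₀ c)) := by
    refine (summable_singularCoeff A b c₀ hA hN).hasSum.comp
      (Filter.tendsto_atTop_finset_of_monotone (fun K K' hK => ?_) fun e => ?_)
    · exact Finset.insert_subset_insert _
        (Nat.divisors_subset_of_dvd (Nat.factorial_ne_zero _) (Nat.factorial_dvd_factorial hK))
    · refine ⟨e, ?_⟩
      rcases Nat.eq_zero_or_pos e with rfl | he
      · simp
      · exact Finset.mem_insert_of_mem (Nat.mem_divisors.2
          ⟨Nat.dvd_factorial he le_rfl, Nat.factorial_ne_zero _⟩)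
  refine ge_of_tendsto' ((Complex.continuous_re.tendsto _).comp hlim) fun K => ?_
  rw [Function.comp_apply, Finset.sum_insert (by simp), singularCoeff_zero, zero_add,
    sum_singularCoeff_divisors A b c₀ (Nat.factorial_ne_zero K), Complex.ofReal_re]
  exact hdens _ (Nat.factorial_ne_zero K)

end LocalDensity

/-! ### Isotropic vectors modulo primes -/

section Isotropy

/-- Chevalley–Warning: the degree `2` is less than the number `3` of variables, so the number of
zeros is divisible by `p`, and the origin is one of them. -/
lemma exists_ternary_zero {p : ℕ} [Fact p.Prime] (a : Fin 3 → ZMod p) (d : Fin 3 → ZMod p) :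
    ∃ t : Fin 3 → ZMod p, t ≠ 0 ∧ a 0 * t 0 ^ 2 + a 1 * t 1 ^ 2 + a 2 * t 2 ^ 2 +
      d 0 * t 1 * t 2 + d 1 * t 0 * t 2 + d 2 * t 0 * t 1 = 0 := by
  classical
  open MvPolynomial in
  let f : MvPolynomial (Fin 3) (ZMod p) := C (a 0) * X 0 ^ 2 + C (a 1) * X 1 ^ 2 +
    C (a 2) * X 2 ^ 2 + C (d 0) * X 1 * X 2 + C (d 1) * X 0 * X 2 + C (d 2) * X 0 * X 1
  have hdeg : f.totalDegree < Fintype.card (Fin 3) := by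
    have h1 (c : ZMod p) (i : Fin 3) :
        (MvPolynomial.C c * MvPolynomial.X i ^ 2 : MvPolynomial (Fin 3) (ZMod p)).totalDegree ≤ 2 := by
      refine (MvPolynomial.totalDegree_mul _ _).trans ?_
      rw [MvPolynomial.totalDegree_C, MvPolynomial.totalDegree_X_pow]
    have h2 (c : ZMod p) (i j : Fin 3) : (MvPolynomial.C c * MvPolynomial.X i * MvPolynomial.X j :
        MvPolynomial (Fin 3) (ZMod p)).totalDegree ≤ 2 := by
      refine (MvPolynomial.totalDegree_mul _ _).trans ?_
      have := MvPolynomial.totalDegree_mul (MvPolynomial.C c)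
        (MvPolynomial.X i : MvPolynomial (Fin 3) (ZMod p))
      rw [MvPolynomial.totalDegree_C, MvPolynomial.totalDegree_X] at this
      rw [MvPolynomial.totalDegree_X]
      omega
    refine lt_of_le_of_lt (b := 2) ?_ (by simp)
    refine (MvPolynomial.totalDegree_add _ _).trans (max_le ?_ (h2 _ _ _))
    refine (MvPolynomial.totalDegree_add _ _).trans (max_le ?_ (h2 _ _ _))
    refine (MvPolynomial.totalDegree_add _ _).trans (max_le ?_ (h2 _ _ _))
    refine (MvPolynomial.totalDegree_add _ _).trans (max_le ?_ (h1 _ _))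
    exact (MvPolynomial.totalDegree_add _ _).trans (max_le (h1 _ _) (h1 _ _))
  have hdvd := char_dvd_card_solutions p hdeg
  have hf : ∀ t, MvPolynomial.eval t f = a 0 * t 0 ^ 2 + a 1 * t 1 ^ 2 + a 2 * t 2 ^ 2 +
      d 0 * t 1 * t 2 + d 1 * t 0 * t 2 + d 2 * t 0 * t 1 := by
    intro t
    simp [f]
  have h0 : MvPolynomial.eval 0 f = 0 := by rw [hf]; simp
  have hpos : 0 < Fintype.card {x : Fin 3 → ZMod p // MvPolynomial.eval x f = 0} :=
    Fintype.card_pos_iff.2 ⟨⟨0, h0⟩⟩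
  have hlt : 1 < Fintype.card {x : Fin 3 → ZMod p // MvPolynomial.eval x f = 0} :=
    (Fact.out : p.Prime).one_lt.trans_le (Nat.le_of_dvd hpos hdvd)
  obtain ⟨⟨t, ht⟩, hne⟩ := Fintype.exists_ne_of_one_lt_card hlt ⟨0, h0⟩
  exact ⟨t, fun h => hne (Subtype.ext h), (hf t).symm.trans ht⟩

variable {N : ℕ} (A : Matrix (Fin N) (Fin N) ℤ)

lemma polarPoly_add {R : Type*} [CommRing R] (x y z : Fin N → R) :
    polarPoly A (x + y) z = polarPoly A x z + polarPoly A y z := by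
  rw [polarPoly_comm A _ z, polarPoly_comm A x z, polarPoly_comm A y z]
  simp only [polarPoly, Pi.add_apply, mul_add, Finset.sum_add_distrib]

lemma smul_polarPoly {R : Type*} [CommRing R] (t : R) (x y : Fin N → R) :
    polarPoly A (t • x) y = t * polarPoly A x y := by
  rw [polarPoly_comm, polarPoly_smul, polarPoly_comm]

lemma quadForm_smul {R : Type*} [CommRing R] (t : R) (x : Fin N → R) :
    quadPoly A 0 0 (t • x) = t ^ 2 * quadPoly A 0 0 x := by
  rw [quadPoly_smul]
  simp [quadPoly]

lemma polarPoly_self {R : Type*} [CommRing R] (x : Fin N → R) :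
    polarPoly A x x = 2 * quadPoly A 0 0 x := by
  simp only [polarPoly_eq, quadPoly, Finset.mul_sum, Pi.zero_apply, Int.cast_zero, zero_mul,
    Finset.sum_const_zero, add_zero]
  exact Finset.sum_congr rfl fun i _ => Finset.sum_congr rfl fun j _ => by ring

lemma map_polarPoly {R S : Type*} [CommRing R] [CommRing S] (f : R →+* S) (x y : Fin N → R) :
    f (polarPoly A x y) = polarPoly A (fun i => f (x i)) (fun i => f (y i)) := by
  simp [polarPoly_eq]

lemma quadForm_ternary {R : Type*} [CommRing R] (t : Fin 3 → R) (w : Fin 3 → Fin N → R) :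
    quadPoly A 0 0 (∑ i, t i • w i) = quadPoly A 0 0 (w 0) * t 0 ^ 2 + quadPoly A 0 0 (w 1) * t 1 ^ 2 +
      quadPoly A 0 0 (w 2) * t 2 ^ 2 + polarPoly A (w 1) (w 2) * t 1 * t 2 +
      polarPoly A (w 0) (w 2) * t 0 * t 2 + polarPoly A (w 0) (w 1) * t 0 * t 1 := by
  simp only [Fin.sum_univ_three, quadPoly_add A 0 0, quadForm_smul, polarPoly_add, smul_polarPoly,
    polarPoly_smul]
  ring

lemma exists_linearIndependent_three {K W : Type*} [Field K] [AddCommGroup W] [Module K W]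
    (U : Submodule K W) [FiniteDimensional K U] (hU : 3 ≤ Module.finrank K U) :
    ∃ w : Fin 3 → W, (∀ i, w i ∈ U) ∧ LinearIndependent K w := by
  let B := Module.finBasis K U
  refine ⟨fun i => (B (Fin.castLE hU i) : W), fun i => (B (Fin.castLE hU i)).2, ?_⟩
  have h := (B.linearIndependent.comp _ (Fin.castLE_injective hU)).map' U.subtype
    (Submodule.ker_subtype U)
  exact h

/-- `x` is divisible by `p` as soon as `(x · y) ∈ pℤ` for all `y` and `f(x) ∈ p²ℤ`, where `f` is the
quadratic form with matrix `A`. -/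
def IsReducedAt (p : ℕ) : Prop :=
  ∀ x : Fin N → ℤ, (∀ y, (p : ℤ) ∣ polarPoly A x y) → (p : ℤ) ^ 2 ∣ quadPoly A 0 0 x →
    ∀ i, (p : ℤ) ∣ x i

/-- The radical of a quadratic form modulo `p`. -/
def radicalMod (p : ℕ) : Submodule (ZMod p) (Fin N → ZMod p) where
  carrier := {x | quadPoly A 0 0 x = 0 ∧ ∀ y, polarPoly A x y = 0}
  add_mem' := fun {x y} hx hy => by
    refine ⟨?_, fun z => ?_⟩
    · rw [quadPoly_add, hx.1, hy.1, hx.2]; simp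
    · rw [polarPoly_add, hx.2, hy.2, add_zero]
  zero_mem' := ⟨by simp [quadPoly], fun y => by simp [polarPoly_eq]⟩
  smul_mem' := fun t x hx => by
    refine ⟨?_, fun z => ?_⟩
    · rw [quadForm_smul, hx.1, mul_zero]
    · rw [smul_polarPoly, hx.2, mul_zero]

lemma exists_int_lift {p : ℕ} (x : Fin N → ZMod p) : ∃ X : Fin N → ℤ, (fun i => (X i : ZMod p)) = x :=
  ⟨fun i => (ZMod.intCast_surjective (x i)).choose,
    funext fun i => (ZMod.intCast_surjective (x i)).choose_spec⟩

lemma cast_quadPoly {p : ℕ} (b : Fin N → ℤ) (c : ℤ) (X : Fin N → ℤ) :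
    ((quadPoly A b c X : ℤ) : ZMod p) = quadPoly A b c (fun i => (X i : ZMod p)) :=
  map_quadPoly A b c (Int.castRingHom (ZMod p)) X

lemma cast_polarPoly {p : ℕ} (X Y : Fin N → ℤ) :
    ((polarPoly A X Y : ℤ) : ZMod p) = polarPoly A (fun i => (X i : ZMod p)) (fun i => (Y i : ZMod p)) :=
  map_polarPoly A (Int.castRingHom (ZMod p)) X Y

/-- On lifts of radical vectors the form is divisible by `p`. Given three independent ones, the form
divided by `p` is a ternary form modulo `p`. A nontrivial zero of it lifts to a vector which
reducedness makes divisible by `p`, against independence. -/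
lemma finrank_radicalMod_le {p : ℕ} [Fact p.Prime] (h : IsReducedAt A p) :
    Module.finrank (ZMod p) (radicalMod A p) ≤ 2 := by
  by_contra! hlt
  obtain ⟨w, hw, hli⟩ := exists_linearIndependent_three _ hlt
  choose W hW using fun i => exists_int_lift (w i)
  have hdq (i) : (p : ℤ) ∣ quadPoly A 0 0 (W i) := by
    rw [← ZMod.intCast_zmod_eq_zero_iff_dvd, cast_quadPoly, hW]
    exact (hw i).1
  have hdp (i) (y : Fin N → ℤ) : (p : ℤ) ∣ polarPoly A (W i) y := by
    rw [← ZMod.intCast_zmod_eq_zero_iff_dvd, cast_polarPoly, hW]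
    exact (hw i).2 _
  choose a ha using hdq
  choose e he using hdp
  obtain ⟨t, ht0, ht⟩ := exists_ternary_zero (fun i => (a i : ZMod p))
    ![(e 1 (W 2) : ZMod p), (e 0 (W 2) : ZMod p), (e 0 (W 1) : ZMod p)]
  obtain ⟨T, hT⟩ := exists_int_lift t
  have hred := h (∑ i, T i • W i) (fun y => ?_) ?_
  · refine ht0 (funext fun i => Fintype.linearIndependent_iff.1 hli t ?_ i)
    funext i
    have := (ZMod.intCast_zmod_eq_zero_iff_dvd _ p).2 (hred i)
    simpa [← hT, ← hW] using this
  · rw [Fin.sum_univ_three, polarPoly_add, polarPoly_add, smul_polarPoly, smul_polarPoly,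
      smul_polarPoly]
    exact dvd_add (dvd_add (Dvd.dvd.mul_left ⟨_, he 0 y⟩ _) (Dvd.dvd.mul_left ⟨_, he 1 y⟩ _))
      (Dvd.dvd.mul_left ⟨_, he 2 y⟩ _)
  · rw [quadForm_ternary, ha, ha, ha, he, he, he]
    have h1 : (p : ℤ) ∣ a 0 * T 0 ^ 2 + a 1 * T 1 ^ 2 + a 2 * T 2 ^ 2 +
        e 1 (W 2) * T 1 * T 2 + e 0 (W 2) * T 0 * T 2 + e 0 (W 1) * T 0 * T 1 := by
      rw [← ZMod.intCast_zmod_eq_zero_iff_dvd]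
      simpa [← hT] using ht
    obtain ⟨k, hk⟩ := h1
    exact ⟨k, by linear_combination (p : ℤ) * hk⟩

/-- A complement of the radical has dimension at least `5 - 2 = 3`, so it contains a nonzero
isotropic vector. Lying outside the radical, this vector pairs nontrivially with some `z`. -/
lemma exists_isotropic_mod {p : ℕ} [Fact p.Prime] (h : IsReducedAt A p) (hN : 5 ≤ N) :
    ∃ x z : Fin N → ℤ, (p : ℤ) ∣ quadPoly A 0 0 x ∧ ¬ (p : ℤ) ∣ polarPoly A x z := by
  obtain ⟨C, hC⟩ := Submodule.exists_isCompl (radicalMod A p)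
  have hdim := Submodule.finrank_add_eq_of_isCompl hC
  rw [Module.finrank_fin_fun] at hdim
  have := finrank_radicalMod_le A h
  obtain ⟨w, hw, hli⟩ := exists_linearIndependent_three C (by omega)
  obtain ⟨t, ht0, ht⟩ := exists_ternary_zero (fun i => quadPoly A 0 0 (w i))
    ![polarPoly A (w 1) (w 2), polarPoly A (w 0) (w 2), polarPoly A (w 0) (w 1)]
  have hq : quadPoly A 0 0 (∑ i, t i • w i) = 0 := by
    rw [quadForm_ternary]
    simpa using ht
  have hne : ∑ i, t i • w i ≠ 0 := fun h0 =>
    ht0 (funext fun i => Fintype.linearIndependent_iff.1 hli t h0 i)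
  have hmem : ∑ i, t i • w i ∈ C := Submodule.sum_mem _ fun i _ => Submodule.smul_mem _ _ (hw i)
  have hex : ∃ z, polarPoly A (∑ i, t i • w i) z ≠ 0 := by
    by_contra! hz
    exact hne (Submodule.disjoint_def.1 hC.disjoint _ ⟨hq, hz⟩ hmem)
  obtain ⟨z, hz⟩ := hex
  obtain ⟨X, hX⟩ := exists_int_lift (∑ i, t i • w i)
  obtain ⟨Z, hZ⟩ := exists_int_lift z
  refine ⟨X, Z, ?_, ?_⟩
  · rw [← ZMod.intCast_zmod_eq_zero_iff_dvd, cast_quadPoly, hX, hq]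
  · rwa [← ZMod.intCast_zmod_eq_zero_iff_dvd, cast_polarPoly, hX, hZ]

/-! ### Approximate zeros -/

/-- For `x` isotropic modulo `p`, the value at `t x + z` is modulo `p` linear in `t` with unit slope
`(x · z)`, so some `t` gives the value `k` modulo `p`. The derivative there in direction `x` is
again `(x · z)` modulo `p`, and Hensel lifting with `M = 0` applies. -/
lemma exists_represent_mod_pow {p : ℕ} [Fact p.Prime] (h : IsReducedAt A p) (hN : 5 ≤ N) (k : ℤ)
    (j : ℕ) : ∃ x z : Fin N → ℤ, (p : ℤ) ^ j ∣ quadPoly A 0 0 x - k ∧ ¬ (p : ℤ) ∣ polarPoly A x z := by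
  have hp : p.Prime := Fact.out
  have hp' : _root_.Prime (p : ℤ) := Nat.prime_iff_prime_int.1 hp
  obtain ⟨x, z, hx, hz⟩ := exists_isotropic_mod A h hN
  obtain ⟨s, s', hs⟩ : IsCoprime (polarPoly A x z) (p : ℤ) :=
    (hp'.irreducible.coprime_iff_not_dvd.2 hz).symm
  set t : ℤ := s * (k - quadPoly A 0 0 z) with ht
  have h1 : quadPoly A 0 0 (t • x + z) = t ^ 2 * quadPoly A 0 0 x + quadPoly A 0 0 z +
      t * polarPoly A x z := by
    rw [quadPoly_add, quadForm_smul, smul_polarPoly]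
  have hquad : ∀ v : Fin N → ℤ, quadPoly A 0 (-k) v = quadPoly A 0 0 v - k := fun v => by
    simp [quadPoly, sub_eq_add_neg]
  have h2 : (p : ℤ) ∣ quadPoly A 0 (-k) (t • x + z) := by
    rw [hquad, h1]
    have : t ^ 2 * quadPoly A 0 0 x + quadPoly A 0 0 z + t * polarPoly A x z - k =
        quadPoly A 0 0 x * t ^ 2 - p * (s' * (k - quadPoly A 0 0 z)) := by
      rw [ht]; linear_combination (k - quadPoly A 0 0 z) * hs
    rw [this]
    exact dvd_sub (hx.mul_right _) (Dvd.intro _ rfl)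
  have h3 : polarPoly A (t • x + z) x = t * 2 * quadPoly A 0 0 x + polarPoly A x z := by
    rw [polarPoly_add, smul_polarPoly, polarPoly_self, polarPoly_comm A z x]; ring
  have h4 : ¬ (p : ℤ) ∣ polarPoly A (t • x + z) x := by
    rw [h3]
    exact fun h => hz ((Int.dvd_add_right (hx.mul_left _)).1 h)
  obtain ⟨t', ht'⟩ := exists_lift_of_isApproxZero A 0 (-k) hp (M := 0) (x₀ := t • x + z) (z := x)
    ⟨by simpa using h2, _, by simp, h4⟩ j 0
  rw [hquad] at ht'
  refine ⟨_, x, ht', ?_⟩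
  rw [smul_zero, add_zero, polarPoly_add, smul_polarPoly]
  exact fun h => h4 ((Int.dvd_add_left (Dvd.dvd.mul_right (Dvd.dvd.mul_right
    (dvd_pow_self _ (by omega)) _) _)).1 h)

lemma polarPoly_zsmul_sub_quadPoly (x y : Fin N → ℤ) (t : ℤ) :
    quadPoly A 0 0 (x + t • y) = quadPoly A 0 0 x + t * (t * quadPoly A 0 0 y + polarPoly A x y) := by
  rw [quadPoly_add, quadForm_smul, polarPoly_smul]; ring

/-- Let `l = r y - β`. If `p^a ∣ l`, then `l / p^a` can be exchanged for a nonsingular vector with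
nearly the same value, and the gradient along `rL` has valuation `2a`. Otherwise `l = p^t l₀` with
`t ≤ a` and `p ∤ l₀`; the first alternative of `hβ` must hold, so some `z` pairs with `l₀` to a
unit, and `l` itself works with valuation `t + a`. The bound `2a` depends on `r` only. -/
lemma exists_approxZero_coset {p r a r' : ℕ} [Fact p.Prime] (hr : r = p ^ a * r') (hr' : ¬ p ∣ r')
    (h : IsReducedAt A p) (hN : 5 ≤ N) (β : Fin N → ℤ)
    (hβ : (∀ x : Fin N → ℤ, (∀ y, (p : ℤ) ∣ polarPoly A x y) → ∀ i, (p : ℤ) ∣ x i) ∨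
      ∀ i, (p : ℤ) ^ a ∣ β i) (y : Fin N → ℤ) :
    ∃ m ≤ 2 * a, ∃ x₀ z : Fin N → ℤ,
      (p : ℤ) ^ (2 * m + 1) ∣ quadPoly A 0 0 ((r : ℤ) • x₀ - β) - quadPoly A 0 0 ((r : ℤ) • y - β) ∧
      ∃ u : ℤ, polarPoly A ((r : ℤ) • x₀ - β) ((r : ℤ) • z) = (p : ℤ) ^ m * u ∧ ¬ (p : ℤ) ∣ u := by
  have hp : p.Prime := Fact.out
  have hp' : _root_.Prime (p : ℤ) := Nat.prime_iff_prime_int.1 hp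
  have hrz : (r : ℤ) = (p : ℤ) ^ a * r' := by rw [hr]; push_cast; ring
  have hr'z : ¬ (p : ℤ) ∣ r' := by rwa [Int.natCast_dvd_natCast]
  set l : Fin N → ℤ := (r : ℤ) • y - β with hl
  by_cases hdiv : ∀ i, (p : ℤ) ^ a ∣ l i
  · choose l₁ hl₁ using hdiv
    have hl₁' : l = (p : ℤ) ^ a • l₁ := funext hl₁
    obtain ⟨Y, z, hY, hz⟩ := exists_represent_mod_pow A h hN (quadPoly A 0 0 l₁) (2 * a + 1)
    -- As `s` inverts `r'` modulo `p^(2a+1)`, moving `y` by `s (Y - l₁)` turns `l₁` into `Y` up to a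
    -- multiple of `p^(2a+1)`.
    obtain ⟨s, s', hs⟩ : IsCoprime (r' : ℤ) ((p : ℤ) ^ (2 * a + 1)) :=
      ((hp'.irreducible.coprime_iff_not_dvd.2 hr'z).symm).pow_right
    have hx : (r : ℤ) • (y + s • (Y - l₁)) - β =
        (p : ℤ) ^ a • (Y + ((p : ℤ) ^ (2 * a + 1)) • (s' • (l₁ - Y))) := by
      have h1 : (r : ℤ) • (y + s • (Y - l₁)) - β = l + (r : ℤ) • s • (Y - l₁) := by
        rw [hl, smul_add]; abel
      rw [h1, hl₁', hrz]
      funext i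
      simp only [Pi.add_apply, Pi.smul_apply, Pi.sub_apply, smul_eq_mul]
      linear_combination (p : ℤ) ^ a * (Y i - l₁ i) * hs
    -- The congruence is needed modulo `p^(4a+1)`: a factor `p^(2a)` comes from the scaling by
    -- `p^a`, the rest from the choice of `Y`.
    refine ⟨2 * a, le_rfl, y + s • (Y - l₁), z, ?_, r' * polarPoly A
      (Y + ((p : ℤ) ^ (2 * a + 1)) • (s' • (l₁ - Y))) z, ?_, ?_⟩
    · rw [hx, hl₁', quadForm_smul, quadForm_smul, polarPoly_zsmul_sub_quadPoly]
      obtain ⟨k, hk⟩ := hY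
      refine ⟨k + ((p : ℤ) ^ (2 * a + 1) * quadPoly A 0 0 (s' • (l₁ - Y)) +
        polarPoly A Y (s' • (l₁ - Y))), ?_⟩
      linear_combination ((p : ℤ) ^ a) ^ 2 * hk
    · rw [hx, smul_polarPoly, polarPoly_smul, hrz]
      ring
    · refine hp'.not_dvd_mul hr'z ?_
      rw [polarPoly_add, smul_polarPoly]
      exact fun h => hz ((Int.dvd_add_left (Dvd.dvd.mul_right (dvd_pow_self _ (by omega)) _)).1 h)
  · have hβ' : ¬ ∀ i, (p : ℤ) ^ a ∣ β i := fun h => hdiv fun i => by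
      simp only [hl, Pi.sub_apply, Pi.smul_apply, smul_eq_mul, hrz]
      exact dvd_sub (Dvd.dvd.mul_right (Dvd.intro _ rfl) _) (h i)
    replace hβ := hβ.resolve_right hβ'
    obtain ⟨t, ht, ht'⟩ : ∃ t, (∀ i, (p : ℤ) ^ t ∣ l i) ∧ ¬ ∀ i, (p : ℤ) ^ (t + 1) ∣ l i := by
      by_contra! hcon
      exact hdiv (Nat.rec (by simp) (fun k hk => hcon k hk) a)
    have hta : t ≤ a := by
      by_contra! hlt
      exact hdiv fun i => (pow_dvd_pow _ hlt.le).trans (ht i)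
    choose l₀ hl₀ using ht
    have hl₀' : l = (p : ℤ) ^ t • l₀ := funext hl₀
    have hex : ∃ z, ¬ (p : ℤ) ∣ polarPoly A l₀ z := by
      by_contra! hz
      refine ht' fun i => ?_
      rw [hl₀ i, pow_succ]
      exact mul_dvd_mul_left _ (hβ l₀ hz i)
    obtain ⟨z, hz⟩ := hex
    refine ⟨t + a, by omega, y, z, by simp [hl], r' * polarPoly A l₀ z, ?_, hp'.not_dvd_mul hr'z hz⟩
    rw [← hl, hl₀', smul_polarPoly, polarPoly_smul, hrz]
    ring

end Isotropy

/-! ### Integral coordinates; local consequences of maximality and of the order of `β` -/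

section Coordinates

open Module QuadraticMap

variable {V : Type*} [AddCommGroup V] [Module ℚ V] {N : ℕ}

/-- The integral upper triangular Gram matrix of a quadratic form with respect to a basis of a
lattice on which it is integral. -/
def triGram (Q : QuadraticForm ℚ V) (v : Basis (Fin N) ℚ V) : Matrix (Fin N) (Fin N) ℤ :=
  fun i j => ⌊Q.toBilin v (v i) (v j)⌋

lemma polar_eq_int {Q : QuadraticForm ℚ V} {L : Submodule ℤ V} (hint : IsIntegralOn Q L) {x y : V}
    (hx : x ∈ L) (hy : y ∈ L) : ∃ k : ℤ, polar Q x y = k := by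
  obtain ⟨a, ha⟩ := hint _ (L.add_mem hx hy)
  obtain ⟨b, hb⟩ := hint _ hx
  obtain ⟨c, hc⟩ := hint _ hy
  exact ⟨a - b - c, by rw [polar, ha, hb, hc]; push_cast; ring⟩

lemma cast_triGram {Q : QuadraticForm ℚ V} {L : Submodule ℤ V} (hint : IsIntegralOn Q L)
    (v : Basis (Fin N) ℚ V) (hv : ∀ i, v i ∈ L) (i j : Fin N) :
    (triGram Q v i j : ℚ) = Q.toBilin v (v i) (v j) := by
  have : ∃ k : ℤ, Q.toBilin v (v i) (v j) = k := by
    rw [toBilin_apply]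
    split_ifs
    · exact hint _ (hv i)
    · exact polar_eq_int hint (hv i) (hv j)
    · exact ⟨0, by simp⟩
  obtain ⟨k, hk⟩ := this
  rw [triGram, hk, Int.floor_intCast]

/-- The vector with given integral coordinates. -/
def vec (v : Fin N → V) (x : Fin N → ℤ) : V := ∑ i, x i • v i

omit [Module ℚ V] in
lemma vec_add (v : Fin N → V) (x y : Fin N → ℤ) : vec v (x + y) = vec v x + vec v y := by
  simp [vec, add_smul, Finset.sum_add_distrib]

omit [Module ℚ V] in
lemma vec_sub (v : Fin N → V) (x y : Fin N → ℤ) : vec v (x - y) = vec v x - vec v y := by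
  simp [vec, sub_smul, Finset.sum_sub_distrib]

omit [Module ℚ V] in
lemma vec_smul (v : Fin N → V) (t : ℤ) (x : Fin N → ℤ) : vec v (t • x) = t • vec v x := by
  simp [vec, mul_smul, Finset.smul_sum]

lemma vec_eq_rat (v : Fin N → V) (x : Fin N → ℤ) : vec v x = ∑ i, (x i : ℚ) • v i := by
  simp [vec, Int.cast_smul_eq_zsmul]

lemma vec_injective (v : Basis (Fin N) ℚ V) : Function.Injective (vec v) := by
  intro x y h
  rw [vec_eq_rat, vec_eq_rat] at h
  funext i
  have h1 := congrArg (fun z => v.repr z i) h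
  simpa only [Basis.repr_sum_self, Int.cast_inj] using h1

section LatticeCongruences

variable {Q : QuadraticForm ℚ V} {L : Submodule ℤ V} (hint : IsIntegralOn Q L)
  (v : Basis (Fin N) ℚ V) (hv : ∀ i, v i ∈ L)

include hint hv

lemma toBilin_vec (x y : Fin N → ℤ) :
    Q.toBilin v (vec v x) (vec v y) = ∑ i, ∑ j, (triGram Q v i j : ℚ) * x i * y j := by
  rw [vec_eq_rat, vec_eq_rat, LinearMap.map_sum₂]
  refine Finset.sum_congr rfl fun i _ => ?_
  rw [map_sum]
  refine Finset.sum_congr rfl fun j _ => ?_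
  rw [LinearMap.map_smul₂, map_smul, cast_triGram hint v hv, smul_eq_mul, smul_eq_mul]
  ring

lemma quadForm_vec (x : Fin N → ℤ) : Q (vec v x) = (quadPoly (triGram Q v) 0 0 x : ℤ) := by
  conv_lhs => rw [← toQuadraticMap_toBilin Q v]
  rw [LinearMap.BilinMap.toQuadraticMap_apply, toBilin_vec hint v hv]
  simp [quadPoly]

lemma polar_vec (x y : Fin N → ℤ) :
    polar Q (vec v x) (vec v y) = (polarPoly (triGram Q v) x y : ℤ) := by
  rw [polar, ← vec_add, quadForm_vec hint v hv, quadForm_vec hint v hv, quadForm_vec hint v hv,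
    quadPoly_add]
  push_cast
  ring

lemma det_triGram_ne_zero [FiniteDimensional ℚ V] (hrad : finrank ℚ Q.radical = 0) :
    (triGram Q v + (triGram Q v).transpose).det ≠ 0 := by
  intro hdet
  obtain ⟨w, hw0, hw⟩ := Matrix.exists_mulVec_eq_zero_iff.2 hdet
  have hpol : ∀ y, polarPoly (triGram Q v) w y = 0 := by
    intro y
    rw [polarPoly]
    refine Finset.sum_eq_zero fun i _ => ?_
    have : ((triGram Q v + (triGram Q v).transpose).map (Int.cast : ℤ → ℤ)) =
      triGram Q v + (triGram Q v).transpose := by ext; simp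
    rw [this, hw]
    simp
  have hmem : vec v w ∈ Q.radical := by
    refine ⟨?_, ?_⟩
    · have h := polarPoly_self (triGram Q v) w
      rw [hpol] at h
      rw [quadForm_vec hint v hv]
      exact_mod_cast (by omega : quadPoly (triGram Q v) 0 0 w = 0)
    · refine v.ext fun j => ?_
      have h1 : v j = vec v (Pi.single j 1) := by
        simp [vec, Pi.single_apply]
      rw [polarBilin_apply_apply, h1, polar_vec hint v hv, hpol]
      simp
  rw [Submodule.finrank_eq_zero.1 hrad, Submodule.mem_bot] at hmem
  exact hw0 (vec_injective v (hmem.trans (by simp [vec])))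

end LatticeCongruences

omit [Module ℚ V] in
lemma mem_iff_exists_vec {L : Submodule ℤ V} (bL : Basis (Fin N) ℤ L) (x : V) :
    x ∈ L ↔ ∃ X, vec (fun i => (bL i : V)) X = x := by
  constructor
  · intro hx
    refine ⟨fun i => bL.repr ⟨x, hx⟩ i, ?_⟩
    have h := congrArg L.subtype (bL.sum_repr ⟨x, hx⟩)
    rw [map_sum] at h
    exact h
  · rintro ⟨X, rfl⟩
    exact L.sum_mem fun i _ => L.smul_mem _ (bL i).2

lemma smul_localized (p : ℕ) [Fact p.Prime] (t : ℤ_[p]) (y : ℚ_[p] ⊗[ℚ] V) :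
    t • y = (t : ℚ_[p]) • y := by
  induction y with
  | zero => simp
  | add a b ha hb => rw [smul_add, smul_add, ha, hb]
  | tmul a b =>
    rw [TensorProduct.smul_tmul', TensorProduct.smul_tmul']
    rfl

lemma localLattice_fg {L : Submodule ℤ V} (bL : Basis (Fin N) ℤ L) (p : ℕ) [Fact p.Prime] :
    (localLattice L p).FG := by
  have : localLattice L p =
      Submodule.span ℤ_[p] (Set.range fun i => (1 : ℚ_[p]) ⊗ₜ[ℚ] (bL i : V)) := by
    refine le_antisymm (Submodule.span_le.2 ?_) (Submodule.span_mono ?_)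
    · rintro _ ⟨x, hx, rfl⟩
      obtain ⟨X, rfl⟩ := (mem_iff_exists_vec bL x).1 hx
      simp only [vec, TensorProduct.tmul_sum]
      refine Submodule.sum_mem _ fun i _ => ?_
      rw [TensorProduct.tmul_smul]
      exact zsmul_mem (Submodule.subset_span (Set.mem_range_self i)) _
    · rintro _ ⟨i, rfl⟩
      exact ⟨_, (bL i).2, rfl⟩
  rw [this]
  exact Submodule.fg_span (Set.finite_range _)

lemma norm_polar_baseChange_le {Q : QuadraticForm ℚ V} {L : Submodule ℤ V} (p : ℕ) [Fact p.Prime]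
    {x : V} (hpol : ∀ y ∈ L, ∃ k : ℤ, polar Q y x = p * k) {y : ℚ_[p] ⊗[ℚ] V}
    (hy : y ∈ localLattice L p) :
    ‖polar (Q.baseChange ℚ_[p]) y ((p : ℚ_[p])⁻¹ ⊗ₜ[ℚ] x)‖ ≤ 1 := by
  have hp0 : (p : ℚ_[p]) ≠ 0 := Nat.cast_ne_zero.2 (Fact.out : p.Prime).ne_zero
  induction hy using Submodule.span_induction with
  | mem y hy =>
    obtain ⟨l, hl, rfl⟩ := hy
    obtain ⟨k, hk⟩ := hpol l hl
    have h1 : (p : ℚ_[p])⁻¹ ⊗ₜ[ℚ] x = (p : ℚ_[p])⁻¹ • ((1 : ℚ_[p]) ⊗ₜ[ℚ] x) := by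
      rw [TensorProduct.smul_tmul', smul_eq_mul, mul_one]
    have h2 : polar (Q.baseChange ℚ_[p]) ((1 : ℚ_[p]) ⊗ₜ[ℚ] l) ((1 : ℚ_[p]) ⊗ₜ[ℚ] x) =
        (p * k : ℚ_[p]) := by
      have h3 : ((polar Q l x : ℚ) : ℚ_[p]) = p * k := by rw [hk]; push_cast; ring
      rw [← h3, polar, polar, ← TensorProduct.tmul_add]
      simp only [QuadraticForm.baseChange_tmul, mul_one, Algebra.smul_def, eq_ratCast]
      push_cast
      ring
    rw [h1, polar_smul_right, h2, smul_eq_mul, ← mul_assoc, inv_mul_cancel₀ hp0, one_mul]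
    exact Padic.norm_int_le_one k
  | zero => simp
  | add a b _ _ ha hb =>
    rw [polar_add_left]
    exact (Padic.nonarchimedean _ _).trans (max_le ha hb)
  | smul t a _ ha =>
    rw [smul_localized, polar_smul_left, smul_eq_mul, norm_mul]
    exact mul_le_one₀ t.2 (norm_nonneg _) ha

/-- Under the two divisibility conditions on `x`, adjoining `x/p` to `L ⊗ ℤ_p` keeps the form
integral. Maximality puts `x/p` into `L ⊗ ℤ_p`, so the coordinates of `x` are divisible by `p`. -/
lemma isReducedAt_of_isMaximalAt {Q : QuadraticForm ℚ V} {L : Submodule ℤ V} [L.IsLattice ℚ]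
    (hint : IsIntegralOn Q L) (bL : Basis (Fin N) ℤ L) (p : ℕ) [Fact p.Prime]
    (hmax : IsMaximalAt Q L p) : IsReducedAt (triGram Q (bL.extendOfIsLattice ℚ)) p := by
  have hp : p.Prime := Fact.out
  have hp0 : (p : ℚ_[p]) ≠ 0 := Nat.cast_ne_zero.2 hp.ne_zero
  set v := bL.extendOfIsLattice ℚ with hvdef
  have hvL : ∀ i, v i = bL i := fun i => Basis.extendOfIsLattice_apply ℚ bL i
  have hv : ∀ i, v i ∈ L := fun i => (hvL i) ▸ (bL i).2
  have hvec : vec (fun i => (bL i : V)) = vec v := by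
    funext x
    simp [vec, hvL]
  intro X hX hQ i
  set x := vec v X with hx
  have hpol : ∀ y ∈ L, ∃ k : ℤ, polar Q y x = p * k := by
    intro y hy
    obtain ⟨Y, rfl⟩ := (mem_iff_exists_vec bL y).1 hy
    obtain ⟨k, hk⟩ := hX Y
    refine ⟨k, ?_⟩
    rw [hvec, polar_comm, hx, polar_vec hint v hv, hk]
    push_cast
    ring
  obtain ⟨k, hk⟩ := hQ
  have hQx : Q x = (p : ℚ) ^ 2 * k := by
    rw [hx, quadForm_vec hint v hv, hk]; push_cast; ring
  set w : ℚ_[p] ⊗[ℚ] V := (p : ℚ_[p])⁻¹ ⊗ₜ[ℚ] x with hw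
  have hQw : Q.baseChange ℚ_[p] w = k := by
    rw [hw, QuadraticForm.baseChange_tmul, hQx, Algebra.smul_def, eq_ratCast]
    push_cast
    field_simp
  let M := localLattice L p ⊔ Submodule.span ℤ_[p] {w}
  have hMint : IsIntegralAt Q p M := by
    intro z hz
    obtain ⟨y, hy, u, hu, rfl⟩ := Submodule.mem_sup.1 hz
    obtain ⟨t, rfl⟩ := Submodule.mem_span_singleton.1 hu
    rw [QuadraticMap.map_add (Q.baseChange ℚ_[p])]
    refine (Padic.nonarchimedean _ _).trans (max_le
      ((Padic.nonarchimedean _ _).trans (max_le (hmax.1 y hy) ?_)) ?_)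
    · rw [smul_localized, QuadraticMap.map_smul, hQw, smul_eq_mul, norm_mul, norm_mul]
      exact mul_le_one₀ (mul_le_one₀ t.2 (norm_nonneg _) t.2) (norm_nonneg _)
        (Padic.norm_int_le_one k)
    · rw [smul_localized, polar_smul_right, smul_eq_mul, norm_mul]
      exact mul_le_one₀ t.2 (norm_nonneg _) (norm_polar_baseChange_le p hpol hy)
  have hM := hmax.2 M ((localLattice_fg bL p).sup (Submodule.fg_span_singleton w)) hMint le_sup_left
  have hwmem : w ∈ localLattice L p := hM ▸ Submodule.mem_sup_right (Submodule.mem_span_singleton_self w)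
  let W := v.baseChange ℚ_[p]
  have hcoord : ∀ z ∈ localLattice L p, ‖W.repr z i‖ ≤ 1 := by
    intro z hz
    induction hz using Submodule.span_induction with
    | mem y hy =>
      obtain ⟨l, hl, rfl⟩ := hy
      obtain ⟨Y, rfl⟩ := (mem_iff_exists_vec bL l).1 hl
      simp only [W]
      rw [Basis.baseChange_repr_tmul, hvec, vec_eq_rat, Basis.repr_sum_self, Algebra.smul_def,
        eq_ratCast, mul_one, Rat.cast_intCast]
      exact Padic.norm_int_le_one _
    | zero => simp
    | add a b _ _ ha hb =>
      rw [map_add, Finsupp.add_apply]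
      exact (Padic.nonarchimedean _ _).trans (max_le ha hb)
    | smul t a _ ha =>
      rw [smul_localized, map_smul, Finsupp.smul_apply, smul_eq_mul, norm_mul]
      exact mul_le_one₀ t.2 (norm_nonneg _) ha
  have h1 := hcoord w hwmem
  simp only [W] at h1
  rw [hw, Basis.baseChange_repr_tmul, hx, vec_eq_rat, Basis.repr_sum_self, Algebra.smul_def,
    eq_ratCast, Rat.cast_intCast, norm_mul, norm_inv, Padic.norm_p, inv_inv] at h1
  have hpr : (1 : ℝ) < p := by exact_mod_cast hp.one_lt
  rw [← Padic.norm_intCast_lt_one_iff]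
  nlinarith [norm_nonneg (X i : ℚ_[p])]

/-- The vector `x/p` lies in the dual lattice and its class in `L^∨/L` is killed by `p`; since `p`
does not divide the order of this group, the class is trivial. -/
lemma dvd_of_not_dvd_disc {Q : QuadraticForm ℚ V} {L : Submodule ℤ V} [L.IsLattice ℚ]
    (hint : IsIntegralOn Q L) (bL : Basis (Fin N) ℤ L) {p : ℕ} (hp : p.Prime)
    (hdisc : ¬ p ∣ disc Q L) (X : Fin N → ℤ)
    (hX : ∀ Y, (p : ℤ) ∣ polarPoly (triGram Q (bL.extendOfIsLattice ℚ)) X Y) (i : Fin N) :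
    (p : ℤ) ∣ X i := by
  have hp0 : (p : ℚ) ≠ 0 := Nat.cast_ne_zero.2 hp.ne_zero
  set v := bL.extendOfIsLattice ℚ with hvdef
  have hvL : ∀ i, v i = bL i := fun i => Basis.extendOfIsLattice_apply ℚ bL i
  have hv : ∀ i, v i ∈ L := fun i => (hvL i) ▸ (bL i).2
  have hvec : vec (fun i => (bL i : V)) = vec v := by
    funext x
    simp [vec, hvL]
  set x := (p : ℚ)⁻¹ • vec v X with hx
  have hpx : p • x = vec v X := by
    rw [hx, ← Nat.cast_smul_eq_nsmul ℚ, smul_smul, mul_inv_cancel₀ hp0, one_smul]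
  have hdual : x ∈ dualLattice Q L := by
    rw [dualLattice, LinearMap.BilinForm.mem_dualSubmodule]
    intro y hy
    obtain ⟨Y, rfl⟩ := (mem_iff_exists_vec bL y).1 hy
    obtain ⟨k, hk⟩ := hX Y
    rw [hx, hvec, map_smul, LinearMap.smul_apply, polarBilin_apply_apply, polar_vec hint v hv, hk,
      Submodule.mem_one]
    refine ⟨k, ?_⟩
    simp only [eq_intCast, smul_eq_mul]
    push_cast
    field_simp
  let cl : dualLattice Q L ⧸ L.submoduleOf (dualLattice Q L) := Submodule.Quotient.mk ⟨x, hdual⟩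
  have hcl : p • cl = 0 := by
    rw [← Submodule.Quotient.mk_smul, Submodule.Quotient.mk_eq_zero]
    change p • x ∈ L
    rw [hpx, ← hvec]
    exact (mem_iff_exists_vec bL _).2 ⟨X, rfl⟩
  have hcl0 : cl = 0 := by
    rcases (Nat.dvd_prime hp).1 (addOrderOf_dvd_of_nsmul_eq_zero hcl) with h | h
    · exact AddMonoid.addOrderOf_eq_one_iff.1 h
    · exact absurd (h ▸ addOrderOf_dvd_natCard cl) hdisc
  rw [Submodule.Quotient.mk_eq_zero] at hcl0
  replace hcl0 : x ∈ L := hcl0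
  obtain ⟨Z, hZ⟩ := (mem_iff_exists_vec bL _).1 hcl0
  have h1 : vec v ((p : ℤ) • Z) = vec v X := by
    rw [vec_smul, ← hvec, hZ, hvec, ← hpx, natCast_zsmul]
  exact ⟨Z i, (congrFun (vec_injective v h1) i).symm⟩

omit [Module ℚ V] in
lemma mem_scale_iff {r : ℕ} {L : Submodule ℤ V} {x : V} :
    x ∈ scale r L ↔ ∃ y ∈ L, (r : ℤ) • y = x := by
  simp [scale, Submodule.mem_map]

/-- A multiple of `β` by an integer prime to `p` lies in `rL`, hence in `p^a L`, and the multiplier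
can be cancelled. -/
lemma pow_dvd_of_dvd_disc {Q : QuadraticForm ℚ V} {L : Submodule ℤ V} [L.IsLattice ℚ]
    (bL : Basis (Fin N) ℤ L) {p r a : ℕ} (har : p ^ a ∣ r) (β : L)
    (hβ : (orderMod r L β).Coprime (disc Q L)) (hdisc : p ∣ disc Q L) (X : Fin N → ℤ)
    (hX : vec (bL.extendOfIsLattice ℚ) X = β) (i : Fin N) : (p : ℤ) ^ a ∣ X i := by
  set v := bL.extendOfIsLattice ℚ with hvdef
  have hvL : ∀ i, v i = bL i := fun i => Basis.extendOfIsLattice_apply ℚ bL i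
  have hvec : vec (fun i => (bL i : V)) = vec v := by
    funext x
    simp [vec, hvL]
  have hcop : (orderMod r L β).Coprime p := hβ.coprime_dvd_right hdisc
  have h0 : orderMod r L β • (Submodule.Quotient.mk β : L ⧸ (scale r L).submoduleOf L) = 0 :=
    addOrderOf_nsmul_eq_zero _
  rw [← Submodule.Quotient.mk_smul, Submodule.Quotient.mk_eq_zero] at h0
  replace h0 : orderMod r L β • (β : V) ∈ scale r L := h0
  obtain ⟨l, hl, hl'⟩ := mem_scale_iff.1 h0
  obtain ⟨Y, rfl⟩ := (mem_iff_exists_vec bL l).1 hl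
  have h1 : vec v ((r : ℤ) • Y) = vec v ((orderMod r L β : ℤ) • X) := by
    rw [vec_smul, vec_smul, ← hvec, hl', hvec, hX, natCast_zsmul]
  have h2 := congrFun (vec_injective v h1) i
  simp only [Pi.smul_apply, smul_eq_mul] at h2
  have h3 : (p : ℤ) ^ a ∣ (orderMod r L β : ℤ) * X i := by
    rw [← h2]
    exact Dvd.dvd.mul_right (by exact_mod_cast har) _
  refine IsCoprime.dvd_of_dvd_mul_left ?_ h3
  exact (Nat.isCoprime_iff_coprime.2 hcop.symm).pow_left

/-- Coordinates on the coset `β + Λ` of `Λ = rL`, in which the quadratic form is the polynomial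
`quadPoly A b c₀`. -/
structure CosetCoordinates (Q : QuadraticForm ℚ V) (Λ : Submodule ℤ V) (β : V) (N : ℕ) where
  v : Fin N → V
  A : Matrix (Fin N) (Fin N) ℤ
  b : Fin N → ℤ
  c₀ : ℤ
  injective : Function.Injective (vec v)
  mem_iff : ∀ x, x ∈ Λ ↔ ∃ X, vec v X = x
  det_ne_zero : (A + A.transpose).det ≠ 0
  quad : ∀ X, Q (vec v X) = (quadPoly A 0 0 X : ℤ)
  -- With this sign `quadPoly A b c₀ X` is `Q (vec v X - β)`, in accordance with the term `-(x · β)`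
  -- in the Weil coefficients.
  polar : ∀ X, QuadraticMap.polar Q (vec v X) β = -((∑ i, b i * X i : ℤ) : ℚ)
  quad_shift : Q β = c₀

theorem exists_cosetCoordinates (Q : QuadraticForm ℚ V) (n : ℕ) (hn : 3 ≤ n)
    (hdim : Module.finrank ℚ V = n + 2) (hpos : sigPos Q = n) (hneg : sigNeg Q = 2)
    (L : Submodule ℤ V) [L.IsLattice ℚ] (hint : IsIntegralOn Q L) (hmax : IsMaximal Q L)
    (r : ℕ) (hr : 1 ≤ r) (β : L) (hβ : (orderMod r L β).Coprime (disc Q L)) :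
    ∃ C : CosetCoordinates Q (scale r L) β (n + 2), ∃ δ > 0, ∀ m : ℕ, RepresentedBy Q L r β m →
      δ ≤ (∑' c, singularCoeff C.A C.b (C.c₀ - m) c).re := by
  have : FiniteDimensional ℚ V := FiniteDimensional.of_finrank_pos (by omega)
  have hr0 : (r : ℤ) ≠ 0 := by exact_mod_cast (by omega : r ≠ 0)
  have hrank : finrank ℤ L = n + 2 := by
    rw [finrank, Submodule.IsLattice.rank' ℚ L, ← finrank, hdim]
  let bL : Basis (Fin (n + 2)) ℤ L := finBasisOfFinrankEq ℤ L hrank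
  set v := bL.extendOfIsLattice ℚ with hvdef
  have hvL : ∀ i, v i = bL i := fun i => Basis.extendOfIsLattice_apply ℚ bL i
  have hv : ∀ i, v i ∈ L := fun i => (hvL i) ▸ (bL i).2
  have hvec : vec (fun i => (bL i : V)) = vec v := by
    funext x
    simp [vec, hvL]
  have hrad : finrank ℚ Q.radical = 0 := by
    have := QuadraticForm.sigPos_add_sigNeg_add_radical (Q := Q)
    omega
  obtain ⟨B, hB⟩ := (mem_iff_exists_vec bL β).1 β.2
  rw [hvec] at hB
  set A := triGram Q v with hA
  have hvr : ∀ X, vec (fun i => (r : ℤ) • v i) X = vec v ((r : ℤ) • X) := by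
    intro X
    simp only [vec, Pi.smul_apply, smul_eq_mul, mul_smul]
    exact Finset.sum_congr rfl fun i _ => smul_comm _ _ _
  have hquad : ∀ X : Fin (n + 2) → ℤ, quadPoly ((r : ℤ) ^ 2 • A) 0 0 X = quadPoly A 0 0 ((r : ℤ) • X) := by
    intro X
    rw [quadForm_smul]
    simp [quadPoly, mul_assoc, Finset.mul_sum]
  have hpol : ∀ X Y : Fin (n + 2) → ℤ, polarPoly ((r : ℤ) ^ 2 • A) X Y =
      polarPoly A ((r : ℤ) • X) ((r : ℤ) • Y) := by
    intro X Y
    rw [smul_polarPoly, polarPoly_smul, polarPoly_eq, polarPoly_eq]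
    simp only [Matrix.smul_apply, smul_eq_mul, Finset.mul_sum]
    exact Finset.sum_congr rfl fun i _ => Finset.sum_congr rfl fun j _ => by push_cast; ring
  let b : Fin (n + 2) → ℤ := fun i => -(r * ((A + A.transpose).map (Int.cast : ℤ → ℤ)).mulVec B i)
  have hb : ∀ X : Fin (n + 2) → ℤ, ∑ i, b i * X i = -polarPoly A ((r : ℤ) • X) B := by
    intro X
    rw [smul_polarPoly, polarPoly_comm, polarPoly, Finset.mul_sum, ← Finset.sum_neg_distrib]
    exact Finset.sum_congr rfl fun i _ => by simp only [b]; ring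
  let C : CosetCoordinates Q (scale r L) β (n + 2) :=
    { v := fun i => (r : ℤ) • v i
      A := (r : ℤ) ^ 2 • A
      b := b
      c₀ := quadPoly A 0 0 B
      injective := fun X Y h => by
        rw [hvr, hvr] at h
        have h1 := vec_injective v h
        funext i
        have h2 := congrFun h1 i
        simp only [Pi.smul_apply, smul_eq_mul] at h2
        exact mul_left_cancel₀ hr0 h2
      mem_iff := fun x => by
        rw [mem_scale_iff]
        constructor
        · rintro ⟨y, hy, rfl⟩
          obtain ⟨Y, rfl⟩ := (mem_iff_exists_vec bL y).1 hy
          exact ⟨Y, by rw [hvr, vec_smul, hvec]⟩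
        · rintro ⟨X, rfl⟩
          exact ⟨vec v X, (mem_iff_exists_vec bL _).2 ⟨X, by rw [hvec]⟩, by rw [hvr, vec_smul]⟩
      det_ne_zero := by
        rw [Matrix.transpose_smul, ← smul_add, Matrix.det_smul]
        exact mul_ne_zero (pow_ne_zero _ (pow_ne_zero _ hr0)) (det_triGram_ne_zero hint v hv hrad)
      quad := fun X => by rw [hvr, quadForm_vec hint v hv, hquad]
      polar := fun X => by
        rw [hvr, ← hB, polar_vec hint v hv, hb]
        push_cast
        ring
      quad_shift := by rw [← hB, quadForm_vec hint v hv] }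
  -- Neither the quadratic part nor the valuation bound `2 v_p(r)` depends on `m`, so one `δ` serves
  -- all `m`.
  obtain ⟨δ, hδ, h⟩ := exists_le_singularSeries C.A C.det_ne_zero (by omega)
    (fun p => 2 * r.factorization p)
  refine ⟨C, δ, hδ, fun m hm => h _ _ fun p hp => ?_⟩
  have := Fact.mk hp
  obtain ⟨x, hx, hxm⟩ := hm
  obtain ⟨l, hl, hl'⟩ := mem_scale_iff.1 hx
  obtain ⟨Y, hY⟩ := (mem_iff_exists_vec bL l).1 hl
  rw [hvec] at hY
  -- The polynomial lives on `rL - β`, so a representing vector `x` of `β + rL` enters through `-x`.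
  have hxY : x = -vec v ((r : ℤ) • (-Y) - B) := by
    rw [vec_sub, smul_neg, ← neg_smul, vec_smul, hY, hB, neg_smul, hl']
    abel
  have hm' : quadPoly A 0 0 ((r : ℤ) • (-Y) - B) = m := by
    rw [hxY, QuadraticMap.map_neg, quadForm_vec hint v hv] at hxm
    exact_mod_cast hxm
  obtain ⟨k, hk, x₀, z, h1, u, h2, h3⟩ := exists_approxZero_coset A
    (Nat.ordProj_mul_ordCompl_eq_self r p).symm (Nat.not_dvd_ordCompl hp (by omega))
    (isReducedAt_of_isMaximalAt hint bL p (hmax p)) (by omega : 5 ≤ n + 2) B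
    (by
      by_cases hd : p ∣ disc Q L
      · exact Or.inr (pow_dvd_of_dvd_disc bL (Nat.ordProj_dvd r p) β hβ hd B hB)
      · exact Or.inl (dvd_of_not_dvd_disc hint bL hp hd)) (-Y)
  refine ⟨k, hk, x₀, z, ?_, u, ?_, h3⟩
  · rw [hm'] at h1
    convert h1 using 1
    have h4 : quadPoly A 0 0 ((r : ℤ) • x₀ - B) = quadPoly A 0 0 ((r : ℤ) • x₀) +
        quadPoly A 0 0 B - polarPoly A ((r : ℤ) • x₀) B := by
      have := quadPoly_add A 0 0 ((r : ℤ) • x₀) ((-1 : ℤ) • B)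
      rw [quadForm_smul A (-1) B, polarPoly_smul] at this
      rw [sub_eq_add_neg, ← neg_one_smul ℤ B, this]
      linear_combination
    rw [h4, ← hquad]
    have h5 := hb x₀
    simp only [quadPoly, C, Int.cast_id, Int.cast_zero, Pi.zero_apply, zero_mul,
      Finset.sum_const_zero] at h5 ⊢
    linarith
  · rw [← h2, sub_eq_add_neg, polarPoly_add, ← neg_one_smul ℤ B, smul_polarPoly A (-1) B,
      polarPoly_comm A B, ← hpol]
    have h5 := hb z
    simp only [C]
    linarith

end Coordinates

/-! ### Weil coefficients as Gauss sums -/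

section WeilCoefficients

open Module QuadraticMap

variable {V : Type*} [AddCommGroup V] [Module ℚ V] {N : ℕ} {Q : QuadraticForm ℚ V}
  {Λ : Submodule ℤ V} {β : V} (C : CosetCoordinates Q Λ β N)

/-- Integral coordinates of an element of `Λ`. -/
def CosetCoordinates.coord (x : Λ) : Fin N → ℤ := ((C.mem_iff x).1 x.2).choose

lemma CosetCoordinates.vec_coord (x : Λ) : vec C.v (C.coord x) = x :=
  ((C.mem_iff x).1 x.2).choose_spec

lemma CosetCoordinates.mk_eq_mk_iff (c : ℤ) (x y : Λ) :
    (Submodule.Quotient.mk x : Λ ⧸ LinearMap.range (LinearMap.lsmul ℤ Λ c)) =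
      Submodule.Quotient.mk y ↔ (fun i => (C.coord x i : ZMod c.natAbs)) =
        fun i => (C.coord y i : ZMod c.natAbs) := by
  rw [Submodule.Quotient.eq, LinearMap.mem_range]
  have h1 : (∃ z, LinearMap.lsmul ℤ Λ c z = x - y) ↔ ∃ Z, C.coord x - C.coord y = c • Z := by
    constructor
    · rintro ⟨z, hz⟩
      refine ⟨C.coord z, C.injective ?_⟩
      rw [vec_sub, vec_smul, C.vec_coord, C.vec_coord, C.vec_coord]
      exact (congrArg Subtype.val hz).symm
    · rintro ⟨Z, hZ⟩
      refine ⟨⟨vec C.v Z, (C.mem_iff _).2 ⟨Z, rfl⟩⟩, Subtype.ext ?_⟩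
      change c • vec C.v Z = (x : V) - y
      rw [← vec_smul, ← hZ, vec_sub, C.vec_coord, C.vec_coord]
  rw [h1, funext_iff]
  have h2 : ∀ i, ((C.coord x i : ZMod c.natAbs) = C.coord y i) ↔ c ∣ C.coord x i - C.coord y i := by
    intro i
    rw [← sub_eq_zero, ← Int.cast_sub, ZMod.intCast_zmod_eq_zero_iff_dvd, Int.natAbs_dvd]
  simp only [h2]
  constructor
  · rintro ⟨Z, hZ⟩ i
    exact ⟨Z i, congrFun hZ i⟩
  · intro h
    choose Z hZ using h
    exact ⟨Z, funext hZ⟩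

lemma CosetCoordinates.bijective_coord (c : ℤ) :
    Function.Bijective (fun (x : Λ ⧸ LinearMap.range (LinearMap.lsmul ℤ Λ c)) (i : Fin N) =>
      (C.coord (Quotient.out x) i : ZMod c.natAbs)) := by
  constructor
  · intro x y h
    have h1 := (C.mk_eq_mk_iff c (Quotient.out x) (Quotient.out y)).2 h
    have h2 : ∀ z : Λ ⧸ LinearMap.range (LinearMap.lsmul ℤ Λ c),
      (Submodule.Quotient.mk (Quotient.out z) : Λ ⧸ LinearMap.range (LinearMap.lsmul ℤ Λ c)) = z :=
      fun z => Quotient.out_eq z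
    rwa [h2, h2] at h1
  · intro y
    obtain ⟨Y, hY⟩ := exists_int_lift y
    let x : Λ := ⟨vec C.v Y, (C.mem_iff _).2 ⟨Y, rfl⟩⟩
    refine ⟨Submodule.Quotient.mk x, ?_⟩
    rw [← hY]
    have h2 : (Submodule.Quotient.mk (Quotient.out (Submodule.Quotient.mk x :
        Λ ⧸ LinearMap.range (LinearMap.lsmul ℤ Λ c))) : Λ ⧸ LinearMap.range (LinearMap.lsmul ℤ Λ c)) =
        Submodule.Quotient.mk x := Quotient.out_eq _
    have h3 := (C.mk_eq_mk_iff c _ _).1 h2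
    have h4 : C.coord x = Y := C.injective (C.vec_coord x)
    rw [h4] at h3
    exact h3

lemma e_div_eq_stdAddChar {c : ℤ} (hc : c ≠ 0) (t : ℤ) [NeZero c.natAbs] :
    e ((t : ℚ) / c) = ZMod.stdAddChar ((c.sign * t : ℤ) : ZMod c.natAbs) := by
  rw [ZMod.stdAddChar_coe, e]
  congr 1
  have h1 : (c : ℂ) = c.sign * (c.natAbs : ℂ) := by
    have h := congrArg (Int.cast : ℤ → ℂ) (Int.sign_mul_natAbs c).symm
    rwa [Int.cast_mul, Int.cast_natCast] at h
  have h2 : (c.sign : ℂ) * c.sign = 1 := by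
    rcases lt_or_gt_of_ne hc with h | h
    · simp [Int.sign_eq_neg_one_of_neg h]
    · simp [Int.sign_eq_one_of_pos h]
  have h3 : (c.natAbs : ℂ) ≠ 0 := Nat.cast_ne_zero.2 (NeZero.ne _)
  have h4 : (c.sign : ℂ) ≠ 0 := left_ne_zero_of_mul_eq_one h2
  push_cast
  rw [h1]
  field_simp
  linear_combination (-(t : ℂ)) * h2

/-- The matrix coefficient of the Weil representation at a matrix with bottom row `(c, d)`,
`c ≠ 0`. -/
lemma weilCoeff_eq_gauss (γ : SL(2, ℤ)) (hc : γ 1 0 ≠ 0) [NeZero (γ 1 0).natAbs] :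
    weilCoeff Q Λ γ 0 β = Complex.exp (Real.pi * Complex.I / 4) ^ (negSig Q * (γ 1 0).sign) /
        (Real.sqrt (|((γ 1 0 : ℤ) : ℝ)| ^ finrank ℚ V) * Real.sqrt (disc Q Λ) : ℝ) *
      gauss C.A C.b C.c₀ (γ 1 0).natAbs ((γ 1 0).sign * γ 1 1 : ℤ) := by
  simp only [weilCoeff]
  rw [if_neg hc]
  congr 1
  have hdet : γ 0 0 * γ 1 1 - γ 0 1 * γ 1 0 = 1 := by
    have := γ.det_coe
    rwa [Matrix.det_fin_two] at this
  generalize γ 0 0 = a at *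
  generalize γ 0 1 = b at *
  generalize γ 1 0 = c at *
  generalize γ 1 1 = d at *
  have had : (a : ZMod c.natAbs) * d = 1 := by
    have h1 : ((c : ℤ) : ZMod c.natAbs) = 0 := by
      rw [ZMod.intCast_zmod_eq_zero_iff_dvd, Int.natAbs_dvd]
    have h2 : ((a * d - b * c : ℤ) : ZMod c.natAbs) = 1 := by rw [hdet]; simp
    push_cast at h2
    rw [h1] at h2
    simpa using h2
  let F : (Fin N → ZMod c.natAbs) → ℂ := fun y => ZMod.stdAddChar
    ((c.sign : ZMod c.natAbs) * ((a : ZMod c.natAbs) * quadPoly C.A 0 0 y +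
      ∑ i, (C.b i : ZMod c.natAbs) * y i + (d : ZMod c.natAbs) * (C.c₀ : ZMod c.natAbs)))
  have hF : ∀ x : Λ ⧸ LinearMap.range (LinearMap.lsmul ℤ Λ c),
      e ((a * Q (0 + ((Quotient.out x : Λ) : V)) - polar Q (0 + ((Quotient.out x : Λ) : V)) β + d * Q β) / c) =
        F (fun i => (C.coord (Quotient.out x) i : ZMod c.natAbs)) := by
    intro x
    rw [zero_add, ← C.vec_coord, C.quad, C.polar, C.quad_shift]
    have h1 : ((a : ℚ) * (quadPoly C.A 0 0 (C.coord (Quotient.out x)) : ℤ) -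
        -((∑ i, C.b i * C.coord (Quotient.out x) i : ℤ) : ℚ) + d * C.c₀) =
        ((a * quadPoly C.A 0 0 (C.coord (Quotient.out x)) +
          ∑ i, C.b i * C.coord (Quotient.out x) i + d * C.c₀ : ℤ) : ℚ) := by
      push_cast
      ring
    rw [h1, e_div_eq_stdAddChar hc]
    simp only [F]
    congr 1
    rw [← cast_quadPoly]
    push_cast
    rfl
  rw [finsum_eq_of_bijective _ (C.bijective_coord c) (g := F) hF, finsum_eq_sum_of_fintype, gauss]
  let u : (ZMod c.natAbs)ˣ := ⟨d, a, by rw [mul_comm, had], had⟩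
  -- Since `a d ≡ 1` modulo `c`, replacing `y` by `d y` turns `a Q(y) - (y · β) + d Q(β)` into `d
  -- Q(y - β)`.
  rw [← Equiv.sum_comp (Equiv.piCongrRight fun _ : Fin N => u.mulLeft)]
  refine Finset.sum_congr rfl fun y _ => ?_
  have h2 : (Equiv.piCongrRight fun _ : Fin N => u.mulLeft) y = (d : ZMod c.natAbs) • y := by
    funext i
    simp [u]
  rw [h2]
  simp only [F]
  congr 1
  have h3 : quadPoly C.A C.b C.c₀ y =
      quadPoly C.A 0 0 y + ∑ i, (C.b i : ZMod c.natAbs) * y i + C.c₀ := by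
    simp [quadPoly]
  have h4 : ∑ i, (C.b i : ZMod c.natAbs) * ((d : ZMod c.natAbs) • y) i =
      d * ∑ i, (C.b i : ZMod c.natAbs) * y i := by
    rw [Finset.mul_sum]
    exact Finset.sum_congr rfl fun i _ => by simp only [Pi.smul_apply, smul_eq_mul]; ring
  rw [quadForm_smul, h3, h4]
  push_cast
  linear_combination ((c.sign : ZMod c.natAbs) * d * quadPoly C.A 0 0 y) * had

lemma gauss_sub {A : Matrix (Fin N) (Fin N) ℤ} (b : Fin N → ℤ) (c₀ m : ℤ) (c : ℕ) [NeZero c]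
    (d : ZMod c) :
    gauss A b (c₀ - m) c d = gauss A b c₀ c d * ZMod.stdAddChar (-(d * (m : ZMod c))) := by
  rw [gauss, gauss, Finset.sum_mul]
  refine Finset.sum_congr rfl fun x _ => ?_
  rw [← AddChar.map_add_eq_mul]
  congr 1
  simp only [quadPoly]
  push_cast
  ring

lemma gauss_congr (A : Matrix (Fin N) (Fin N) ℤ) (b : Fin N → ℤ) (c₀ : ℤ) {k k' : ℕ} [NeZero k]
    [NeZero k'] (h : k = k') (t : ℤ) :
    gauss A b c₀ k (t : ZMod k) = gauss A b c₀ k' (t : ZMod k') := by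
  subst h
  rfl

/-- The constant relating coefficients of the Weil representation to Gauss sums. -/
def weilConst (Q : QuadraticForm ℚ V) (Λ : Submodule ℤ V) (c : ℤ) : ℂ :=
  Complex.exp (Real.pi * Complex.I / 4) ^ (negSig Q * c.sign) /
    (Real.sqrt (|(c : ℝ)| ^ finrank ℚ V) * Real.sqrt (disc Q Λ) : ℝ)

open Classical in
/-- The matrix coefficient of the Weil representation at a matrix with bottom row `(c, d)`, extended
by zero. -/
def rowCoeff (c d : ℤ) : ℂ :=
  if IsCoprime c d then
    if h : c = 0 then
      if d • β ∈ Λ then Complex.exp (Real.pi * Complex.I / 4) ^ (negSig Q * (1 - d.sign)) else 0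
    else
      haveI : NeZero c.natAbs := ⟨Int.natAbs_ne_zero.2 h⟩
      weilConst Q Λ c * gauss C.A C.b C.c₀ c.natAbs (c.sign * d : ℤ)
  else 0

lemma isCoprime_bottom_row (γ : SL(2, ℤ)) : IsCoprime (γ 1 0) (γ 1 1) :=
  ModularGroup.bottom_row_coprime γ

lemma weilCoeff_eq_rowCoeff (γ : SL(2, ℤ)) :
    weilCoeff Q Λ γ 0 β = rowCoeff C (γ 1 0) (γ 1 1) := by
  rw [rowCoeff, if_pos (isCoprime_bottom_row γ)]
  by_cases hc : γ 1 0 = 0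
  · rw [dif_pos hc]
    have hdet : γ 0 0 * γ 1 1 = 1 := by
      have := γ.det_coe
      rw [Matrix.det_fin_two, hc] at this
      simpa using this
    have ha : γ 0 0 = γ 1 1 := by
      rcases Int.mul_eq_one_iff_eq_one_or_neg_one.1 hdet with ⟨h1, h2⟩ | ⟨h1, h2⟩ <;> rw [h1, h2]
    simp only [weilCoeff]
    rw [if_pos hc, ha, zero_sub, Submodule.neg_mem_iff]
    simp [e]
  · rw [dif_neg hc]
    have : NeZero (γ 1 0).natAbs := ⟨Int.natAbs_ne_zero.2 hc⟩
    rw [weilCoeff_eq_gauss C γ hc, weilConst]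

lemma norm_exp_pi_I_div_four : ‖Complex.exp (Real.pi * Complex.I / 4)‖ = 1 := by
  have : (Real.pi * Complex.I / 4 : ℂ) = ((Real.pi / 4 : ℝ) : ℂ) * Complex.I := by push_cast; ring
  rw [this, Complex.norm_exp_ofReal_mul_I]

lemma norm_weilConst (c : ℤ) :
    ‖weilConst Q Λ c‖ = (Real.sqrt (|(c : ℝ)| ^ finrank ℚ V) * Real.sqrt (disc Q Λ))⁻¹ := by
  rw [weilConst, norm_div, norm_zpow, norm_exp_pi_I_div_four, one_zpow, Complex.norm_real,
    Real.norm_of_nonneg (by positivity), one_div]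

lemma isUnit_sign_mul_of_isCoprime {c d : ℤ} (hc : c ≠ 0) (h : IsCoprime c d) :
    IsUnit ((c.sign * d : ℤ) : ZMod c.natAbs) := by
  rw [ZMod.coe_int_isUnit_iff_isCoprime, Int.isCoprime_iff_gcd_eq_one, Int.gcd, Int.natAbs_mul,
    Int.natAbs_sign_of_ne_zero hc, one_mul, Int.natAbs_natCast]
  exact Int.isCoprime_iff_gcd_eq_one.1 h

/-- The factor `|c|^(-N/2)` of the Weil constant cancels the growth of the Gauss sum. A bound
uniform in `(c, d)` is all that the absolute convergence of the unfolding needs. -/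
lemma norm_rowCoeff_le (hN : finrank ℚ V = N) (c d : ℤ) :
    ‖rowCoeff C c d‖ ≤ 1 + gaussBound C.A * (Real.sqrt (disc Q Λ))⁻¹ := by
  have h0 : 0 ≤ gaussBound C.A * (Real.sqrt (disc Q Λ))⁻¹ :=
    mul_nonneg (gaussBound_nonneg _) (by positivity)
  rw [rowCoeff]
  split_ifs with h1 h2 h3
  · rw [norm_zpow, norm_exp_pi_I_div_four, one_zpow]
    linarith
  · rw [norm_zero]; linarith
  · have : NeZero c.natAbs := ⟨Int.natAbs_ne_zero.2 h2⟩
    obtain ⟨u, hu⟩ := isUnit_sign_mul_of_isCoprime h2 h1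
    have h3 := norm_gauss_le C.A C.b C.c₀ C.det_ne_zero c.natAbs u
    rw [norm_mul, norm_weilConst, ← hu, hN]
    have hc0 : (0 : ℝ) < c.natAbs := by exact_mod_cast Int.natAbs_pos.2 h2
    have h5 : Real.sqrt (|(c : ℝ)| ^ N) = (c.natAbs : ℝ) ^ (N / 2 : ℝ) := by
      rw [Real.sqrt_eq_rpow, Nat.cast_natAbs, ← Real.rpow_natCast_mul (by positivity)]
      push_cast
      congr 1
      ring
    rw [h5, mul_inv]
    calc _ ≤ ((c.natAbs : ℝ) ^ (N / 2 : ℝ))⁻¹ * (Real.sqrt (disc Q Λ))⁻¹ *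
          (gaussBound C.A * (c.natAbs : ℝ) ^ (N / 2 : ℝ)) := by gcongr
      _ = gaussBound C.A * (Real.sqrt (disc Q Λ))⁻¹ := by
          field_simp
      _ ≤ _ := by linarith
  · rw [norm_zero]; linarith

lemma rowCoeff_add (c d : ℤ) (hc : c ≠ 0) (l : ℤ) : rowCoeff C c (d + c * l) = rowCoeff C c d := by
  have h1 : IsCoprime c (d + c * l) ↔ IsCoprime c d := IsCoprime.add_mul_left_right_iff
  rw [rowCoeff, rowCoeff, if_congr h1 rfl rfl, dif_neg hc, dif_neg hc]
  congr 3
  have : ((c : ℤ) : ZMod c.natAbs) = 0 := by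
    rw [ZMod.intCast_zmod_eq_zero_iff_dvd, Int.natAbs_dvd]
  push_cast
  rw [this]
  ring

lemma rowCoeff_neg (c d : ℤ) (hc : 0 < c) : rowCoeff C (-c) (-d) =
    Complex.exp (Real.pi * Complex.I / 4) ^ (-(2 * negSig Q)) * rowCoeff C c d := by
  have h1 : IsCoprime (-c) (-d) ↔ IsCoprime c d := by
    rw [IsCoprime.neg_left_iff, IsCoprime.neg_right_iff]
  have hne : Complex.exp (Real.pi * Complex.I / 4) ≠ 0 := Complex.exp_ne_zero _
  have h2 : weilConst Q Λ (-c) =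
      Complex.exp (Real.pi * Complex.I / 4) ^ (-(2 * negSig Q)) * weilConst Q Λ c := by
    rw [weilConst, weilConst, Int.sign_neg, Int.sign_eq_one_of_pos hc, ← mul_div_assoc,
      ← zpow_add₀ hne]
    push_cast
    rw [abs_neg]
    congr 2
    ring
  rw [rowCoeff, rowCoeff, if_congr h1 rfl rfl, dif_neg hc.ne', dif_neg (neg_ne_zero.2 hc.ne'), h2]
  split_ifs
  · have h3 : (-c).sign * -d = c.sign * d := by rw [Int.sign_neg]; ring
    have : NeZero c.natAbs := ⟨Int.natAbs_ne_zero.2 hc.ne'⟩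
    have : NeZero (-c).natAbs := ⟨Int.natAbs_ne_zero.2 (neg_ne_zero.2 hc.ne')⟩
    rw [h3, gauss_congr _ _ _ (Int.natAbs_neg c), mul_assoc]
  · rw [mul_zero]

/-- The finite Fourier transform of the Weil coefficients. -/
lemma sum_rowCoeff (c m : ℕ) [NeZero c] :
    ∑ d ∈ Finset.range c, star (rowCoeff C c d) *
      Complex.exp (2 * Real.pi * Complex.I * m * (d / c)) =
    star (weilConst Q Λ c) * unitGauss C.A C.b (C.c₀ - m) c := by
  have hc : c ≠ 0 := NeZero.ne c
  have hcz : (c : ℤ) ≠ 0 := by exact_mod_cast hc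
  have key : ∀ d : ℕ, c.Coprime d → star (rowCoeff C c d) *
      Complex.exp (2 * Real.pi * Complex.I * m * (d / c)) =
      star (weilConst Q Λ c) * star (gauss C.A C.b (C.c₀ - m) c (d : ZMod c)) := by
    intro d hd
    have : NeZero (c : ℤ).natAbs := ⟨Int.natAbs_ne_zero.2 hcz⟩
    have h1 : Complex.exp (2 * Real.pi * Complex.I * m * (d / c)) =
        star (ZMod.stdAddChar (-((d : ZMod c) * ((m : ℤ) : ZMod c))) : ℂ) := by
      have h2 : -(-((d : ZMod c) * ((m : ℤ) : ZMod c))) = ((d * m : ℤ) : ZMod c) := by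
        push_cast; ring
      rw [star_stdAddChar, h2, ZMod.stdAddChar_coe]
      congr 1
      push_cast
      ring
    rw [rowCoeff, if_pos (Nat.isCoprime_iff_coprime.2 hd), dif_neg hcz,
      Int.sign_eq_one_of_pos (by positivity), one_mul, gauss_congr _ _ _ (Int.natAbs_natCast c), h1,
      gauss_sub, star_mul', star_mul', mul_assoc]
    simp only [Int.cast_natCast]
  have hz : ∀ d ∈ Finset.range c, ¬ c.Coprime d → star (rowCoeff C c d) *
      Complex.exp (2 * Real.pi * Complex.I * m * (d / c)) = 0 := by
    intro d _ hd
    rw [rowCoeff, if_neg (fun h => hd (Nat.isCoprime_iff_coprime.1 h)), star_zero, zero_mul]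
  -- The summands are conjugates of Gauss sums, which does no harm because the sum over units is
  -- real.
  rw [← star_unitGauss, unitGauss_eq, star_sum, Finset.mul_sum]
  symm
  refine Finset.sum_of_injOn (fun u : (ZMod c)ˣ => (u : ZMod c).val) ?_ ?_ ?_ ?_
  · exact fun u _ v _ h => Units.ext (ZMod.val_injective c h)
  · exact fun u _ => Finset.mem_coe.2 (Finset.mem_range.2 (ZMod.val_lt _))
  · intro d hd hd'
    refine hz d hd fun hcop => hd' ⟨ZMod.unitOfCoprime d hcop.symm, Finset.mem_coe.2 (Finset.mem_univ _), ?_⟩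
    simp only [ZMod.coe_unitOfCoprime]
    exact ZMod.val_cast_of_lt (Finset.mem_range.1 hd)
  · intro u _
    rw [key _ (ZMod.val_coe_unit_coprime u).symm, ZMod.natCast_zmod_val]

end WeilCoefficients

/-! ### Holomorphic parametric integrals -/

section ParametricIntegrals

open MeasureTheory Filter Topology

/-- A dominated parametric integral of holomorphic functions is holomorphic. -/
lemma differentiableAt_integral_of_dominated {α : Type*} [MeasurableSpace α] {μ : Measure α}
    {F : ℂ → α → ℂ} {z₀ : ℂ} {R : ℝ} (hR : 0 < R) {bound : α → ℝ}
    (hmeas : ∀ s ∈ Metric.ball z₀ R, AEStronglyMeasurable (F s) μ)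
    (hdiff : ∀ᵐ t ∂μ, DifferentiableOn ℂ (fun s => F s t) (Metric.ball z₀ R))
    (hbound : ∀ᵐ t ∂μ, ∀ s ∈ Metric.ball z₀ R, ‖F s t‖ ≤ bound t) (hint : Integrable bound μ) :
    DifferentiableAt ℂ (fun s => ∫ t, F s t ∂μ) z₀ := by
  have hz₀ : z₀ ∈ Metric.ball z₀ R := Metric.mem_ball_self hR
  have hball : ∀ᶠ s in 𝓝 z₀, s ∈ Metric.ball z₀ R := Metric.ball_mem_nhds z₀ hR
  -- The derivative is measurable as a limit of difference quotients with increments `R / (n + 2)`.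
  have hmeas' : AEStronglyMeasurable (fun t => deriv (fun s => F s t) z₀) μ := by
    let h : ℕ → ℂ := fun n => ((R / (n + 2) : ℝ) : ℂ)
    have hn : ∀ n : ℕ, 0 < R / (n + 2) := fun n => by positivity
    have hh0 : Tendsto (fun n => z₀ + h n) atTop (𝓝[≠] z₀) := by
      refine tendsto_nhdsWithin_iff.2 ⟨?_, Eventually.of_forall fun n => ?_⟩
      · have h1 : Tendsto (fun n : ℕ => R / ((n : ℝ) + 2)) atTop (𝓝 0) :=
          tendsto_const_nhds.div_atTop (tendsto_atTop_add_const_right _ _ tendsto_natCast_atTop_atTop)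
        have h2 := (Complex.continuous_ofReal.tendsto 0).comp h1
        have h3 := (tendsto_const_nhds (x := z₀)).add h2
        rw [Complex.ofReal_zero, add_zero] at h3
        exact h3
      · simp only [Set.mem_compl_iff, Set.mem_singleton_iff, add_eq_left, h, Complex.ofReal_eq_zero]
        exact (hn n).ne'
    refine aestronglyMeasurable_of_tendsto_ae atTop
      (f := fun n t => slope (fun s => F s t) z₀ (z₀ + h n)) (fun n => ?_) ?_
    · simp only [slope, vsub_eq_sub]
      suffices h1 : z₀ + h n ∈ Metric.ball z₀ R from
        ((hmeas _ h1).sub (hmeas _ hz₀)).const_smul ((z₀ + h n - z₀)⁻¹ : ℂ)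
      rw [Metric.mem_ball, dist_self_add_left, Complex.norm_real, Real.norm_of_nonneg (hn n).le]
      exact div_lt_self hR (by linarith [(Nat.cast_nonneg n : (0 : ℝ) ≤ n)])
    · filter_upwards [hdiff] with t ht
      have := (ht.differentiableAt hball).hasDerivAt
      exact (hasDerivAt_iff_tendsto_slope.1 this).comp hh0
  refine (hasDerivAt_integral_of_dominated_loc_of_deriv_le (s := Metric.ball z₀ (R / 2))
    (bound := fun t => bound t / (R / 2)) (F' := fun s t => deriv (fun s => F s t) s)
    (Metric.ball_mem_nhds _ (by positivity))
    (hball.mono hmeas) ?_ hmeas' ?_ (hint.div_const _) ?_).2.differentiableAt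
  · refine hint.mono' (hmeas _ hz₀) ?_
    filter_upwards [hbound] with t ht using ht _ hz₀
  -- Cauchy's estimate on discs of radius `R / 2` bounds the derivative by `bound t / (R / 2)`.
  · filter_upwards [hbound, hdiff] with t ht hd s hs
    have hsub : Metric.closedBall s (R / 2) ⊆ Metric.ball z₀ R := by
      intro w hw
      rw [Metric.mem_ball] at hs ⊢
      rw [Metric.mem_closedBall] at hw
      linarith [dist_triangle w s z₀]
    refine Complex.norm_deriv_le_of_forall_mem_sphere_norm_le (by positivity)
      (hd.diffContOnCl_ball hsub) fun w hw => ht w (hsub (Metric.sphere_subset_closedBall hw))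
  · filter_upwards [hdiff] with t ht s hs
    refine (ht.differentiableAt (Metric.isOpen_ball.mem_nhds ?_)).hasDerivAt
    exact Metric.ball_subset_ball (by linarith) hs

lemma integrableOn_rpow_mul_exp_neg_mul {a b : ℝ} (ha : -1 < a) (hb : 0 < b) :
    IntegrableOn (fun t : ℝ => t ^ a * Real.exp (-b * t)) (Set.Ioi 0) := by
  simpa using integrableOn_rpow_mul_exp_neg_mul_rpow ha one_pos hb

/-- Euler's integral for the Gamma function along the ray of slope `z`. -/
lemma integral_cpow_mul_exp_neg_mul {a : ℝ} (ha : 0 < a) {z : ℂ} (hz : 0 < z.re) :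
    ∫ t in Set.Ioi (0 : ℝ), (t : ℂ) ^ ((a : ℂ) - 1) * Complex.exp (-(z * t)) =
      z ^ (-(a : ℂ)) * Complex.Gamma a := by
  let U : Set ℂ := {z | 0 < z.re}
  have hU : IsOpen U := isOpen_lt continuous_const Complex.continuous_re
  have hconv : IsPreconnected U := (convex_halfSpace_re_gt 0).isPreconnected
  have hf : DifferentiableOn ℂ (fun z : ℂ => ∫ t in Set.Ioi (0 : ℝ),
      (t : ℂ) ^ ((a : ℂ) - 1) * Complex.exp (-(z * t))) U := by
    intro w hw
    have hw' : 0 < w.re := hw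
    refine (differentiableAt_integral_of_dominated (R := w.re / 2)
      (bound := fun t : ℝ => t ^ (a - 1) * Real.exp (-(w.re / 2) * t)) (by positivity) ?_ ?_ ?_
      (integrableOn_rpow_mul_exp_neg_mul (by linarith) (by positivity))).differentiableWithinAt
    · intro s _
      refine ContinuousOn.aestronglyMeasurable (fun t ht => ?_) measurableSet_Ioi
      refine ContinuousAt.continuousWithinAt (ContinuousAt.mul ?_ (by fun_prop))
      exact Complex.continuousAt_ofReal_cpow_const _ _ (Or.inr (ne_of_gt ht))
    · refine Eventually.of_forall fun t => ?_
      fun_prop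
    · filter_upwards [ae_restrict_mem measurableSet_Ioi] with t ht s hs
      have ht' : 0 < t := ht
      rw [norm_mul, Complex.norm_cpow_eq_rpow_re_of_pos ht', Complex.norm_exp]
      have h1 : w.re / 2 ≤ s.re := by
        have h2 := (Complex.abs_re_le_norm (s - w)).trans (mem_ball_iff_norm.1 hs).le
        rw [Complex.sub_re] at h2
        linarith [(abs_le.1 h2).1]
      have h3 : (-(s * t)).re ≤ -(w.re / 2) * t := by
        simp only [Complex.neg_re, Complex.mul_re, Complex.ofReal_re, Complex.ofReal_im, mul_zero,
          sub_zero]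
        nlinarith
      have h4 : ((a : ℂ) - 1).re = a - 1 := by simp
      rw [h4]
      gcongr
  have hg : DifferentiableOn ℂ (fun z : ℂ => z ^ (-(a : ℂ)) * Complex.Gamma a) U := by
    intro w hw
    refine DifferentiableAt.differentiableWithinAt (DifferentiableAt.mul_const ?_ _)
    exact differentiableAt_id.cpow_const (Or.inl hw)
  have heq : ∀ r : ℝ, 0 < r → (∫ t in Set.Ioi (0 : ℝ),
      (t : ℂ) ^ ((a : ℂ) - 1) * Complex.exp (-((r : ℂ) * t))) =
      (r : ℂ) ^ (-(a : ℂ)) * Complex.Gamma a := by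
    intro r hr
    rw [Complex.integral_cpow_mul_exp_neg_mul_Ioi (by simpa using ha) hr, one_div, Complex.cpow_neg,
      Complex.inv_cpow]
    rw [Complex.arg_ofReal_of_nonneg hr.le]
    exact Real.pi_pos.ne
  -- Identity theorem on the right half-plane: both sides agree at the points `1 + 1/(n+1)`, which
  -- accumulate at `1`.
  refine (hf.analyticOnNhd hU).eqOn_of_preconnected_of_frequently_eq (hg.analyticOnNhd hU) hconv
    (z₀ := 1) (by simp [U]) ?_ hz
  have hseq : Tendsto (fun n : ℕ => ((1 + 1 / ((n : ℝ) + 1) : ℝ) : ℂ)) atTop (𝓝[≠] 1) := by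
    refine tendsto_nhdsWithin_iff.2 ⟨?_, Eventually.of_forall fun n => ?_⟩
    · have h1 := (tendsto_const_nhds (x := (1 : ℝ))).add
        (tendsto_one_div_add_atTop_nhds_zero_nat (𝕜 := ℝ))
      have h2 := (Complex.continuous_ofReal.tendsto _).comp h1
      rw [add_zero, Complex.ofReal_one] at h2
      exact h2
    · have h0 : (0 : ℝ) < 1 / ((n : ℝ) + 1) := by positivity
      intro h
      have h2 : (1 + 1 / ((n : ℝ) + 1) : ℝ) = 1 := Complex.ofReal_injective h
      linarith
  refine hseq.frequently (Frequently.of_forall fun n => ?_)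
  exact heq _ (by positivity)

end ParametricIntegrals

/-! ### The archimedean integral -/

section Archimedean

open MeasureTheory Filter Topology

/-- The function `(t + iv)^(-k) (v / (t² + v²))^s`. -/
def archKernel (k : ℝ) (s : ℂ) (v t : ℝ) : ℂ :=
  ((t : ℂ) + v * Complex.I) ^ (-(k : ℂ)) * ((v / (t ^ 2 + v ^ 2) : ℝ) : ℂ) ^ s

lemma add_mul_I_mem_slitPlane {t v : ℝ} (hv : 0 < v) : (t : ℂ) + v * Complex.I ∈ Complex.slitPlane :=
  Or.inr (by simpa using hv.ne')

lemma norm_archKernel (k : ℝ) (s : ℂ) {v : ℝ} (hv : 0 < v) (t : ℝ) :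
    ‖archKernel k s v t‖ = v ^ s.re * (t ^ 2 + v ^ 2) ^ (-(k / 2 + s.re)) := by
  have h0 : (0 : ℝ) < t ^ 2 + v ^ 2 := by positivity
  have h1 : ‖(t : ℂ) + v * Complex.I‖ = (t ^ 2 + v ^ 2) ^ (1 / 2 : ℝ) := by
    rw [Complex.norm_add_mul_I, Real.sqrt_eq_rpow]
  have h2 : (-(k : ℂ)) = ((-k : ℝ) : ℂ) := by push_cast; ring
  rw [archKernel, norm_mul, h2, Complex.norm_cpow_real, h1,
    Complex.norm_cpow_eq_rpow_re_of_pos (by positivity), Real.div_rpow hv.le h0.le,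
    ← Real.rpow_mul h0.le, neg_add, Real.rpow_add h0, Real.rpow_neg h0.le s.re]
  have h3 : 1 / 2 * -k = -(k / 2) := by ring
  rw [h3]
  field_simp

lemma continuous_archKernel (k : ℝ) (s : ℂ) {v : ℝ} (hv : 0 < v) : Continuous (archKernel k s v) := by
  unfold archKernel
  refine Continuous.mul ?_ ?_
  · exact Continuous.cpow (by fun_prop) continuous_const fun t => add_mul_I_mem_slitPlane hv
  · refine Continuous.cpow ?_ continuous_const fun t => ?_
    · exact Complex.continuous_ofReal.comp (Continuous.div₀ continuous_const (by fun_prop)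
        fun t => by positivity)
    · exact Complex.ofReal_mem_slitPlane.2 (by positivity)

lemma integrable_rpow_sq_add_sq {a v : ℝ} (ha : 1 < a) (hv : 0 < v) :
    Integrable (fun t : ℝ => (t ^ 2 + v ^ 2) ^ (-(a / 2))) := by
  have h1 := (integrable_rpow_neg_one_add_norm_sq (E := ℝ) (μ := volume) (r := a)
    (by simpa using ha)).comp_div hv.ne'
  refine (h1.const_mul ((v ^ 2) ^ (-(a / 2)))).congr (Eventually.of_forall fun t => ?_)
  simp only
  rw [neg_div, ← Real.mul_rpow (by positivity) (by positivity)]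
  congr 1
  rw [Real.norm_eq_abs, sq_abs, div_pow]
  field_simp
  ring

lemma integrable_archKernel {k : ℝ} {s : ℂ} (hks : 1 < k + 2 * s.re) {v : ℝ} (hv : 0 < v) :
    Integrable (archKernel k s v) := by
  refine ((integrable_rpow_sq_add_sq hks hv).const_mul (v ^ s.re)).mono'
    (continuous_archKernel k s hv).aestronglyMeasurable (Eventually.of_forall fun t => ?_)
  rw [norm_archKernel k s hv]
  refine le_of_eq ?_
  congr 2
  ring

lemma norm_exp_two_pi_I_mul (m t : ℝ) : ‖Complex.exp (-(2 * Real.pi * Complex.I * m * t))‖ = 1 := by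
  have : (-(2 * Real.pi * Complex.I * m * t) : ℂ) = ((-(2 * Real.pi * m * t) : ℝ) : ℂ) * Complex.I := by
    push_cast; ring
  rw [this, Complex.norm_exp_ofReal_mul_I]

/-- The Fourier integral of `archKernel`. -/
def archIntegral (k : ℝ) (s : ℂ) (v m : ℝ) : ℂ :=
  ∫ t : ℝ, archKernel k s v t * Complex.exp (-(2 * Real.pi * Complex.I * m * t))

lemma integrable_archIntegrand {k : ℝ} {s : ℂ} (hks : 1 < k + 2 * s.re) {v : ℝ} (hv : 0 < v) (m : ℝ) :
    Integrable (fun t : ℝ => archKernel k s v t *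
      Complex.exp (-(2 * Real.pi * Complex.I * m * t))) := by
  refine (integrable_archKernel hks hv).mul_bdd (c := 1) (by fun_prop) (Eventually.of_forall fun t => ?_)
  rw [norm_exp_two_pi_I_mul]

lemma ofReal_mul_cpow {r : ℝ} (hr : 0 < r) {z : ℂ} (hz : z ≠ 0) (w : ℂ) :
    ((r : ℂ) * z) ^ w = (r : ℂ) ^ w * z ^ w := by
  have hr0 : (r : ℂ) ≠ 0 := Complex.ofReal_ne_zero.2 hr.ne'
  rw [Complex.cpow_def_of_ne_zero (mul_ne_zero hr0 hz), Complex.cpow_def_of_ne_zero hr0,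
    Complex.cpow_def_of_ne_zero hz, Complex.log_ofReal_mul hr hz, Complex.ofReal_log hr.le, add_mul,
    Complex.exp_add]

lemma archKernel_mul (k : ℝ) (s : ℂ) {v : ℝ} (hv : 0 < v) (t : ℝ) :
    archKernel k s v (v * t) = (v : ℂ) ^ (-(k : ℂ) - s) * archKernel k s 1 t := by
  have hv0 : (v : ℂ) ≠ 0 := Complex.ofReal_ne_zero.2 hv.ne'
  have h1 : ((v * t : ℝ) : ℂ) + v * Complex.I = v * ((t : ℂ) + (1 : ℝ) * Complex.I) := by
    push_cast; ring
  have h2 : v / ((v * t) ^ 2 + v ^ 2) = v⁻¹ * (1 / (t ^ 2 + 1 ^ 2)) := by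
    have : t ^ 2 + 1 ≠ 0 := by positivity
    field_simp
  rw [archKernel, archKernel, h1, h2, ofReal_mul_cpow hv
    (Complex.slitPlane_ne_zero (add_mul_I_mem_slitPlane one_pos)), Complex.ofReal_mul,
    Complex.mul_cpow_ofReal_nonneg (by positivity) (by positivity), sub_eq_add_neg,
    Complex.cpow_add _ _ hv0, Complex.ofReal_inv, Complex.inv_cpow, Complex.cpow_neg _ s]
  · ring
  · rw [Complex.arg_ofReal_of_nonneg hv.le]
    exact Real.pi_pos.ne

/-- Substitute `t ↦ v t`. At the height `v = 1/(4πm)` the remaining integral is independent of `m`,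
and `m` survives only in the power of `v`. -/
lemma archIntegral_scale (k : ℝ) (s : ℂ) {v : ℝ} (hv : 0 < v) (m : ℝ) :
    archIntegral k s v m = (v : ℂ) ^ (1 - (k : ℂ) - s) * archIntegral k s 1 (m * v) := by
  have hv0 : (v : ℂ) ≠ 0 := Complex.ofReal_ne_zero.2 hv.ne'
  have h1 := Measure.integral_comp_mul_left (fun t : ℝ => archKernel k s v t *
    Complex.exp (-(2 * Real.pi * Complex.I * m * t))) v
  rw [abs_of_pos (inv_pos.2 hv)] at h1
  have h2 : archIntegral k s v m = (v : ℂ) * ∫ t : ℝ, archKernel k s v (v * t) *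
      Complex.exp (-(2 * Real.pi * Complex.I * m * (v * t : ℝ))) := by
    rw [h1, archIntegral, Complex.real_smul, Complex.ofReal_inv, mul_inv_cancel_left₀ hv0]
  rw [h2, archIntegral, ← integral_const_mul, ← integral_const_mul]
  congr 1
  funext t
  have h3 : (v : ℂ) ^ (1 - (k : ℂ) - s) = v * (v : ℂ) ^ (-(k : ℂ) - s) := by
    rw [show (1 - (k : ℂ) - s) = 1 + (-(k : ℂ) - s) by ring, Complex.cpow_add _ _ hv0, Complex.cpow_one]
  rw [archKernel_mul k s hv, h3]
  push_cast
  ring_nf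

end Archimedean

/-! ### The archimedean integral near `s = 0` -/

section Whittaker

open MeasureTheory Filter Topology

lemma I_mul_cpow_neg {w : ℂ} (hw : 0 < w.re) (a : ℂ) :
    (Complex.I * w) ^ (-a) = Complex.exp (-(Real.pi * Complex.I * a / 2)) * w ^ (-a) := by
  have hw0 : w ≠ 0 := fun h => by simp [h] at hw
  have harg := abs_lt.1 (Complex.abs_arg_lt_pi_div_two_iff.2 (Or.inl hw))
  have hlog : Complex.log (Complex.I * w) = Complex.log Complex.I + Complex.log w := by
    rw [Complex.log_mul_eq_add_log_iff Complex.I_ne_zero hw0, Complex.arg_I]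
    constructor <;> linarith [Real.pi_pos]
  rw [Complex.cpow_def_of_ne_zero (mul_ne_zero Complex.I_ne_zero hw0),
    Complex.cpow_def_of_ne_zero hw0, hlog, Complex.log_I, add_mul, Complex.exp_add]
  congr 2
  ring

/-- The value of `archIntegral` at `s = 0`, by Fourier inversion of the Gamma density. -/
lemma archIntegral_zero {k v m : ℝ} (hk : 1 < k) (hv : 0 < v) (hm : 0 < m) :
    archIntegral k 0 v m = Complex.exp (-(Real.pi * Complex.I * k / 2)) *
      ((2 * Real.pi) ^ k * m ^ (k - 1) * Real.exp (-(2 * Real.pi * v * m)) / Real.Gamma k : ℝ) := by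
  have hG : 0 < Real.Gamma k := Real.Gamma_pos_of_pos (by linarith)
  have h2pi : 0 < 2 * Real.pi := by positivity
  -- The Gamma density on `x > 0`. Thanks to `k > 1`, its extension through `max x 0` is continuous
  -- on the line, as Fourier inversion requires.
  let f : ℝ → ℂ := fun x => (((max x 0) ^ (k - 1) * Real.exp (-(2 * Real.pi * v) * x) : ℝ) : ℂ)
  have hfc : Continuous f := by
    refine Complex.continuous_ofReal.comp (Continuous.mul ?_ (by fun_prop))
    exact Continuous.rpow_const (by fun_prop) fun x => Or.inr (by linarith)
  have hsupp : ∀ x, x ∉ Set.Ioi (0 : ℝ) → f x = 0 := by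
    intro x hx
    have : max x 0 = 0 := max_eq_right (not_lt.1 hx)
    simp only [f]
    rw [this, Real.zero_rpow (by linarith)]
    simp
  have hfi : Integrable f := by
    rw [← integrableOn_iff_integrable_of_support_subset (s := Set.Ioi 0)
      (fun x hx => by_contra fun h => hx (hsupp x h))]
    refine (IntegrableOn.congr_fun ((integrableOn_rpow_mul_exp_neg_mul (a := k - 1)
      (b := 2 * Real.pi * v) (by linarith) (by positivity)).ofReal (𝕜 := ℂ)) (fun x hx => ?_)
      measurableSet_Ioi)
    simp only [f, max_eq_left (le_of_lt (Set.mem_Ioi.1 hx))]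
    rfl
  have hF : ∀ ξ : ℝ, FourierTransform.fourier f ξ = ((2 * Real.pi : ℝ) : ℂ) ^ (-(k : ℂ)) *
      ((v : ℂ) + ξ * Complex.I) ^ (-(k : ℂ)) * Complex.Gamma k := by
    intro ξ
    have hre : 0 < (((2 * Real.pi : ℝ) : ℂ) * ((v : ℂ) + ξ * Complex.I)).re := by
      rw [Complex.re_ofReal_mul]
      simp only [Complex.add_re, Complex.ofReal_re, Complex.mul_re, Complex.I_re, mul_zero,
        Complex.ofReal_im, Complex.I_im, mul_one, sub_self, add_zero]
      positivity
    have hne : (v : ℂ) + ξ * Complex.I ≠ 0 := fun h => by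
      have := congrArg Complex.re h
      simp at this
      exact hv.ne' this
    rw [← ofReal_mul_cpow h2pi hne, ← integral_cpow_mul_exp_neg_mul (by linarith) hre,
      Real.fourier_real_eq_integral_exp_smul,
      ← setIntegral_eq_integral_of_forall_compl_eq_zero (s := Set.Ioi 0)]
    · refine setIntegral_congr_fun measurableSet_Ioi fun x hx => ?_
      have hx' : 0 < x := hx
      simp only [f, max_eq_left hx'.le, smul_eq_mul]
      have h0 : ((x ^ (k - 1) * Real.exp (-(2 * Real.pi * v) * x) : ℝ) : ℂ) =
          (x : ℂ) ^ ((k : ℂ) - 1) * Complex.exp (-(2 * Real.pi * v) * x) := by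
        rw [Complex.ofReal_mul, Complex.ofReal_cpow hx'.le]
        push_cast
        rfl
      rw [h0, mul_left_comm, ← Complex.exp_add]
      congr 2
      push_cast
      ring
    · intro x hx
      rw [hsupp x hx, smul_zero]
  have hFi : Integrable (FourierTransform.fourier f) := by
    have h1 : Integrable (fun ξ : ℝ => (ξ ^ 2 + v ^ 2) ^ (-(k / 2))) := integrable_rpow_sq_add_sq hk hv
    refine (h1.const_mul (‖((2 * Real.pi : ℝ) : ℂ) ^ (-(k : ℂ))‖ * ‖Complex.Gamma k‖)).mono'
      ((VectorFourier.fourierIntegral_continuous Real.continuous_fourierChar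
        (by exact continuous_inner) hfi).aestronglyMeasurable) (Eventually.of_forall fun ξ => ?_)
    have h2 : (-(k : ℂ)) = ((-k : ℝ) : ℂ) := by push_cast; ring
    have h3 : ‖((v : ℂ) + ξ * Complex.I) ^ (-(k : ℂ))‖ = (ξ ^ 2 + v ^ 2) ^ (-(k / 2)) := by
      rw [h2, Complex.norm_cpow_real, Complex.norm_add_mul_I, Real.sqrt_eq_rpow,
        ← Real.rpow_mul (by positivity), add_comm (v ^ 2)]
      congr 1
      ring
    rw [hF, norm_mul, norm_mul, h3]
    exact le_of_eq (by ring)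
  have hinv := congrFun (hfc.fourierInv_fourier_eq hfi hFi) m
  rw [Real.fourierInv_eq'] at hinv
  have h4 : ∀ ξ : ℝ, archKernel k 0 v (-ξ) * Complex.exp (-(2 * Real.pi * Complex.I * m * ((-ξ : ℝ) : ℂ))) =
      (Complex.exp (-(Real.pi * Complex.I * k / 2)) * ((2 * Real.pi : ℝ) : ℂ) ^ (k : ℂ) *
        (Complex.Gamma k)⁻¹) *
      (Complex.exp ((2 * Real.pi * inner ℝ ξ m : ℝ) * Complex.I) • FourierTransform.fourier f ξ) := by
    intro ξ
    -- Rotating by `i` at `t = -ξ` matches the kernel with the Fourier transform of `f` and produces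
    -- the phase `exp(-πik/2)`.
    have h5 : ((-ξ : ℝ) : ℂ) + v * Complex.I = Complex.I * ((v : ℂ) + ξ * Complex.I) := by
      push_cast
      linear_combination (-(ξ : ℂ)) * Complex.I_mul_I
    have hre : 0 < ((v : ℂ) + ξ * Complex.I).re := by simpa using hv
    have h6 : ((2 * Real.pi : ℝ) : ℂ) ^ (k : ℂ) * ((2 * Real.pi : ℝ) : ℂ) ^ (-(k : ℂ)) = 1 := by
      rw [← Complex.cpow_add _ _ (Complex.ofReal_ne_zero.2 h2pi.ne'), add_neg_cancel, Complex.cpow_zero]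
    have h7 : Complex.Gamma k ≠ 0 := by
      rw [Complex.Gamma_ofReal]
      exact Complex.ofReal_ne_zero.2 hG.ne'
    have h8 : (-(2 * Real.pi * Complex.I * m * ((-ξ : ℝ) : ℂ)) : ℂ) =
        (2 * Real.pi * inner ℝ ξ m : ℝ) * Complex.I := by
      simp only [RCLike.inner_apply, conj_trivial]
      push_cast
      ring
    rw [archKernel, Complex.cpow_zero, mul_one, h5, I_mul_cpow_neg hre, hF, h8, smul_eq_mul]
    generalize ((v : ℂ) + ξ * Complex.I) ^ (-(k : ℂ)) = W
    generalize Complex.exp (-(Real.pi * Complex.I * k / 2)) = X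
    generalize Complex.exp ((2 * Real.pi * inner ℝ ξ m : ℝ) * Complex.I) = Y
    linear_combination (-(X * W * Y)) * h6 - X * W * Y * ((2 * Real.pi : ℝ) : ℂ) ^ (k : ℂ) *
      ((2 * Real.pi : ℝ) : ℂ) ^ (-(k : ℂ)) * (mul_inv_cancel₀ h7)
  have h9 : archIntegral k 0 v m = ∫ ξ : ℝ, archKernel k 0 v (-ξ) *
      Complex.exp (-(2 * Real.pi * Complex.I * m * ((-ξ : ℝ) : ℂ))) :=
    (integral_neg_eq_self (fun t : ℝ => archKernel k 0 v t *
      Complex.exp (-(2 * Real.pi * Complex.I * m * t))) volume).symm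
  rw [h9]
  simp only [h4]
  rw [integral_const_mul, hinv]
  simp only [f, max_eq_left hm.le]
  rw [Complex.Gamma_ofReal, ← Complex.ofReal_cpow h2pi.le]
  push_cast
  have h10 : (-(2 * Real.pi * v) * m : ℂ) = -(2 * Real.pi * v * m) := by ring
  rw [h10]
  ring

/-- For `|s| < (k-1)/4` the integrand is dominated by `(t² + 1)^(-(k+1)/4)`, which is integrable
because `k > 1`. -/
lemma differentiableAt_archIntegral {k : ℝ} (hk : 1 < k) (m : ℝ) :
    DifferentiableAt ℂ (fun s => archIntegral k s 1 m) 0 := by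
  have hR : 0 < (k - 1) / 4 := by linarith
  refine differentiableAt_integral_of_dominated (R := (k - 1) / 4)
    (bound := fun t : ℝ => (t ^ 2 + 1 ^ 2) ^ (-((k + 1) / 2 / 2))) hR ?_ ?_ ?_
    (integrable_rpow_sq_add_sq (by linarith) one_pos)
  · intro s hs
    exact ((continuous_archKernel k s one_pos).mul (by fun_prop)).aestronglyMeasurable
  · refine Eventually.of_forall fun t => ?_
    have h0 : ((1 / (t ^ 2 + 1 ^ 2) : ℝ) : ℂ) ≠ 0 := Complex.ofReal_ne_zero.2 (by positivity)
    unfold archKernel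
    intro s _
    refine DifferentiableAt.differentiableWithinAt ?_
    exact ((differentiableAt_id.const_cpow (Or.inl h0)).const_mul _).mul_const _
  · refine Eventually.of_forall fun t s hs => ?_
    have h1 : -((k - 1) / 4) ≤ s.re := by
      have := (Complex.abs_re_le_norm s).trans (mem_ball_zero_iff.1 hs).le
      exact (abs_le.1 this).1
    rw [norm_mul, norm_exp_two_pi_I_mul, mul_one, norm_archKernel k s one_pos, Real.one_rpow, one_mul]
    refine Real.rpow_le_rpow_of_exponent_le ?_ (by linarith)
    nlinarith [sq_nonneg t]

/-! ### The Whittaker function -/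

/-- The integrand in the definition of `tricomiU s (k + 2 s) 1`. -/
def tricomiIntegrand (k : ℝ) (s : ℂ) (t : ℝ) : ℂ :=
  (t : ℂ) ^ s * Complex.exp (-t) * ((1 + t : ℝ) : ℂ) ^ ((k : ℂ) + s - 2) *
    ((1 + t : ℝ) - ((k : ℂ) + s - 1))

lemma aestronglyMeasurable_tricomiIntegrand (k : ℝ) (s : ℂ) :
    AEStronglyMeasurable (tricomiIntegrand k s) (volume.restrict (Set.Ioi 0)) := by
  refine ContinuousOn.aestronglyMeasurable (fun t ht => ?_) measurableSet_Ioi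
  have ht' : 0 < t := ht
  refine ContinuousAt.continuousWithinAt ?_
  unfold tricomiIntegrand
  refine ((ContinuousAt.mul ?_ (by fun_prop)).mul ?_).mul (by fun_prop)
  · exact Complex.continuousAt_ofReal_cpow_const _ _ (Or.inr ht'.ne')
  · refine ContinuousAt.cpow (by fun_prop) continuousAt_const (Complex.ofReal_mem_slitPlane.2 ?_)
    linarith

/-- For `|s| < 1/2` the factor `t^s` is bounded by `t^(-1/2) + t^(1/2)`, for small and large `t`
alike, and half of the exponential decay absorbs the polynomial growth of the other factors. -/
lemma exists_norm_tricomiIntegrand_le {k : ℝ} (hk : 0 ≤ k) :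
    ∃ bound : ℝ → ℝ, IntegrableOn bound (Set.Ioi 0) ∧
      ∀ t ∈ Set.Ioi (0 : ℝ), ∀ s ∈ Metric.ball (0 : ℂ) (1 / 2), ‖tricomiIntegrand k s t‖ ≤ bound t := by
  obtain ⟨K, hK⟩ := exists_nat_ge k
  let c : ℝ := (k + 3) * (2 ^ K * K.factorial * Real.exp (1 / 2))
  refine ⟨fun t => c * (t ^ (-(1 / 2) : ℝ) * Real.exp (-(1 / 2) * t) +
    t ^ (1 / 2 : ℝ) * Real.exp (-(1 / 2) * t)), ?_, ?_⟩
  · exact ((integrableOn_rpow_mul_exp_neg_mul (by norm_num) (by norm_num)).add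
      (integrableOn_rpow_mul_exp_neg_mul (by norm_num) (by norm_num))).const_mul c
  · intro t ht s hs
    have ht' : 0 < t := ht
    have h1t : (1 : ℝ) ≤ 1 + t := by linarith
    have hs1 : ‖s‖ < 1 / 2 := mem_ball_zero_iff.1 hs
    have hs2 := abs_le.1 ((Complex.abs_re_le_norm s).trans hs1.le)
    have e1 : ‖(t : ℂ) ^ s‖ ≤ t ^ (-(1 / 2) : ℝ) + t ^ (1 / 2 : ℝ) := by
      rw [Complex.norm_cpow_eq_rpow_re_of_pos ht']
      have p1 : 0 ≤ t ^ (-(1 / 2) : ℝ) := by positivity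
      have p2 : 0 ≤ t ^ (1 / 2 : ℝ) := by positivity
      rcases le_total t 1 with h | h
      · have := Real.rpow_le_rpow_of_exponent_ge ht' h hs2.1
        linarith
      · have := Real.rpow_le_rpow_of_exponent_le h hs2.2
        linarith
    have e2 : ‖Complex.exp (-(t : ℂ))‖ = Real.exp (-t) := by
      rw [Complex.norm_exp]; simp
    have e3 : ‖((1 + t : ℝ) : ℂ) ^ ((k : ℂ) + s - 2)‖ ≤ (1 + t) ^ (k - 1) := by
      rw [Complex.norm_cpow_eq_rpow_re_of_pos (by linarith)]
      refine Real.rpow_le_rpow_of_exponent_le h1t ?_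
      simp only [Complex.sub_re, Complex.add_re, Complex.ofReal_re, Complex.re_ofNat]
      linarith
    have e4 : ‖(((1 + t : ℝ) : ℂ) - ((k : ℂ) + s - 1))‖ ≤ (k + 3) * (1 + t) := by
      have a1 := norm_sub_le (((1 + t : ℝ) : ℂ)) ((k : ℂ) + s - 1)
      have a2 := norm_sub_le ((k : ℂ) + s) 1
      have a3 := norm_add_le (k : ℂ) s
      rw [Complex.norm_real, Real.norm_of_nonneg (by linarith)] at a1
      rw [Complex.norm_real, Real.norm_of_nonneg hk] at a3
      rw [norm_one] at a2
      nlinarith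
    have e5 : (1 + t) ^ (k - 1) * (1 + t) ≤ 2 ^ K * K.factorial * Real.exp (1 / 2) *
        Real.exp (1 / 2 * t) := by
      have a1 : (1 + t) ^ (k - 1) * (1 + t) = (1 + t) ^ k := by
        rw [← Real.rpow_add_one (by linarith)]
        congr 1
        ring
      have a2 : (1 + t) ^ k ≤ (1 + t) ^ (K : ℝ) := Real.rpow_le_rpow_of_exponent_le h1t hK
      rw [Real.rpow_natCast] at a2
      have a3 := Real.pow_div_factorial_le_exp ((1 + t) / 2) (by positivity) K
      rw [div_le_iff₀ (by positivity), div_pow, div_le_iff₀ (by positivity)] at a3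
      have a4 : Real.exp ((1 + t) / 2) = Real.exp (1 / 2) * Real.exp (1 / 2 * t) := by
        rw [← Real.exp_add]
        congr 1
        ring
      rw [a4] at a3
      rw [a1]
      linarith
    have e6 : Real.exp (-t) * Real.exp (1 / 2 * t) = Real.exp (-(1 / 2) * t) := by
      rw [← Real.exp_add]
      congr 1
      ring
    rw [tricomiIntegrand, norm_mul, norm_mul, norm_mul, e2]
    calc _ ≤ (t ^ (-(1 / 2) : ℝ) + t ^ (1 / 2 : ℝ)) * Real.exp (-t) * (1 + t) ^ (k - 1) *
          ((k + 3) * (1 + t)) := by gcongr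
      _ = (t ^ (-(1 / 2) : ℝ) + t ^ (1 / 2 : ℝ)) * Real.exp (-t) * (k + 3) *
          ((1 + t) ^ (k - 1) * (1 + t)) := by ring
      _ ≤ (t ^ (-(1 / 2) : ℝ) + t ^ (1 / 2 : ℝ)) * Real.exp (-t) * (k + 3) *
          (2 ^ K * K.factorial * Real.exp (1 / 2) * Real.exp (1 / 2 * t)) := by gcongr
      _ = c * (t ^ (-(1 / 2) : ℝ) * Real.exp (-(1 / 2) * t) +
          t ^ (1 / 2 : ℝ) * Real.exp (-(1 / 2) * t)) := by
        rw [← e6]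
        simp only [c]
        ring

lemma differentiableAt_integral_tricomiIntegrand {k : ℝ} (hk : 0 ≤ k) :
    DifferentiableAt ℂ (fun s => ∫ t in Set.Ioi (0 : ℝ), tricomiIntegrand k s t) 0 := by
  obtain ⟨bound, hint, hbound⟩ := exists_norm_tricomiIntegrand_le hk
  refine differentiableAt_integral_of_dominated (R := 1 / 2) (bound := bound) (by norm_num)
    (fun s _ => aestronglyMeasurable_tricomiIntegrand k s) ?_ ?_ hint
  · filter_upwards [ae_restrict_mem measurableSet_Ioi] with t ht s _
    have ht' : (t : ℂ) ≠ 0 := Complex.ofReal_ne_zero.2 (ne_of_gt ht)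
    have h1t : ((1 + t : ℝ) : ℂ) ≠ 0 :=
      Complex.ofReal_ne_zero.2 (by linarith [Set.mem_Ioi.1 ht])
    refine DifferentiableAt.differentiableWithinAt ?_
    unfold tricomiIntegrand
    refine DifferentiableAt.mul (DifferentiableAt.mul (DifferentiableAt.mul_const ?_ _) ?_)
      (by fun_prop)
    · exact differentiableAt_id.const_cpow (Or.inl ht')
    · exact DifferentiableAt.const_cpow (by fun_prop) (Or.inl h1t)
  · filter_upwards [ae_restrict_mem measurableSet_Ioi] with t ht using hbound t ht

/-- At `s = 0` the integrand is the derivative of `-exp(-t) (1+t)^(k-1)`, which rises from `-1` at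
`0` to the limit `0`. -/
lemma integral_tricomiIntegrand_zero {k : ℝ} (hk : 0 ≤ k) :
    ∫ t in Set.Ioi (0 : ℝ), tricomiIntegrand k 0 t = 1 := by
  obtain ⟨bound, hint, hbound⟩ := exists_norm_tricomiIntegrand_le hk
  have hi : IntegrableOn (tricomiIntegrand k 0) (Set.Ioi 0) := by
    refine hint.mono' (aestronglyMeasurable_tricomiIntegrand k 0) ?_
    filter_upwards [ae_restrict_mem measurableSet_Ioi] with t ht
    exact hbound t ht 0 (Metric.mem_ball_self (by norm_num))
  let f : ℝ → ℝ := fun t => -(Real.exp (-t) * (1 + t) ^ (k - 1))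
  have hderiv : ∀ t ∈ Set.Ici (0 : ℝ), HasDerivAt (fun t : ℝ => (f t : ℂ)) (tricomiIntegrand k 0 t) t := by
    intro t ht
    have h1t : 0 < 1 + t := by linarith [Set.mem_Ici.1 ht]
    have h1 : HasDerivAt f (-(-Real.exp (-t) * (1 + t) ^ (k - 1) +
        Real.exp (-t) * (1 * (k - 1) * (1 + t) ^ (k - 1 - 1)))) t := by
      have h2 : HasDerivAt (fun t : ℝ => Real.exp (-t)) (-Real.exp (-t)) t := by
        simpa using (hasDerivAt_neg t).exp
      have h3 : HasDerivAt (fun t : ℝ => (1 + t) ^ (k - 1)) (1 * (k - 1) * (1 + t) ^ (k - 1 - 1)) t :=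
        ((hasDerivAt_id t).const_add 1).rpow_const (Or.inl h1t.ne')
      exact (h2.mul h3).neg
    convert h1.ofReal_comp using 1
    have h4 : (1 + t) ^ (k - 1) = (1 + t) ^ (k - 1 - 1) * (1 + t) := by
      rw [← Real.rpow_add_one h1t.ne']
      congr 1
      ring
    have h5 : ((1 + t : ℝ) : ℂ) ^ ((k : ℂ) - 2) = (((1 + t) ^ (k - 1 - 1) : ℝ) : ℂ) := by
      rw [Complex.ofReal_cpow h1t.le]
      congr 1
      push_cast
      ring
    rw [tricomiIntegrand, Complex.cpow_zero, add_zero, h4, h5]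
    push_cast
    ring
  have hlim : Tendsto (fun t : ℝ => (f t : ℂ)) atTop (𝓝 0) := by
    rw [← Complex.ofReal_zero]
    refine (Complex.continuous_ofReal.tendsto 0).comp ?_
    have h1 := (tendsto_rpow_mul_exp_neg_mul_atTop_nhds_zero (k - 1) 1 one_pos).comp
      (tendsto_atTop_add_const_left atTop (1 : ℝ) tendsto_id)
    have h2 := h1.const_mul (-Real.exp 1)
    rw [mul_zero] at h2
    refine h2.congr fun t => ?_
    simp only [Function.comp_apply, id_eq, f]
    have : Real.exp (-t) = Real.exp 1 * Real.exp (-1 * (1 + t)) := by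
      rw [← Real.exp_add]
      congr 1
      ring
    rw [this]
    ring
  have h := integral_Ioi_of_hasDerivAt_of_tendsto' hderiv hi hlim
  rw [h]
  simp [f]

lemma curlyW_one (n : ℕ) (s : ℂ) : curlyW n s 1 = Complex.exp (-(1 / 2)) *
    ((Complex.Gamma (s + 1))⁻¹ * ∫ t in Set.Ioi (0 : ℝ), tricomiIntegrand (weight n) s t) := by
  have h1 : ((weight n : ℂ) - 1) / 2 + s - (weight n : ℂ) / 2 + 1 / 2 = s := by ring
  rw [curlyW, whittakerW, tricomiU, h1]
  simp only [Complex.ofReal_one, Complex.one_cpow, one_mul, mul_one]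
  congr 2
  refine integral_congr_ae (Eventually.of_forall fun t => ?_)
  simp only [tricomiIntegrand]
  have h2 : 1 + 2 * (((weight n : ℂ) - 1) / 2 + s) - s - 2 = weight n + s - 2 := by ring
  have h3 : 1 + 2 * (((weight n : ℂ) - 1) / 2 + s) - s - 1 = weight n + s - 1 := by ring
  rw [h2, h3]
  push_cast
  rfl

lemma weight_nonneg (n : ℕ) : 0 ≤ weight n := by
  unfold weight
  positivity

lemma differentiableAt_curlyW_one (n : ℕ) : DifferentiableAt ℂ (fun s => curlyW n s 1) 0 := by
  simp only [curlyW_one]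
  refine (DifferentiableAt.mul ?_ (differentiableAt_integral_tricomiIntegrand (weight_nonneg n))).const_mul _
  refine DifferentiableAt.inv ?_ (by simp)
  refine DifferentiableAt.comp (f := fun s : ℂ => s + 1) (g := Complex.Gamma) 0
    (Complex.differentiableAt_Gamma _ fun m => ?_) (by fun_prop)
  rw [zero_add]
  intro h
  have := congrArg Complex.re h
  simp at this
  linarith [(Nat.cast_nonneg m : (0 : ℝ) ≤ m)]

lemma curlyW_zero_one (n : ℕ) : curlyW n 0 1 = Complex.exp (-(1 / 2)) := by
  rw [curlyW_one, integral_tricomiIntegrand_zero (weight_nonneg n)]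
  simp

end Whittaker

/-! ### Unfolding the Eisenstein series -/

section Unfolding

open Module QuadraticMap MeasureTheory Filter Topology

variable {V : Type*} [AddCommGroup V] [Module ℚ V] {N : ℕ} {Q : QuadraticForm ℚ V}
  {Λ : Submodule ℤ V} {β : V}

/-- The function `(cτ + d)^(-k) (v / |cτ + d|²)^s`, `τ = u + iv`. -/
def rowKernel (k : ℝ) (s : ℂ) (v : ℝ) (x : ℤ × ℤ) (u : ℝ) : ℂ :=
  ((x.1 : ℂ) * ((u : ℂ) + v * Complex.I) + x.2) ^ (-(k : ℂ)) *
    ((v / Complex.normSq ((x.1 : ℂ) * ((u : ℂ) + v * Complex.I) + x.2) : ℝ) : ℂ) ^ s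

/-- The injection of `⟨T⟩ \ SL₂(ℤ)` into `ℤ²` by the bottom row. -/
def bottomRow (x : Quotient (QuotientGroup.rightRel (Subgroup.zpowers ModularGroup.T))) : ℤ × ℤ :=
  ((Quotient.out x) 1 0, (Quotient.out x) 1 1)

lemma exists_zpow_T_eq {g : SL(2, ℤ)} (h0 : g 1 0 = 0) (h1 : g 1 1 = 1) :
    ModularGroup.T ^ (g 0 1) = g := by
  have hdet := g.det_coe
  rw [Matrix.det_fin_two, h0, h1] at hdet
  have ha : g 0 0 = 1 := by simpa using hdet
  ext i j
  fin_cases i <;> fin_cases j <;> simp [ModularGroup.coe_T_zpow, h0, h1, ha]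

lemma rightRel_zpowers_T_iff (g g' : SL(2, ℤ)) :
    QuotientGroup.rightRel (Subgroup.zpowers ModularGroup.T) g g' ↔
      g 1 0 = g' 1 0 ∧ g 1 1 = g' 1 1 := by
  rw [QuotientGroup.rightRel_apply]
  constructor
  · rintro ⟨l, hl⟩
    have h : g' = ModularGroup.T ^ l * g := by rw [← mul_inv_eq_iff_eq_mul]; exact hl.symm
    rw [h]
    simp
  · rintro ⟨h0, h1⟩
    have hdet := g.det_coe
    rw [Matrix.det_fin_two] at hdet
    refine ⟨(g' * g⁻¹) 0 1, exists_zpow_T_eq ?_ ?_⟩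
    · simp [Matrix.SpecialLinearGroup.coe_inv, Matrix.adjugate_fin_two, Matrix.mul_apply,
        Fin.sum_univ_two, ← h0, ← h1]
      ring
    · simp [Matrix.SpecialLinearGroup.coe_inv, Matrix.adjugate_fin_two, Matrix.mul_apply,
        Fin.sum_univ_two, ← h0, ← h1]
      linarith

lemma injective_bottomRow : Function.Injective bottomRow := by
  intro x y h
  have h1 := (rightRel_zpowers_T_iff (Quotient.out x) (Quotient.out y)).2
    ⟨congrArg Prod.fst h, congrArg Prod.snd h⟩
  rw [← Quotient.out_eq x, ← Quotient.out_eq y]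
  exact Quotient.sound h1

lemma mem_range_bottomRow {x : ℤ × ℤ} (hx : IsCoprime x.1 x.2) : x ∈ Set.range bottomRow := by
  obtain ⟨g, -, hg⟩ := ModularGroup.bottom_row_surj (R := ℤ) (show ![x.1, x.2] ∈ _ from hx)
  refine ⟨Quotient.mk _ g, ?_⟩
  have h1 : QuotientGroup.rightRel (Subgroup.zpowers ModularGroup.T)
      (Quotient.out (Quotient.mk (QuotientGroup.rightRel (Subgroup.zpowers ModularGroup.T)) g)) g :=
    Quotient.exact (Quotient.out_eq _)
  rw [rightRel_zpowers_T_iff] at h1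
  have h2 := congrFun hg 0
  have h3 := congrFun hg 1
  simp only [Matrix.cons_val_zero, Matrix.cons_val_one] at h2 h3
  exact Prod.ext (h1.1.trans h2) (h1.2.trans h3)

variable (C : CosetCoordinates Q Λ β N)

lemma rowCoeff_eq_zero {c d : ℤ} (h : ¬ IsCoprime c d) : rowCoeff C c d = 0 := by
  rw [rowCoeff, if_neg h]

lemma eisenstein_eq_tsum (n : ℕ) (s : ℂ) {v : ℝ} (u : ℝ)
    (h : 0 < ((u : ℂ) + v * Complex.I).im) :
    eisenstein Q Λ n β ⟨(u : ℂ) + v * Complex.I, h⟩ s =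
      ∑' x : ℤ × ℤ, rowKernel (weight n) s v x u * star (rowCoeff C x.1 x.2) := by
  rw [← injective_bottomRow.tsum_eq, eisenstein]
  · refine tsum_congr fun x => ?_
    simp only [weilCoeff_eq_rowCoeff C, bottomRow, rowKernel]
    congr 3
    rw [ModularGroup.im_smul_eq_div_normSq, ModularGroup.denom_apply]
    simp [UpperHalfPlane.im]
  -- Pairs that are not coprime carry the coefficient `0`, so the sum over cosets extends to all of
  -- `ℤ²`.
  · intro x hx
    refine mem_range_bottomRow (by_contra fun h => hx ?_)
    simp only
    rw [rowCoeff_eq_zero C h, star_zero, mul_zero]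

lemma row_mem_slitPlane {v : ℝ} (hv : 0 < v) {c : ℤ} (hc : c ≠ 0) (d : ℤ) (u : ℝ) :
    (c : ℂ) * ((u : ℂ) + v * Complex.I) + d ∈ Complex.slitPlane := by
  refine Or.inr ?_
  simp [hc, hv.ne']

lemma continuous_rowKernel (k : ℝ) (s : ℂ) {v : ℝ} (hv : 0 < v) (x : ℤ × ℤ) :
    Continuous (rowKernel k s v x) := by
  unfold rowKernel
  by_cases hc : x.1 = 0
  · simp only [hc, Int.cast_zero, zero_mul, zero_add]
    exact continuous_const
  · refine Continuous.mul ?_ ?_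
    · exact Continuous.cpow (by fun_prop) continuous_const fun u => row_mem_slitPlane hv hc _ u
    · have h0 : ∀ u : ℝ, 0 < Complex.normSq ((x.1 : ℂ) * ((u : ℂ) + v * Complex.I) + x.2) :=
        fun u => Complex.normSq_pos.2 (Complex.slitPlane_ne_zero (row_mem_slitPlane hv hc _ u))
      refine Continuous.cpow ?_ continuous_const fun u =>
        Complex.ofReal_mem_slitPlane.2 (div_pos hv (h0 u))
      exact Complex.continuous_ofReal.comp (Continuous.div₀ continuous_const
        (Complex.continuous_normSq.comp (by fun_prop)) fun u => (h0 u).ne')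

lemma norm_rowKernel (k : ℝ) (s : ℂ) {v : ℝ} (hv : 0 < v) (x : ℤ × ℤ) (u : ℝ)
    (h : (x.1 : ℂ) * ((u : ℂ) + v * Complex.I) + x.2 ≠ 0) :
    ‖rowKernel k s v x u‖ = v ^ s.re *
      ‖(x.1 : ℂ) * ((u : ℂ) + v * Complex.I) + x.2‖ ^ (-(k + 2 * s.re)) := by
  rw [rowKernel]
  generalize (x.1 : ℂ) * ((u : ℂ) + v * Complex.I) + x.2 = w at *
  have h0 : 0 < ‖w‖ := norm_pos_iff.2 h
  have h2 : (-(k : ℂ)) = ((-k : ℝ) : ℂ) := by push_cast; ring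
  rw [norm_mul, h2, Complex.norm_cpow_real, Complex.normSq_eq_norm_sq,
    Complex.norm_cpow_eq_rpow_re_of_pos (by positivity), Real.div_rpow hv.le (by positivity),
    neg_add, Real.rpow_add h0, Real.rpow_neg h0.le (2 * s.re), Real.rpow_mul h0.le, Real.rpow_two]
  ring

lemma row_ne_zero {v : ℝ} (hv : 0 < v) {c d : ℤ} (h : IsCoprime c d) (u : ℝ) :
    (c : ℂ) * ((u : ℂ) + v * Complex.I) + d ≠ 0 := by
  by_cases hc : c = 0
  · subst hc
    have hd : d ≠ 0 := by
      rintro rfl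
      exact not_isCoprime_zero_zero h
    simpa using hd
  · exact Complex.slitPlane_ne_zero (row_mem_slitPlane hv hc d u)

lemma exists_norm_rowKernel_mul_le (hN : finrank ℚ V = N) {k : ℝ} {s : ℂ} (hks : 2 < k + 2 * s.re)
    {v : ℝ} (hv : 0 < v) : ∃ bound : ℤ × ℤ → ℝ, Summable bound ∧ (∀ x, 0 ≤ bound x) ∧
      ∀ x, ∀ u ∈ Set.Icc (0 : ℝ) 1, ‖rowKernel k s v x u * star (rowCoeff C x.1 x.2)‖ ≤ bound x := by
  let B : ℝ := 1 + gaussBound C.A * (Real.sqrt (disc Q Λ))⁻¹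
  have hB : 0 ≤ B := (norm_nonneg _).trans (norm_rowCoeff_le C hN 1 0)
  let r : ℝ := EisensteinSeries.r ⟨⟨1, v⟩, hv⟩
  have hr : 0 < r := EisensteinSeries.r_pos _
  refine ⟨fun x => v ^ s.re * (r ^ (-(k + 2 * s.re)) * ‖![x.1, x.2]‖ ^ (-(k + 2 * s.re))) * B,
    ?_, fun x => by positivity, fun x u hu => ?_⟩
  · have h1 := (finTwoArrowEquiv ℤ).symm.summable_iff.2 (EisensteinSeries.summable_one_div_norm_rpow hks)
    exact ((h1.mul_left _).mul_left _).mul_right _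
  · by_cases h : IsCoprime x.1 x.2
    · rw [norm_mul, norm_star, norm_rowKernel k s hv x u (row_ne_zero hv h u)]
      have h1 := EisensteinSeries.summand_bound_of_mem_verticalStrip
        (z := ⟨(u : ℂ) + v * Complex.I, by simpa using hv⟩) (k := k + 2 * s.re) (by linarith)
        ![x.1, x.2] (A := 1) (B := v) hv (by
          rw [UpperHalfPlane.mem_verticalStrip_iff]
          constructor
          · change |((u : ℂ) + v * Complex.I).re| ≤ 1
            simpa [abs_of_nonneg hu.1] using hu.2
          · change v ≤ ((u : ℂ) + v * Complex.I).im
            simp)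
      have h2 := norm_rowCoeff_le C hN x.1 x.2
      simp only [Matrix.cons_val_zero, Matrix.cons_val_one] at h1
      exact mul_le_mul (mul_le_mul_of_nonneg_left h1 (by positivity)) h2 (norm_nonneg _)
        (by positivity)
    · rw [rowCoeff_eq_zero C h, star_zero, mul_zero, norm_zero]
      positivity

/-- The contribution of the bottom row `x` to the `m`-th Fourier coefficient. -/
def rowIntegral (k : ℝ) (s : ℂ) (v : ℝ) (m : ℕ) (x : ℤ × ℤ) : ℂ :=
  ∫ u in (0 : ℝ)..1, rowKernel k s v x u * star (rowCoeff C x.1 x.2) *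
    Complex.exp (-(2 * Real.pi * Complex.I * m * u))

lemma hasSum_rowIntegral (hN : finrank ℚ V = N) {n : ℕ} {s : ℂ} (hks : 2 < weight n + 2 * s.re)
    {v : ℝ} (hv : 0 < v) (m : ℕ) :
    HasSum (rowIntegral C (weight n) s v m) (eisensteinCoeff Q Λ n β m s v hv) := by
  obtain ⟨bound, hsum, h0, hbound⟩ := exists_norm_rowKernel_mul_le C hN hks hv
  let f : ℤ × ℤ → C(ℝ, ℂ) := fun x => ⟨fun u => rowKernel (weight n) s v x u *
    star (rowCoeff C x.1 x.2) * Complex.exp (-(2 * Real.pi * Complex.I * m * u)),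
    ((continuous_rowKernel _ s hv x).mul continuous_const).mul (by fun_prop)⟩
  have hf := intervalIntegral.hasSum_intervalIntegral_of_summable_norm (f := f) (a := 0) (b := 1)
    (hsum.of_nonneg_of_le (fun x => norm_nonneg _) fun x => by
      rw [ContinuousMap.norm_le _ (h0 x)]
      rintro ⟨u, hu⟩
      have hu' : u ∈ Set.Icc (0 : ℝ) 1 := by
        have := hu
        simpa [Set.uIcc_of_le (zero_le_one' ℝ)] using this
      simp only [ContinuousMap.restrict_apply, f, ContinuousMap.coe_mk]
      rw [norm_mul]
      have := norm_exp_two_pi_I_mul m u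
      push_cast at this
      rw [this, mul_one]
      exact hbound x u hu')
  have h1 : eisensteinCoeff Q Λ n β m s v hv = ∫ u in (0 : ℝ)..1, ∑' x, f x u := by
    refine intervalIntegral.integral_congr fun u _ => ?_
    simp only [f, ContinuousMap.coe_mk]
    rw [eisenstein_eq_tsum C n s u, tsum_mul_right]
  rw [h1]
  exact hf

/-- Rows with `c = 0` give functions constant in `u`, which have no `m`-th Fourier coefficient for
`m ≠ 0`. -/
lemma rowIntegral_zero_left (k : ℝ) (s : ℂ) (v : ℝ) {m : ℕ} (hm : m ≠ 0) (d : ℤ) :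
    rowIntegral C k s v m (0, d) = 0 := by
  have h1 : ∀ u : ℝ, (-(2 * Real.pi * Complex.I * m * u) : ℂ) = (-(2 * Real.pi * Complex.I * m)) * u :=
    fun u => by ring
  have h2 : (-(2 * Real.pi * Complex.I * m) : ℂ) ≠ 0 := by
    simp [Real.pi_ne_zero, Complex.I_ne_zero, hm]
  simp only [rowIntegral, rowKernel, Int.cast_zero, zero_mul, zero_add, h1]
  rw [intervalIntegral.integral_const_mul, integral_exp_mul_complex h2]
  have h3 : Complex.exp (-(2 * Real.pi * Complex.I * m) * (1 : ℝ)) = 1 := by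
    rw [Complex.ofReal_one, mul_one, Complex.exp_neg, inv_eq_one, Complex.exp_eq_one_iff]
    exact ⟨m, by push_cast; ring⟩
  rw [h3]
  simp

lemma neg_cpow_neg {w : ℂ} (hw : 0 < w.im) (a : ℂ) :
    (-w) ^ (-a) = Complex.exp (Real.pi * Complex.I * a) * w ^ (-a) := by
  have hw0 : w ≠ 0 := fun h => by simp [h] at hw
  have hlog : Complex.log (-w) = Complex.log w - Real.pi * Complex.I := by
    rw [Complex.log, Complex.log, norm_neg, Complex.arg_neg_eq_arg_sub_pi_of_im_pos hw]
    push_cast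
    ring
  rw [Complex.cpow_def_of_ne_zero (neg_ne_zero.2 hw0), Complex.cpow_def_of_ne_zero hw0, hlog,
    ← Complex.exp_add]
  congr 1
  ring

lemma star_exp_pi_I_zpow (j : ℤ) : star (Complex.exp (Real.pi * Complex.I / 4) ^ j) =
    Complex.exp (Real.pi * Complex.I / 4) ^ (-j) := by
  rw [zpow_neg, Complex.inv_eq_conj (by rw [norm_zpow, norm_exp_pi_I_div_four, one_zpow])]
  rfl

/-- The kernel acquires the factor `exp(πik)` and the conjugated Weil coefficient the factor
`exp(πi(2-n)/2)`. Since `k = 1 + n/2`, the product is `exp(2πi) = 1`. -/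
lemma rowIntegral_neg {n : ℕ} (hsig : negSig Q = 2 - n) (s : ℂ) {v : ℝ} (hv : 0 < v) (m : ℕ)
    {c : ℤ} (hc : 0 < c) (d : ℤ) :
    rowIntegral C (weight n) s v m (-c, -d) = rowIntegral C (weight n) s v m (c, d) := by
  refine intervalIntegral.integral_congr fun u _ => ?_
  have hw : 0 < ((c : ℂ) * ((u : ℂ) + v * Complex.I) + d).im := by
    have : (0 : ℝ) < c := by exact_mod_cast hc
    simp only [Complex.add_im, Complex.mul_im, Complex.intCast_re, Complex.intCast_im,
      Complex.ofReal_im, Complex.ofReal_re, Complex.I_re, Complex.I_im, Complex.add_re, Complex.mul_re]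
    nlinarith
  have h1 : ((-c : ℤ) : ℂ) * ((u : ℂ) + v * Complex.I) + ((-d : ℤ) : ℂ) =
      -((c : ℂ) * ((u : ℂ) + v * Complex.I) + d) := by push_cast; ring
  have h2 : star (Complex.exp (Real.pi * Complex.I / 4) ^ (-(2 * negSig Q))) *
      Complex.exp (Real.pi * Complex.I * (weight n : ℂ)) = 1 := by
    rw [star_exp_pi_I_zpow, hsig, ← Complex.exp_int_mul, ← Complex.exp_add, weight,
      ← Complex.exp_two_pi_mul_I]
    congr 1
    push_cast
    ring
  simp only [rowKernel, h1, Complex.normSq_neg]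
  rw [neg_cpow_neg hw, rowCoeff_neg C c d hc, star_mul']
  linear_combination (((c : ℂ) * ((u : ℂ) + v * Complex.I) + d) ^ (-(weight n : ℂ)) *
    ((v / Complex.normSq ((c : ℂ) * ((u : ℂ) + v * Complex.I) + d) : ℝ) : ℂ) ^ s *
    star (rowCoeff C c d) * Complex.exp (-(2 * Real.pi * Complex.I * m * u))) * h2

lemma rowKernel_add (k : ℝ) (s : ℂ) {v : ℝ} (hv : 0 < v) {c : ℕ} (hc : 0 < c) (d l : ℤ) (u : ℝ) :
    rowKernel k s v (c, d + c * l) u =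
      (c : ℂ) ^ (-(k : ℂ) - 2 * s) * archKernel k s v (u + l + d / c) := by
  have hc' : (0 : ℝ) < c := by exact_mod_cast hc
  have hc0 : (c : ℂ) ≠ 0 := by exact_mod_cast hc.ne'
  have h1 : (((c : ℕ) : ℤ) : ℂ) * ((u : ℂ) + v * Complex.I) + ((d + c * l : ℤ) : ℂ) =
      ((c : ℝ) : ℂ) * (((u + l + d / c : ℝ) : ℂ) + v * Complex.I) := by
    push_cast
    field_simp
    ring
  have h2 : v / Complex.normSq (((c : ℝ) : ℂ) * (((u + l + d / c : ℝ) : ℂ) + v * Complex.I)) =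
      ((c : ℝ) ^ 2)⁻¹ * (v / ((u + l + d / c) ^ 2 + v ^ 2)) := by
    rw [Complex.normSq_mul, Complex.normSq_ofReal, Complex.normSq_add_mul_I]
    field_simp
  have h3 : ((((c : ℝ) ^ 2)⁻¹ : ℝ) : ℂ) ^ s = (c : ℂ) ^ (-(2 * s)) := by
    have h4 : (0 : ℝ) < ((c : ℝ) ^ 2)⁻¹ := by positivity
    rw [Complex.cpow_def_of_ne_zero (Complex.ofReal_ne_zero.2 h4.ne'), Complex.cpow_def_of_ne_zero hc0,
      ← Complex.ofReal_log h4.le, Real.log_inv, Real.log_pow, ← Complex.natCast_log]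
    congr 1
    push_cast
    ring
  simp only [rowKernel]
  rw [h1, h2, ofReal_mul_cpow hc' (Complex.slitPlane_ne_zero (add_mul_I_mem_slitPlane hv)),
    Complex.ofReal_mul, Complex.mul_cpow_ofReal_nonneg (by positivity) (by positivity), h3,
    sub_eq_add_neg, Complex.cpow_add _ _ hc0, archKernel]
  push_cast
  ring

/-- Summing over a residue class of `d` modulo `c` unfolds the Fourier integral. -/
lemma hasSum_rowIntegral_add {k : ℝ} {s : ℂ} (hks : 1 < k + 2 * s.re) {v : ℝ} (hv : 0 < v) (m : ℕ)
    {c : ℕ} (hc : 0 < c) (d : ℤ) :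
    HasSum (fun l : ℤ => rowIntegral C k s v m (c, d + c * l))
      ((c : ℂ) ^ (-(k : ℂ) - 2 * s) * (star (rowCoeff C c d) *
        Complex.exp (2 * Real.pi * Complex.I * m * (d / c))) * archIntegral k s v m) := by
  have hcz : (c : ℤ) ≠ 0 := by exact_mod_cast hc.ne'
  let g : ℝ → ℂ := fun t => archKernel k s v t * Complex.exp (-(2 * Real.pi * Complex.I * (m : ℝ) * t))
  have hg : Integrable g := integrable_archIntegrand hks hv m
  -- The translates of `[0, 1]` by `l` tile the line, so the sum over `l` is an integral over `ℝ`;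
  -- the shift by `d/c` accounts for the phase `e(md/c)`.
  have h1 := (hg.comp_add_right ((d : ℝ) / c)).hasSum_intervalIntegral_comp_add_int
  rw [integral_add_right_eq_self g ((d : ℝ) / c)] at h1
  refine (h1.mul_left ((c : ℂ) ^ (-(k : ℂ) - 2 * s) * (star (rowCoeff C c d) *
    Complex.exp (2 * Real.pi * Complex.I * m * (d / c))))).congr_fun fun l => ?_
  rw [rowIntegral, ← intervalIntegral.integral_const_mul]
  refine intervalIntegral.integral_congr fun u _ => ?_
  simp only [g]
  rw [rowKernel_add k s hv hc, rowCoeff_add C _ _ hcz]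
  have h2 : Complex.exp (-(2 * Real.pi * Complex.I * m * u)) =
      Complex.exp (2 * Real.pi * Complex.I * m * (d / c)) *
        Complex.exp (-(2 * Real.pi * Complex.I * (m : ℝ) * ((u + l + d / c : ℝ) : ℂ))) := by
    rw [← Complex.exp_add, Complex.exp_eq_exp_iff_exists_int]
    refine ⟨m * l, ?_⟩
    push_cast
    ring
  rw [h2]
  ring

lemma tsum_rowIntegral {k : ℝ} {s : ℂ} (hks : 1 < k + 2 * s.re) {v : ℝ} (hv : 0 < v) (m : ℕ)
    {c : ℕ} (hc : 0 < c) (hsum : Summable fun d : ℤ => rowIntegral C k s v m (c, d)) :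
    ∑' d : ℤ, rowIntegral C k s v m (c, d) = (c : ℂ) ^ (-(k : ℂ) - 2 * s) *
      (star (weilConst Q Λ c) * unitGauss C.A C.b (C.c₀ - m) c) * archIntegral k s v m := by
  have : NeZero c := ⟨hc.ne'⟩
  have h1 := ((Equiv.prodComm (Fin c) ℤ).trans (Int.divModEquiv c).symm).hasSum_iff.2 hsum.hasSum
  have h2 := h1.prod_fiberwise (g := fun d : Fin c => (c : ℂ) ^ (-(k : ℂ) - 2 * s) *
    (star (rowCoeff C c d) * Complex.exp (2 * Real.pi * Complex.I * m * ((d : ℕ) / c))) *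
    archIntegral k s v m) fun d => by
      have h3 := hasSum_rowIntegral_add C hks hv m hc (d : ℕ)
      simp only [Int.cast_natCast] at h3
      refine h3.congr_fun fun l => ?_
      simp only [Function.comp_apply, Equiv.trans_apply, Equiv.prodComm_apply, Prod.swap_prod_mk,
        Int.divModEquiv_symm_apply]
      rw [add_comm, mul_comm]
  rw [h2.unique (hasSum_fintype _), ← sum_rowCoeff C c m, Finset.mul_sum, Finset.sum_mul,
    Finset.sum_range]

/-- The Fourier coefficients of the Eisenstein series: a Dirichlet series times an archimedean
integral. -/
lemma hasSum_eisensteinCoeff {n : ℕ} (C : CosetCoordinates Q Λ β (n + 2))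
    (hdim : finrank ℚ V = n + 2) (hsig : negSig Q = 2 - n) {s : ℂ}
    (hks : 2 < weight n + 2 * s.re) {v : ℝ} (hv : 0 < v) {m : ℕ} (hm : m ≠ 0) :
    HasSum (fun c : ℕ => 2 * (Complex.exp (Real.pi * Complex.I / 4) ^ (-negSig Q) /
        (Real.sqrt (disc Q Λ) : ℝ)) *
        (singularCoeff C.A C.b (C.c₀ - m) c * (c : ℂ) ^ (-(2 * s))) * archIntegral (weight n) s v m)
      (eisensteinCoeff Q Λ n β m s v hv) := by
  have h1 := hasSum_rowIntegral C hdim hks hv m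
  have hs : ∀ c : ℤ, Summable fun d : ℤ => rowIntegral C (weight n) s v m (c, d) :=
    fun c => h1.summable.prod_factor c
  -- Pairing `c` with `-c`, which contribute equally, accounts for the factor `2`.
  have h2 := (h1.prod_fiberwise fun c => (hs c).hasSum).nat_add_neg
  have h3 : ∀ c : ℕ, 0 < c → ∑' d : ℤ, rowIntegral C (weight n) s v m (-c, d) =
      ∑' d : ℤ, rowIntegral C (weight n) s v m (c, d) := by
    intro c hc
    rw [← (Equiv.neg ℤ).tsum_eq]
    refine tsum_congr fun d => ?_
    exact rowIntegral_neg C hsig s hv m (by exact_mod_cast hc) d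
  have h4 : ∑' d : ℤ, rowIntegral C (weight n) s v m (0, d) = 0 := by
    simp [rowIntegral_zero_left C _ s v hm]
  rw [h4, add_zero] at h2
  convert h2 using 1
  funext c
  rcases Nat.eq_zero_or_pos c with rfl | hc
  · simp [singularCoeff_zero, h4]
  · rw [h3 c hc, tsum_rowIntegral C (by linarith) hv m hc (hs c), weilConst,
      Int.sign_eq_one_of_pos (by exact_mod_cast hc), mul_one, singularCoeff, hdim, star_div₀,
      star_exp_pi_I_zpow]
    have hc0 : (c : ℂ) ≠ 0 := by exact_mod_cast hc.ne'
    have hc' : (0 : ℝ) < c := by exact_mod_cast hc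
    -- As `n + 2 = 2k`, the factor `c^(-k)` of the kernel and the factor `c^(-k)` of the Weil
    -- constant combine to the normalisation `c^(-(n+2))` of the singular series.
    have h5 : (c : ℂ) ^ (-(weight n : ℂ) - 2 * s) * (Real.sqrt ((c : ℝ) ^ (n + 2)) : ℂ)⁻¹ =
        (c : ℂ) ^ (-(2 * s)) / (c : ℂ) ^ (n + 2) := by
      have h6 : Real.sqrt ((c : ℝ) ^ (n + 2)) = (c : ℝ) ^ weight n := by
        rw [Real.sqrt_eq_rpow, ← Real.rpow_natCast_mul hc'.le]
        congr 1
        rw [weight]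
        push_cast
        ring
      have h7 : ((c : ℝ) ^ (n + 2)) = (c : ℝ) ^ weight n * (c : ℝ) ^ weight n := by
        rw [← h6, Real.mul_self_sqrt (by positivity)]
      have h8 : (c : ℂ) ^ (n + 2) = (c : ℂ) ^ (weight n : ℂ) * (c : ℂ) ^ (weight n : ℂ) := by
        have := congrArg Complex.ofReal h7
        rw [Complex.ofReal_mul, Complex.ofReal_cpow hc'.le] at this
        exact_mod_cast this
      have h9 : (c : ℂ) ^ (weight n : ℂ) ≠ 0 := by
        rw [Complex.cpow_ne_zero_iff]
        exact Or.inl hc0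
      rw [h6, Complex.ofReal_cpow hc'.le, h8, sub_eq_add_neg, Complex.cpow_add _ _ hc0,
        Complex.cpow_neg, Complex.ofReal_natCast]
      field_simp
    have h10 : star ((Real.sqrt (|((c : ℤ) : ℝ)| ^ (n + 2)) * Real.sqrt (disc Q Λ) : ℝ) : ℂ) =
        (Real.sqrt ((c : ℝ) ^ (n + 2)) : ℂ) * (Real.sqrt (disc Q Λ) : ℂ) := by
      rw [Int.cast_natCast, abs_of_pos hc']
      simp
    rw [h10]
    simp only [div_eq_mul_inv, mul_inv] at h5 ⊢
    linear_combination (-(2 * Complex.exp (Real.pi * Complex.I * 4⁻¹) ^ (-negSig Q) *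
      (Real.sqrt (disc Q Λ) : ℂ)⁻¹ * unitGauss C.A C.b (C.c₀ - m) c *
      archIntegral (weight n) s v m)) * h5

end Unfolding

/-! ### Dirichlet series near `s = 0` -/

section DirichletSeries

open Filter Topology

/-- The Dirichlet series `∑ a(c) c^(-2s)`. -/
def evenDirichlet (a : ℕ → ℂ) (s : ℂ) : ℂ := ∑' c : ℕ, a c * (c : ℂ) ^ (-(2 * s))

variable {a : ℕ → ℂ} {B : ℝ}

/-- For `|s| < 1/8` one has `|c^(-2s)| ≤ c^(1/4)`, and the exponent `-3/2 + 1/4 = -5/4` still gives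
convergence. -/
lemma norm_evenDirichlet_term_le (h0 : a 0 = 0) (ha : ∀ c, c ≠ 0 → ‖a c‖ ≤ B * (c : ℝ) ^ (-(3 / 2) : ℝ))
    (hB : 0 ≤ B) {s : ℂ} (hs : s ∈ Metric.ball (0 : ℂ) (1 / 8)) (c : ℕ) :
    ‖a c * (c : ℂ) ^ (-(2 * s))‖ ≤ B * (c : ℝ) ^ (-(5 / 4) : ℝ) := by
  rcases Nat.eq_zero_or_pos c with rfl | hc
  · rw [h0, zero_mul, norm_zero]
    positivity
  · have hc' : (1 : ℝ) ≤ c := by exact_mod_cast hc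
    have hs1 := (Complex.abs_re_le_norm s).trans (mem_ball_zero_iff.1 hs).le
    have hs2 := abs_le.1 hs1
    rw [norm_mul, Complex.norm_natCast_cpow_of_pos hc]
    have h1 : (-(2 * s)).re ≤ 1 / 4 := by
      simp only [Complex.neg_re, Complex.mul_re, Complex.re_ofNat, Complex.im_ofNat, zero_mul, sub_zero]
      linarith
    calc ‖a c‖ * (c : ℝ) ^ (-(2 * s)).re ≤ B * (c : ℝ) ^ (-(3 / 2) : ℝ) * (c : ℝ) ^ (1 / 4 : ℝ) :=
          mul_le_mul (ha c hc.ne') (Real.rpow_le_rpow_of_exponent_le hc' h1) (by positivity)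
            (by positivity)
      _ = B * (c : ℝ) ^ (-(5 / 4) : ℝ) := by
          rw [mul_assoc, ← Real.rpow_add (by linarith)]
          norm_num

lemma summable_evenDirichlet_bound (B : ℝ) :
    Summable fun c : ℕ => B * (c : ℝ) ^ (-(5 / 4) : ℝ) :=
  (Real.summable_nat_rpow.2 (by norm_num)).mul_left B

lemma differentiableOn_evenDirichlet (h0 : a 0 = 0)
    (ha : ∀ c, c ≠ 0 → ‖a c‖ ≤ B * (c : ℝ) ^ (-(3 / 2) : ℝ)) (hB : 0 ≤ B) :
    DifferentiableOn ℂ (evenDirichlet a) (Metric.ball 0 (1 / 8)) := by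
  refine Complex.differentiableOn_tsum_of_summable_norm (summable_evenDirichlet_bound B) (fun c => ?_)
    Metric.isOpen_ball fun c s hs => norm_evenDirichlet_term_le h0 ha hB hs c
  rcases Nat.eq_zero_or_pos c with rfl | hc
  · simp only [h0, zero_mul]
    exact differentiableOn_const _
  · intro s _
    have hc0 : (c : ℂ) ≠ 0 := by exact_mod_cast hc.ne'
    exact ((DifferentiableAt.const_cpow (by fun_prop) (Or.inl hc0)).const_mul _).differentiableWithinAt

/-- Cauchy's estimate on the circle of radius `1/16`. The bound depends on `B` only, hence not on
`m`. -/
lemma norm_deriv_evenDirichlet_le (h0 : a 0 = 0)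
    (ha : ∀ c, c ≠ 0 → ‖a c‖ ≤ B * (c : ℝ) ^ (-(3 / 2) : ℝ)) (hB : 0 ≤ B) :
    ‖deriv (evenDirichlet a) 0‖ ≤ (∑' c : ℕ, B * (c : ℝ) ^ (-(5 / 4) : ℝ)) / (1 / 16) := by
  have hsub : Metric.closedBall (0 : ℂ) (1 / 16) ⊆ Metric.ball 0 (1 / 8) :=
    Metric.closedBall_subset_ball (by norm_num)
  refine Complex.norm_deriv_le_of_forall_mem_sphere_norm_le (by norm_num)
    ((differentiableOn_evenDirichlet h0 ha hB).diffContOnCl_ball hsub) fun s hs => ?_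
  exact tsum_of_norm_bounded (summable_evenDirichlet_bound B).hasSum fun c =>
    norm_evenDirichlet_term_le h0 ha hB (hsub (Metric.sphere_subset_closedBall hs)) c

end DirichletSeries

/-! ### The derivative of `b(β, m, s)` at `s = k/2` -/

section Derivative

open Module QuadraticMap Filter Topology

variable {V : Type*} [AddCommGroup V] [Module ℚ V] {n : ℕ} {Q : QuadraticForm ℚ V}
  {Λ : Submodule ℤ V} {β : V} (C : CosetCoordinates Q Λ β (n + 2))

/-- The archimedean factor of `b(β, m, s + k / 2)`. -/
def archFactor (n : ℕ) (s : ℂ) : ℂ :=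
  archIntegral (weight n) s 1 (1 / (4 * Real.pi)) / curlyW n s 1 *
    ((s + weight n - 1) / ((2 * s + weight n - 1) * Complex.Gamma (s + 1)))

lemma one_lt_weight (hn : 3 ≤ n) : 5 / 2 ≤ weight n := by
  have : (3 : ℝ) ≤ n := by exact_mod_cast hn
  rw [weight]
  linarith

lemma differentiableAt_archFactor (hn : 3 ≤ n) : DifferentiableAt ℂ (archFactor n) 0 := by
  have hk := one_lt_weight hn
  have hk1 : (weight n : ℂ) - 1 ≠ 0 := by
    rw [← Complex.ofReal_one, ← Complex.ofReal_sub, Complex.ofReal_ne_zero]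
    linarith
  have hG : DifferentiableAt ℂ (fun s : ℂ => Complex.Gamma (s + 1)) 0 := by
    refine DifferentiableAt.comp (f := fun s : ℂ => s + 1) (g := Complex.Gamma) 0
      (Complex.differentiableAt_Gamma _ fun m h => ?_) (by fun_prop)
    have := congrArg Complex.re h
    simp at this
    linarith [(Nat.cast_nonneg m : (0 : ℝ) ≤ m)]
  refine DifferentiableAt.mul ?_ ?_
  · refine (differentiableAt_archIntegral (by linarith) _).div (differentiableAt_curlyW_one n) ?_
    rw [curlyW_zero_one]
    exact Complex.exp_ne_zero _
  · refine DifferentiableAt.div (by fun_prop) (DifferentiableAt.mul (by fun_prop) hG) ?_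
    simpa using hk1

lemma archFactor_zero (hn : 3 ≤ n) : archFactor n 0 =
    Complex.exp (-(Real.pi * Complex.I * weight n / 2)) *
      ((2 * Real.pi) ^ weight n * (1 / (4 * Real.pi)) ^ (weight n - 1) / Real.Gamma (weight n) : ℝ) := by
  have hk := one_lt_weight hn
  have hk1 : (weight n : ℂ) - 1 ≠ 0 := by
    rw [← Complex.ofReal_one, ← Complex.ofReal_sub, Complex.ofReal_ne_zero]
    linarith
  have h1 : Real.exp (-(2 * Real.pi * 1 * (1 / (4 * Real.pi)))) = Real.exp (-(1 / 2)) := by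
    congr 1
    field_simp
    norm_num
  have h2 : Complex.exp (-(1 / 2)) = ((Real.exp (-(1 / 2)) : ℝ) : ℂ) := by push_cast; rfl
  have h3 : ((Real.exp (-(1 / 2)) : ℝ) : ℂ) ≠ 0 := Complex.ofReal_ne_zero.2 (Real.exp_ne_zero _)
  rw [archFactor, archIntegral_zero (by linarith) one_pos (by positivity), curlyW_zero_one, h1, h2]
  simp only [zero_add, mul_zero, Complex.Gamma_one, mul_one, div_self hk1]
  rw [div_eq_iff h3]
  push_cast
  ring

/-- The constant factor of the Fourier coefficients. -/
def coeffConst (Q : QuadraticForm ℚ V) (Λ : Submodule ℤ V) : ℂ :=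
  2 * (Complex.exp (Real.pi * Complex.I / 4) ^ (-negSig Q) / (Real.sqrt (disc Q Λ) : ℝ))

/-- The signature fixes the phase: `exp(πi(n-2)/4 - πi(1 + n/2)/2) = exp(-πi)`. Thus `c(β, m)` is
minus a nonnegative multiple of the singular series, and the minus sign in the definition of `b`
compensates. -/
lemma coeffConst_mul_exp (hsig : negSig Q = 2 - n) :
    coeffConst Q Λ * Complex.exp (-(Real.pi * Complex.I * weight n / 2)) =
      -((2 / Real.sqrt (disc Q Λ) : ℝ) : ℂ) := by
  have h1 : Complex.exp (Real.pi * Complex.I / 4) ^ (-negSig Q) *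
      Complex.exp (-(Real.pi * Complex.I * weight n / 2)) = -1 := by
    rw [hsig, ← Complex.exp_int_mul, ← Complex.exp_add, weight,
      show (-1 : ℂ) = Complex.exp (-(Real.pi * Complex.I)) by
        rw [Complex.exp_neg, Complex.exp_pi_mul_I]; norm_num]
    congr 1
    push_cast
    ring
  rw [coeffConst]
  push_cast
  linear_combination (2 / (Real.sqrt (disc Q Λ) : ℂ)) * h1

/-- The finite part of the `m`-th Fourier coefficient. -/
def finitePart (m : ℕ) : ℂ → ℂ := evenDirichlet (singularCoeff C.A C.b (C.c₀ - m))

lemma eisensteinCoeff_eq (hdim : finrank ℚ V = n + 2) (hsig : negSig Q = 2 - n) {s : ℂ}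
    (hks : 2 < weight n + 2 * s.re) {v : ℝ} (hv : 0 < v) {m : ℕ} (hm : m ≠ 0) :
    eisensteinCoeff Q Λ n β m s v hv =
      coeffConst Q Λ * finitePart C m s * archIntegral (weight n) s v m := by
  rw [← (hasSum_eisensteinCoeff C hdim hsig hks hv hm).tsum_eq, tsum_mul_right, tsum_mul_left]
  rfl

/-- The common positive factor of the coefficients at `s = 0`. -/
def coeffScale (Q : QuadraticForm ℚ V) (Λ : Submodule ℤ V) (n m : ℕ) : ℝ :=
  2 / Real.sqrt (disc Q Λ) *
    ((2 * Real.pi) ^ weight n * (m : ℝ) ^ (weight n - 1) / Real.Gamma (weight n))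

lemma coeffScale_nonneg (hn : 3 ≤ n) (m : ℕ) : 0 ≤ coeffScale Q Λ n m := by
  have hk := one_lt_weight hn
  have : 0 < Real.Gamma (weight n) := Real.Gamma_pos_of_pos (by linarith)
  rw [coeffScale]
  positivity

lemma coeffC_eq (hn : 3 ≤ n) (hdim : finrank ℚ V = n + 2) (hsig : negSig Q = 2 - n) {m : ℕ}
    (hm : 0 < m) : coeffC Q Λ n β m = -(coeffScale Q Λ n m : ℂ) * finitePart C m 0 := by
  have hk := one_lt_weight hn
  have hm' : (0 : ℝ) < m := by exact_mod_cast hm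
  rw [coeffC, eisensteinCoeff_eq C hdim hsig (by simp; linarith) one_pos hm.ne',
    archIntegral_zero (by linarith) one_pos hm']
  have h1 : Complex.exp (2 * Real.pi * m) * ((Real.exp (-(2 * Real.pi * 1 * m)) : ℝ) : ℂ) = 1 := by
    rw [Complex.ofReal_exp, ← Complex.exp_add, Complex.exp_eq_one_iff]
    exact ⟨0, by push_cast; ring⟩
  have h2 := coeffConst_mul_exp (Λ := Λ) hsig
  rw [coeffScale]
  push_cast at h1 h2 ⊢
  linear_combination (finitePart C m 0 * Complex.exp (2 * Real.pi * m) *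
    (((2 * Real.pi) ^ weight n : ℝ) * ((m : ℝ) ^ (weight n - 1) : ℝ) *
      Complex.exp (-(2 * Real.pi * 1 * m)) / (Real.Gamma (weight n) : ℝ))) * h2 -
    (2 / (Real.sqrt (disc Q Λ) : ℂ) * finitePart C m 0 * (((2 * Real.pi) ^ weight n : ℝ) *
      ((m : ℝ) ^ (weight n - 1) : ℝ) / (Real.Gamma (weight n) : ℝ))) * h1

lemma smallB_eq (hdim : finrank ℚ V = n + 2) (hsig : negSig Q = 2 - n) {m : ℕ} (hm : 0 < m) {s : ℂ}
    (hks : 2 < weight n + 2 * (s - (weight n / 2 : ℝ)).re) :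
    smallB Q Λ n β m s = -coeffConst Q Λ * (finitePart C m (s - (weight n / 2 : ℝ)) *
      ((4 * Real.pi * m : ℝ) : ℂ) ^ (s - (weight n / 2 : ℝ) + (weight n - 1)) *
      archFactor n (s - (weight n / 2 : ℝ))) := by
  have hm' : (0 : ℝ) < m := by exact_mod_cast hm
  have h4 : 0 < 4 * Real.pi * m := by positivity
  have e0 : s - (weight n : ℂ) / 2 = s - (weight n / 2 : ℝ) := by push_cast; ring
  have e1 : s - 1 + (weight n : ℂ) / 2 = s - (weight n / 2 : ℝ) + weight n - 1 := by push_cast; ring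
  have e2 : 2 * s - 1 = 2 * (s - (weight n / 2 : ℝ)) + weight n - 1 := by push_cast; ring
  have e3 : s + 1 - (weight n : ℂ) / 2 = s - (weight n / 2 : ℝ) + 1 := by push_cast; ring
  rw [smallB, e0, e1, e2, e3]
  generalize s - (weight n / 2 : ℝ) = t at *
  have h5 : (m : ℝ) * (1 / (4 * Real.pi * m)) = 1 / (4 * Real.pi) := by
    field_simp
  have h6 : ((1 / (4 * Real.pi * m) : ℝ) : ℂ) ^ (1 - (weight n : ℂ) - t) =
      ((4 * Real.pi * m : ℝ) : ℂ) ^ (t + (weight n - 1)) := by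
    rw [one_div, Complex.ofReal_inv, Complex.inv_cpow, ← Complex.cpow_neg]
    · congr 1
      ring
    · rw [Complex.arg_ofReal_of_nonneg h4.le]
      exact Real.pi_pos.ne
  rw [bigC, dif_pos hm, eisensteinCoeff_eq C hdim hsig hks _ hm.ne', archIntegral_scale _ _ (by positivity),
    h5, h6, archFactor]
  ring

lemma differentiableAt_finitePart (hn : 3 ≤ n) (m : ℕ) : DifferentiableAt ℂ (finitePart C m) 0 :=
  (differentiableOn_evenDirichlet (singularCoeff_zero _ _ _)
    (fun _ hc => norm_singularCoeff_le' _ _ _ C.det_ne_zero (by omega) hc)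
    (gaussBound_nonneg C.A)).differentiableAt (Metric.ball_mem_nhds _ (by norm_num))

/-- Product rule for the factorisation in `smallB_eq`: the power contributes `log(4πm)` and the
nonvanishing `archFactor` a logarithmic derivative independent of `m`. -/
lemma hasDerivAt_smallB (hn : 3 ≤ n) (hdim : finrank ℚ V = n + 2) (hsig : negSig Q = 2 - n) {m : ℕ}
    (hm : 0 < m) : HasDerivAt (smallB Q Λ n β m)
      (coeffScale Q Λ n m * (deriv (finitePart C m) 0 + finitePart C m 0 *
        (Real.log (4 * Real.pi * m) + deriv (archFactor n) 0 / archFactor n 0)))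
      (weight n / 2 : ℝ) := by
  have hk := one_lt_weight hn
  have hm' : (0 : ℝ) < m := by exact_mod_cast hm
  have h4 : 0 < 4 * Real.pi * m := by positivity
  have h40 : ((4 * Real.pi * m : ℝ) : ℂ) ≠ 0 := Complex.ofReal_ne_zero.2 h4.ne'
  have hG : 0 < Real.Gamma (weight n) := Real.Gamma_pos_of_pos (by linarith)
  have hF := (differentiableAt_finitePart C hn m).hasDerivAt
  have hA := (differentiableAt_archFactor hn).hasDerivAt
  have hP : HasDerivAt (fun t : ℂ => ((4 * Real.pi * m : ℝ) : ℂ) ^ (t + ((weight n : ℂ) - 1)))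
      (((4 * Real.pi * m : ℝ) : ℂ) ^ ((0 : ℂ) + ((weight n : ℂ) - 1)) *
        Complex.log (4 * Real.pi * m : ℝ) * 1) 0 :=
    ((hasDerivAt_id (0 : ℂ)).add_const _).const_cpow (Or.inl h40)
  have hprod := ((hF.mul hP).mul hA).const_mul (-coeffConst Q Λ)
  have hpt : ((weight n / 2 : ℝ) : ℂ) - (weight n / 2 : ℝ) = 0 := sub_self _
  rw [← hpt] at hprod
  have hshift := HasDerivAt.comp_sub_const _ _ hprod
  rw [hpt] at hshift
  have hev : smallB Q Λ n β m =ᶠ[𝓝 ((weight n / 2 : ℝ) : ℂ)] fun s => -coeffConst Q Λ *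
      (finitePart C m (s - (weight n / 2 : ℝ)) *
      ((4 * Real.pi * m : ℝ) : ℂ) ^ (s - (weight n / 2 : ℝ) + (weight n - 1)) *
      archFactor n (s - (weight n / 2 : ℝ))) := by
    have hcont : Continuous fun s : ℂ => weight n + 2 * (s - (weight n / 2 : ℝ)).re := by fun_prop
    have hpos : ∀ᶠ s : ℂ in 𝓝 ((weight n / 2 : ℝ) : ℂ), 2 < weight n + 2 * (s - (weight n / 2 : ℝ)).re := by
      refine hcont.continuousAt.eventually_const_lt ?_
      simp only [sub_self, Complex.zero_re]
      linarith
    filter_upwards [hpos] with s hs using smallB_eq C hdim hsig hm hs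
  refine (hshift.congr_of_eventuallyEq hev).congr_deriv ?_
  have h0 : archFactor n 0 ≠ 0 := by
    rw [archFactor_zero hn]
    refine mul_ne_zero (Complex.exp_ne_zero _) (Complex.ofReal_ne_zero.2 ?_)
    positivity
  -- The powers of `4π` cancel, so that the prefactor of `b` at `k/2` is the scale of `c(β, m)`.
  have hscale : -coeffConst Q Λ * ((4 * Real.pi * m : ℝ) : ℂ) ^ ((weight n : ℂ) - 1) *
      archFactor n 0 = coeffScale Q Λ n m := by
    have h1 : ((4 * Real.pi * m : ℝ) : ℂ) ^ ((weight n : ℂ) - 1) =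
        (((4 * Real.pi * m) ^ (weight n - 1) : ℝ) : ℂ) := by
      rw [Complex.ofReal_cpow h4.le]
      push_cast
      rfl
    have h2 : (4 * Real.pi * m) ^ (weight n - 1) * (1 / (4 * Real.pi)) ^ (weight n - 1) =
        (m : ℝ) ^ (weight n - 1) := by
      rw [← Real.mul_rpow h4.le (by positivity)]
      congr 1
      field_simp
    have h3 := coeffConst_mul_exp (Λ := Λ) hsig
    rw [archFactor_zero hn, h1, coeffScale, ← h2]
    push_cast at h3 ⊢
    linear_combination (-((((4 * Real.pi * m) ^ (weight n - 1) : ℝ) : ℂ) *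
      ((((2 * Real.pi) ^ weight n : ℝ) : ℂ) *
      (((1 / (4 * Real.pi)) ^ (weight n - 1) : ℝ) : ℂ) / ((Real.Gamma (weight n) : ℝ) : ℂ)))) * h3
  rw [← hscale, ← Complex.ofReal_log h4.le]
  simp only [zero_add, mul_one, Pi.mul_apply]
  field_simp
  ring

end Derivative

/-! ### The asymptotic estimate -/

section Asymptotics

open Module QuadraticMap Filter Topology

variable {V : Type*} [AddCommGroup V] [Module ℚ V] {n : ℕ} {Q : QuadraticForm ℚ V}
  {Λ : Submodule ℤ V} {β : V} (C : CosetCoordinates Q Λ β (n + 2))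

lemma finitePart_zero (m : ℕ) :
    finitePart C m 0 = ∑' c, singularCoeff C.A C.b (C.c₀ - m) c := by
  simp [finitePart, evenDirichlet]

lemma finitePart_zero_eq_re (m : ℕ) :
    finitePart C m 0 = ((∑' c, singularCoeff C.A C.b (C.c₀ - m) c).re : ℂ) := by
  rw [finitePart_zero]
  refine (Complex.conj_eq_iff_re.1 ?_).symm
  rw [Complex.conj_tsum]
  refine tsum_congr fun c => ?_
  rw [← singularCoeff_re, Complex.conj_ofReal]

/-- The error term of the asymptotic formula is bounded by a multiple of the coefficient. -/
lemma exists_norm_deriv_smallB_sub_le (hn : 3 ≤ n) (hdim : finrank ℚ V = n + 2)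
    (hsig : negSig Q = 2 - n) {δ : ℝ} (hδ : 0 < δ) : ∃ K : ℝ, ∀ m : ℕ, 0 < m →
      δ ≤ (∑' c, singularCoeff C.A C.b (C.c₀ - m) c).re →
      ‖deriv (smallB Q Λ n β m) (weight n / 2 : ℝ) -
        ((‖coeffC Q Λ n β m‖ * Real.log m : ℝ) : ℂ)‖ ≤ K * ‖coeffC Q Λ n β m‖ := by
  let S : ℝ := (∑' c : ℕ, gaussBound C.A * (c : ℝ) ^ (-(5 / 4) : ℝ)) / (1 / 16)
  let a : ℂ := (Real.log (4 * Real.pi) : ℂ) + deriv (archFactor n) 0 / archFactor n 0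
  -- `S` bounds the derivative of the finite part for all `m`, and `F ≥ δ` turns this into `(S/δ)
  -- F`; `a` collects what is left of the logarithmic derivative after `log m` is removed.
  refine ⟨S / δ + ‖a‖, fun m hm hm' => ?_⟩
  have hT := coeffScale_nonneg (Q := Q) (Λ := Λ) hn m
  have hm0 : (m : ℝ) ≠ 0 := by exact_mod_cast hm.ne'
  have hS : ‖deriv (finitePart C m) 0‖ ≤ S :=
    norm_deriv_evenDirichlet_le (singularCoeff_zero _ _ _)
      (fun _ hc => norm_singularCoeff_le' _ _ _ C.det_ne_zero (by omega) hc) (gaussBound_nonneg C.A)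
  have hS0 : 0 ≤ S := (norm_nonneg _).trans hS
  rw [(hasDerivAt_smallB C hn hdim hsig hm).deriv, coeffC_eq C hn hdim hsig hm,
    finitePart_zero_eq_re C m]
  generalize (∑' c, singularCoeff C.A C.b (C.c₀ - m) c).re = F at *
  generalize deriv (finitePart C m) 0 = F' at *
  generalize coeffScale Q Λ n m = T at *
  have hF : 0 < F := hδ.trans_le hm'
  have h1 : ‖-(T : ℂ) * (F : ℂ)‖ = T * F := by
    rw [norm_mul, norm_neg, Complex.norm_real, Complex.norm_real, Real.norm_of_nonneg hT,
      Real.norm_of_nonneg hF.le]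
  have h2 : Real.log (4 * Real.pi * m) = Real.log (4 * Real.pi) + Real.log m :=
    Real.log_mul (by positivity) hm0
  have h3 : (T : ℂ) * (F' + F * ((Real.log (4 * Real.pi * m) : ℂ) +
      deriv (archFactor n) 0 / archFactor n 0)) - ((T * F * Real.log m : ℝ) : ℂ) =
      (T : ℂ) * (F' + F * a) := by
    simp only [a]
    rw [h2]
    push_cast
    ring
  rw [h1, h3, norm_mul, Complex.norm_real, Real.norm_of_nonneg hT]
  calc T * ‖F' + F * a‖ ≤ T * (S + F * ‖a‖) := by
        gcongr
        refine (norm_add_le _ _).trans (add_le_add hS ?_)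
        rw [norm_mul, Complex.norm_real, Real.norm_of_nonneg hF.le]
    _ ≤ T * (S / δ * F + F * ‖a‖) := by
        gcongr
        rw [div_mul_eq_mul_div, le_div_iff₀ hδ]
        gcongr
    _ = (S / δ + ‖a‖) * (T * F) := by ring

end Asymptotics

end GreenEstimate

end

/-! ### The main theorem -/

theorem mainTheorem8 {V : Type*} [AddCommGroup V] [Module ℚ V]
    (Q : QuadraticForm ℚ V) (n : ℕ) (hn : 3 ≤ n)
    (hdim : Module.finrank ℚ V = n + 2)
    (hpos : sigPos Q = n) (hneg : sigNeg Q = 2)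
    (L : Submodule ℤ V) [L.IsLattice ℚ]
    (hint : GreenEstimate.IsIntegralOn Q L) (hmax : GreenEstimate.IsMaximal Q L)
    (r : ℕ) (hr : 1 ≤ r) (β : L)
    (hβ : (GreenEstimate.orderMod r L β).Coprime (GreenEstimate.disc Q L))
    (D : ℕ) (hD : 1 ≤ D) :
    (∀ m : ℕ, 0 < m → DifferentiableAt ℂ
      (GreenEstimate.smallB Q (GreenEstimate.scale r L) n β m) (GreenEstimate.weight n / 2 : ℝ)) ∧
    (fun m : ℕ =>
        deriv (GreenEstimate.smallB Q (GreenEstimate.scale r L) n β m)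
            (GreenEstimate.weight n / 2 : ℝ) -
          ((‖GreenEstimate.coeffC Q (GreenEstimate.scale r L) n β m‖ * Real.log m : ℝ) : ℂ))
      =o[Filter.atTop ⊓ Filter.principal
          {m : ℕ | GreenEstimate.RepresentedBy Q L r β m ∧ ∃ j : ℕ, m = D * j ^ 2}]
    (fun m : ℕ =>
        GreenEstimate.coeffC Q (GreenEstimate.scale r L) n β m * (Real.log m : ℂ)) := by
  obtain ⟨C, δ, hδ, hC⟩ :=
    GreenEstimate.exists_cosetCoordinates Q n hn hdim hpos hneg L hint hmax r hr β hβ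
  have hsig : GreenEstimate.negSig Q = 2 - n := by
    rw [GreenEstimate.negSig, hpos, hneg]
    rfl
  refine ⟨fun m hm => (GreenEstimate.hasDerivAt_smallB C hn hdim hsig hm).differentiableAt, ?_⟩
  obtain ⟨K, hK⟩ := GreenEstimate.exists_norm_deriv_smallB_sub_le C hn hdim hsig hδ
  -- Since `1 = o(log m)`, an error `O(c(β, m))` is `o(c(β, m) log m)`.
  have h1 : (fun _ : ℕ => (1 : ℂ)) =o[Filter.atTop] fun m : ℕ => (Real.log m : ℂ) := by
    refine (Asymptotics.isLittleO_const_left.2 (Or.inr ?_))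
    refine (Filter.tendsto_abs_atTop_atTop.comp
      (Real.tendsto_log_atTop.comp tendsto_natCast_atTop_atTop)).congr fun m => ?_
    exact ((Complex.norm_real _).trans (Real.norm_eq_abs _)).symm
  have h2 : (fun m : ℕ => deriv (GreenEstimate.smallB Q (GreenEstimate.scale r L) n β m)
      (GreenEstimate.weight n / 2 : ℝ) -
      ((‖GreenEstimate.coeffC Q (GreenEstimate.scale r L) n β m‖ * Real.log m : ℝ) : ℂ))
      =O[Filter.atTop ⊓ Filter.principal
        {m : ℕ | GreenEstimate.RepresentedBy Q L r β m ∧ ∃ j : ℕ, m = D * j ^ 2}]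
      (fun m : ℕ => GreenEstimate.coeffC Q (GreenEstimate.scale r L) n β m) := by
    refine Asymptotics.IsBigO.of_bound K ?_
    rw [Filter.eventually_inf_principal]
    filter_upwards [Filter.eventually_gt_atTop 0] with m hm hrep
    exact hK m hm (hC m hrep.1)
  have h3 := h2.mul_isLittleO (h1.mono inf_le_left)
  simpa only [mul_one] using h3
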